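/- **Setting.** Let $r$ be fixed and let $X_t=\Lambda f_t+e_t$, $1\le t\le T$, be an $N$-dimensional static factor model without change points, with random factors $f_t\in\mathbb R^r$ ($t\in\mathbb Z$), loading matrix $\Lambda=[\lambda_1,\dots,\lambda_N]^\top\in\mathbb R^{N\times r}$ and idiosyncratic components $e_t=(e_{1,t},\dots,e_{N,t})^\top$. Write $X=[X_1,\dots,X_T]^\top$ and $G=[f_1,\dots,f_T]^\top$; $\|\cdot\|$ is the Euclidean (operator) norm; $\mathsf{Vech}(A)$ stacks the entries of a square matrix $A$ on and below its diagonal, and $\mathsf{Vec}(A)$ its columns; $L_r$, $K_r$ are the matrices with $\mathsf{Vech}(A)=L_r\mathsf{Vec}(A)$ for all $A\in\mathbb R^{r\times r}$ and $\mathsf{Vec}(A)=K_r\mathsf{Vech}(A)$ for all symmetric $A\in\mathbb R^{r\times r}$. **Assumptions.** Constants $\epsilon\in(0,1)$ and $c_0\in(0,\infty)$ may differ between items 1–4. 1. $\{f_t\}$ is an $\mathcal L_\nu$-decomposable Bernoulli shift for some $\nu\ge 8+\epsilon$ with decay exponent $a>2$: $f_t=h(\eta_t,\eta_{t-1},\dots)$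 with $h$ measurable and $\eta_t$ i.i.d. in a measurable space, $\mathsf E f_t=0$, $\mathsf E\|f_t\|^\nu<\infty$, and $(\mathsf E\|f_t-f^*_{t,l}\|^\nu)^{1/\nu}\le c_0l^{-a}$ for all $t$ and $l\ge1$, where $f^*_{t,l}$ is obtained from $f_t$ by replacing $\eta_{t-l},\eta_{t-l-1},\dots$ by independent copies that are independent of $\{\eta_t\}$. The matrix $\Sigma_F=\mathsf E(f_tf_t^\top)$ is positive definite, and the long-run variance matrix $D=\lim_{T\to\infty}T^{-1}\mathsf E(S_TS_T^\top)$, $S_T=\sum_{t=1}^T(\mathsf{Vech}(f_tf_t^\top)-\mathsf E\,\mathsf{Vech}(f_tf_t^\top))$, is invertible. 2. The $\lambda_i$ are deterministic, $\|\lambda_i\|\le c_0$ for all $i$, and $\|N^{-1}\Lambda^\top\Lambda-\Sigma_\Lambda\|\le c_0N^{-1/2}$ for all $N$, with $\Sigma_\Lambda$ positive definite. 3. With $\gamma_{s,t}=N^{-1}\sum_{i=1}^N\mathsf E(e_{i,s}e_{i,t})$, for all $N,T\ge1$, all $1\le i,j\le N$ and all $1\le s,t\le T$: $\mathsf E e_{i,t}=0$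 and $\mathsf E|e_{i,t}|^{8+\epsilon}<\infty$; $\sum_{t=1}^T|\gamma_{s,t}|\le c_0$; $\mathsf E|\sum_{i=1}^N(e_{i,t}e_{i,s}-\gamma_{s,t})|^{4+\epsilon}\le c_0N^{2+\epsilon/2}$; $\mathsf E\|\sum_{i=1}^N\lambda_ie_{i,t}\|^{8+\epsilon}\le c_0N^{4+\epsilon/2}$; $\sum_{j=1}^N|\mathsf E(e_{i,t}e_{j,t})|\le c_0$; $\mathsf E|\sum_{t=1}^T(e_{i,t}e_{j,t}-\mathsf E(e_{i,t}e_{j,t}))|^{4+\epsilon}\le c_0T^{2+\epsilon/2}$. 4. For all $N,T\ge1$, all $1\le s\le T$, $0\le a<b\le T$ and $1\le i,j\le N$: $\mathsf E\|\sum_{t=a+1}^bf_t\sum_{i=1}^N(e_{i,t}e_{i,s}-\gamma_{s,t})\|^{2+\epsilon}\le c_0(N(b-a))^{1+\epsilon/2}$; $\mathsf E|\sum_{i=1}^N\sum_{t=a+1}^b\lambda_i^\top f_te_{i,t}|^{4+\epsilon}\le c_0(N(b-a))^{2+\epsilon/2}$; $\mathsf E|\sum_{t=1}^T\lambda_i^\top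 f_te_{j,t}|^{4+\epsilon}\le c_0T^{2+\epsilon/2}$. 5. The eigenvalues of $\Sigma_F\Sigma_\Lambda$ are positive and distinct. 6. $N$ and $T$ tend to infinity along a path on which $T^{1/2+\epsilon_\circ}/N\to0$ for some $\epsilon_\circ>0$. **Estimators.** Let $\widehat G=[\widehat g_1,\dots,\widehat g_T]^\top$ consist of $\sqrt T$ times $r$ orthonormal leading eigenvectors of $(NT)^{-1}XX^\top$, let $\Phi_{NT}$ be the diagonal matrix of its $r$ largest eigenvalues, in decreasing order, and let $H=(NT)^{-1}(\Lambda^\top\Lambda)(G^\top\widehat G)\Phi_{NT}^{-1}$. For a bandwidth $m\ge1$ let $$\widehat V=\widehat\Gamma(0)+\sum_{\ell=1}^m\Big(1-\frac{\ell}{m+1}\Big)\big(\widehat\Gamma(\ell)+\widehat\Gamma(\ell)^\top\big),\qquad \widehat\Gamma(\ell)=\frac1T\sum_{t=\ell+1}^T\mathsf{Vech}(\widehat g_t\widehat g_t^\top-I_r)\,\mathsf{Vech}(\widehat g_{t-\ell}\widehat g_{t-\ell}^\top-I_r)^\top .$$ **Proposition.** Let Assumptions 1–6 hold, and let the integers $1\le\gamma<T$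 and $m\ge1$ satisfy, as $\min(N,T)\to\infty$, $$\frac{\log(T/\gamma)}{m}\to0\qquad\text{and}\qquad\frac{m\log(T/\gamma)}{\sqrt{\min(N,T)}}\to0 .$$ (i) There is a deterministic matrix $H_0$ such that, for every choice of the eigenvectors in $\widehat G$, their signs can be changed so that $H\to H_0$ in probability. (ii) Whenever the eigenvectors are chosen so that $H_0=\operatorname{plim}H$ exists, the matrix $V=L_r(H_0^\top\otimes H_0^\top)K_rDK_r^\top(H_0\otimes H_0)L_r^\top$ satisfies $$\|\widehat V-V\|=o_P\big(1/\log(T/\gamma)\big).$$ -/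

import Mathlib

open MeasureTheory ProbabilityTheory Filter Topology
open scoped ENNReal Matrix Kronecker
open scoped Matrix.Norms.L2Operator

namespace FactorHAC

noncomputable section

universe u v

variable {Ω : Type u} [MeasurableSpace Ω] {r : ℕ}

/-! ### Half-vectorisation -/

/-- Positions `(i, j)` on and below the main diagonal of an `r × r` matrix. -/
abbrev VechIdx (r : ℕ) : Type := {p : Fin r × Fin r // p.2 ≤ p.1}

/-- `Vech(A)`: the entries of `A` on and below the main diagonal. -/
def vech (A : Matrix (Fin r) (Fin r) ℝ) : VechIdx r → ℝ := fun p => A p.1.1 p.1.2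

/-- The matrix `L_r` with `Vech(A) = L_r Vec(A)`; `Matrix.vec A (j, i) = A i j`. -/
def elimMatrix (r : ℕ) : Matrix (VechIdx r) (Fin r × Fin r) ℝ :=
  Matrix.of fun p q => if q = (p.1.2, p.1.1) then 1 else 0

/-- The matrix `K_r` with `Vec(A) = K_r Vech(A)` for symmetric `A`. -/
def dupMatrix (r : ℕ) : Matrix (Fin r × Fin r) (VechIdx r) ℝ :=
  Matrix.of fun q p => if p.1 = (max q.1 q.2, min q.1 q.2) then 1 else 0

theorem elimMatrix_mulVec_vec (A : Matrix (Fin r) (Fin r) ℝ) :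
    elimMatrix r *ᵥ A.vec = vech A := by
  ext p
  simp [elimMatrix, vech, Matrix.mulVec, dotProduct, Matrix.vec]

theorem dupMatrix_mulVec_vech (A : Matrix (Fin r) (Fin r) ℝ) (hA : A.IsSymm) :
    dupMatrix r *ᵥ vech A = A.vec := by
  ext q
  obtain ⟨i, j⟩ := q
  have key : ∀ p : VechIdx r, (p.1 = (max i j, min i j)) ↔
      p = ⟨(max i j, min i j), min_le_max⟩ := fun p => by rw [Subtype.ext_iff]
  simp only [dupMatrix, vech, Matrix.mulVec, dotProduct, Matrix.vec, Matrix.of_apply, key,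
    ite_mul, one_mul, zero_mul, Finset.sum_ite_eq', Finset.mem_univ, if_true]
  rcases le_total i j with h | h
  · simp [h]
  · simp [h, hA.apply]

/-! ### Moments and Bernoulli shifts -/

/-- `E(‖X‖^p)`, as an extended non-negative number. -/
def absMoment {E : Type*} [NormedAddCommGroup E] (μ : Measure Ω) (X : Ω → E) (p : ℝ) : ℝ≥0∞ :=
  ∫⁻ ω, ‖X ω‖ₑ ^ p ∂μ

/-- The past `(x₀, x₁, …)` with all entries from position `l` on replaced by those of `y`. -/
def splice {S : Type v} (l : ℕ) (x y : ℕ → S) : ℕ → S := fun j => if j < l then x j else y j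

/-- `{x_t}` is an `L_ν`-decomposable Bernoulli shift with decay exponent `a`.
The independent copies of the innovations that enter the coupled variable `x*_{t,l}` are realised
as the second coordinate of the product space `(Ω × Ω, μ ⊗ μ)`. -/
def IsBernoulliShift {E : Type*} [NormedAddCommGroup E] [NormedSpace ℝ E] [MeasurableSpace E]
    (μ : Measure Ω) (ν a : ℝ) (x : ℤ → Ω → E) : Prop :=
  ∃ (S : Type v) (_ : MeasurableSpace S) (η : ℤ → Ω → S) (h : (ℕ → S) → E),
    Measurable h ∧
    (∀ t, Measurable (η t)) ∧ iIndepFun η μ ∧ (∀ t, IdentDistrib (η t) (η 0) μ μ) ∧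
    (∀ t, x t =ᵐ[μ] fun ω => h fun j : ℕ => η (t - j) ω) ∧
    (∀ t, MemLp (x t) (ENNReal.ofReal ν) μ) ∧ (∀ t, ∫ ω, x t ω ∂μ = 0) ∧
    ∃ c₀ : ℝ, 0 < c₀ ∧ ∀ (t : ℤ) (l : ℕ), 1 ≤ l →
      eLpNorm (fun w : Ω × Ω => h (fun j : ℕ => η (t - j) w.1) -
          h (splice l (fun j : ℕ => η (t - j) w.1) (fun j : ℕ => η (t - j) w.2)))
        (ENNReal.ofReal ν) (μ.prod μ) ≤ ENNReal.ofReal (c₀ * (l : ℝ) ^ (-a))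

/-! ### Assumptions on factors, loadings and idiosyncratic components -/

/-- `Σ_F = E(f_t f_tᵀ)` (it does not depend on `t` for a Bernoulli shift). -/
def sigmaF (μ : Measure Ω) (f : ℤ → Ω → EuclideanSpace ℝ (Fin r)) : Matrix (Fin r) (Fin r) ℝ :=
  Matrix.of fun i j => ∫ ω, f 0 ω i * f 0 ω j ∂μ

/-- `Vech(f_t f_tᵀ)`. -/
def vechF (f : ℤ → Ω → EuclideanSpace ℝ (Fin r)) (t : ℤ) (ω : Ω) : VechIdx r → ℝ :=
  vech (Matrix.vecMulVec (fun i => f t ω i) (fun i => f t ω i))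

/-- `T⁻¹ E{[∑_{t=1}^T (F_t - E F_t)] [∑_{t=1}^T (F_t - E F_t)]ᵀ}` for `F_t = Vech(f_t f_tᵀ)`. -/
def partialSumCov (μ : Measure Ω) (f : ℤ → Ω → EuclideanSpace ℝ (Fin r)) (T : ℕ) :
    Matrix (VechIdx r) (VechIdx r) ℝ :=
  Matrix.of fun p q => (T : ℝ)⁻¹ *
    ∫ ω, (∑ t ∈ Finset.Icc 1 T, (vechF f t ω p - ∫ ω', vechF f t ω' p ∂μ)) *
      (∑ t ∈ Finset.Icc 1 T, (vechF f t ω q - ∫ ω', vechF f t ω' q ∂μ)) ∂μ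

/-- The factors; `D` is the long-run variance matrix of `Vech(f_t f_tᵀ)`. -/
structure FactorAssumption (ρ : ℕ) (μ : Measure Ω) (f : ℤ → Ω → EuclideanSpace ℝ (Fin r))
    (D : Matrix (VechIdx r) (VechIdx r) ℝ) : Prop where
  shift : ∃ ε ν a : ℝ, 0 < ε ∧ ε < 1 ∧ 8 * ρ + ε ≤ ν ∧ 2 < a ∧ IsBernoulliShift.{u, v} μ ν a f
  posDef : (sigmaF μ f).PosDef
  longRun : Tendsto (partialSumCov μ f) atTop (𝓝 D)
  invertible : IsUnit D

/-- `Λ = [λ₁, …, λ_N]ᵀ`. -/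
def loadingMatrix (lam : ℕ → EuclideanSpace ℝ (Fin r)) (N : ℕ) : Matrix (Fin N) (Fin r) ℝ :=
  Matrix.of fun (i : Fin N) k => lam ((i : ℕ) + 1) k

/-- The loadings `λ₁, λ₂, …`, with limiting Gram matrix `Σ_Λ`. -/
def LoadingAssumption (lam : ℕ → EuclideanSpace ℝ (Fin r)) (SΛ : Matrix (Fin r) (Fin r) ℝ) :
    Prop :=
  SΛ.PosDef ∧ ∃ c₀ : ℝ, 0 < c₀ ∧ (∀ i, 1 ≤ i → ‖lam i‖ ≤ c₀) ∧
    ∀ N : ℕ, 1 ≤ N →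
      ‖(N : ℝ)⁻¹ • ((loadingMatrix lam N)ᵀ * loadingMatrix lam N) - SΛ‖
        ≤ c₀ * (N : ℝ) ^ (-(1 / 2) : ℝ)

/-- `γ_{s,t} = N⁻¹ ∑_{i=1}^N E(e_{i,s} e_{i,t})`. -/
def gammaST (μ : Measure Ω) (e : ℕ → ℕ → Ω → ℝ) (N s t : ℕ) : ℝ :=
  (N : ℝ)⁻¹ * ∑ i ∈ Finset.Icc 1 N, ∫ ω, e i s ω * e i t ω ∂μ

/-- The idiosyncratic components `e i t`, for `i, t ≥ 1`. -/
def IdiosyncraticAssumption (ρ : ℕ) (μ : Measure Ω) (lam : ℕ → EuclideanSpace ℝ (Fin r))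
    (e : ℕ → ℕ → Ω → ℝ) : Prop :=
  ∃ ε c₀ : ℝ, 0 < ε ∧ ε < 1 ∧ 0 < c₀ ∧ ∀ N T : ℕ, 1 ≤ N → 1 ≤ T →
    (∀ i ∈ Finset.Icc 1 N, ∀ t ∈ Finset.Icc 1 T,
      MemLp (e i t) (ENNReal.ofReal (8 + ε)) μ ∧ ∫ ω, e i t ω ∂μ = 0) ∧
    (∀ s ∈ Finset.Icc 1 T, ∑ t ∈ Finset.Icc 1 T, |gammaST μ e N s t| ≤ c₀) ∧
    (∀ s ∈ Finset.Icc 1 T, ∀ t ∈ Finset.Icc 1 T,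
      absMoment μ (fun ω => ∑ i ∈ Finset.Icc 1 N, (e i t ω * e i s ω - gammaST μ e N s t))
        (4 + ε) ≤ ENNReal.ofReal (c₀ * (N : ℝ) ^ (2 + ε / 2))) ∧
    (∀ t ∈ Finset.Icc 1 T,
      absMoment μ (fun ω => ∑ i ∈ Finset.Icc 1 N, e i t ω • lam i)
        (8 + ε) ≤ ENNReal.ofReal (c₀ * (N : ℝ) ^ (4 + ε / 2))) ∧
    (∀ i ∈ Finset.Icc 1 N, ∀ t ∈ Finset.Icc 1 T,
      ∑ j ∈ Finset.Icc 1 N, |∫ ω, e i t ω * e j t ω ∂μ| ≤ c₀) ∧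
    (∀ i ∈ Finset.Icc 1 N, ∀ j ∈ Finset.Icc 1 N,
      absMoment μ (fun ω => ∑ t ∈ Finset.Icc 1 T,
          (e i t ω * e j t ω - ∫ ω', e i t ω' * e j t ω' ∂μ))
        (4 * ρ + ε) ≤ ENNReal.ofReal (c₀ * (T : ℝ) ^ (2 * ρ + ε / 2)))

/-- Joint moment conditions on the (pseudo) factors `g`, the loadings and the idiosyncratic
components. -/
def DependenceAssumption (ρ : ℕ) (μ : Measure Ω) (lam : ℕ → EuclideanSpace ℝ (Fin r))
    (g : ℤ → Ω → EuclideanSpace ℝ (Fin r)) (e : ℕ → ℕ → Ω → ℝ) : Prop :=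
  ∃ ε c₀ : ℝ, 0 < ε ∧ ε < 1 ∧ 0 < c₀ ∧ ∀ N T : ℕ, 1 ≤ N → 1 ≤ T →
    (∀ s ∈ Finset.Icc 1 T, ∀ a b : ℕ, a < b → b ≤ T →
      absMoment μ (fun ω => ∑ t ∈ Finset.Icc (a + 1) b,
          (∑ i ∈ Finset.Icc 1 N, (e i t ω * e i s ω - gammaST μ e N s t)) • g t ω)
        (2 * ρ + ε) ≤ ENNReal.ofReal (c₀ * ((N : ℝ) * ((b : ℝ) - a)) ^ (ρ + ε / 2))) ∧
    (∀ a b : ℕ, a < b → b ≤ T →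
      absMoment μ (fun ω => ∑ i ∈ Finset.Icc 1 N, ∑ t ∈ Finset.Icc (a + 1) b,
          inner ℝ (lam i) (g t ω) * e i t ω)
        (4 * ρ + ε) ≤ ENNReal.ofReal (c₀ * ((N : ℝ) * ((b : ℝ) - a)) ^ (2 * ρ + ε / 2))) ∧
    (∀ i ∈ Finset.Icc 1 N, ∀ j ∈ Finset.Icc 1 N,
      absMoment μ (fun ω => ∑ t ∈ Finset.Icc 1 T, inner ℝ (lam i) (g t ω) * e j t ω)
        (4 * ρ + ε) ≤ ENNReal.ofReal (c₀ * (T : ℝ) ^ (2 * ρ + ε / 2)))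

/-- The eigenvalues of `M` (with multiplicity) are real, positive and distinct. -/
def HasPositiveDistinctEigenvalues (M : Matrix (Fin r) (Fin r) ℝ) : Prop :=
  ∃ d : Fin r → ℝ, Function.Injective d ∧ (∀ i, 0 < d i) ∧
    M.charpoly = ∏ i, (Polynomial.X - Polynomial.C (d i))

/-! ### The data, the estimated factors and the HAC estimator -/

/-- `G`, with rows `g_1ᵀ, …, g_Tᵀ`. -/
def factorMatrix (g : ℤ → Ω → EuclideanSpace ℝ (Fin r)) (T : ℕ) (ω : Ω) :
    Matrix (Fin T) (Fin r) ℝ :=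
  Matrix.of fun (t : Fin T) k => g (((t : ℕ) : ℤ) + 1) ω k

/-- The data matrix `X = G Λᵀ + E`, with rows `X_tᵀ = (Λ g_t + e_t)ᵀ`, `1 ≤ t ≤ T`. -/
def dataMatrix (lam : ℕ → EuclideanSpace ℝ (Fin r)) (g : ℤ → Ω → EuclideanSpace ℝ (Fin r))
    (e : ℕ → ℕ → Ω → ℝ) (N T : ℕ) (ω : Ω) : Matrix (Fin T) (Fin N) ℝ :=
  factorMatrix g T ω * (loadingMatrix lam N)ᵀ +
    Matrix.of fun (t : Fin T) (i : Fin N) => e ((i : ℕ) + 1) ((t : ℕ) + 1) ω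

/-- `(NT)⁻¹ X Xᵀ`. -/
def gramMatrix {N T : ℕ} (X : Matrix (Fin T) (Fin N) ℝ) : Matrix (Fin T) (Fin T) ℝ :=
  ((N : ℝ) * T)⁻¹ • (X * Xᵀ)

theorem gramMatrix_isHermitian {N T : ℕ} (X : Matrix (Fin T) (Fin N) ℝ) :
    (gramMatrix X).IsHermitian := by
  simp [gramMatrix, Matrix.IsHermitian, Matrix.conjTranspose_eq_transpose_of_trivial,
    Matrix.transpose_smul, Matrix.transpose_mul]

/-- `Φ_{NT}`: the diagonal matrix of the `r` largest eigenvalues of `(NT)⁻¹ X Xᵀ`, in decreasing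
order and counted with multiplicity (padded by zeros in the irrelevant case `T < r`). -/
def phiMatrix {N T : ℕ} (r : ℕ) (X : Matrix (Fin T) (Fin N) ℝ) : Matrix (Fin r) (Fin r) ℝ :=
  Matrix.diagonal fun k =>
    if h : (k : ℕ) < Fintype.card (Fin T) then (gramMatrix_isHermitian X).eigenvalues₀ ⟨k, h⟩
    else 0

/-- The columns of `Ghat` are `√T` times `r` orthonormal leading eigenvectors of `(NT)⁻¹ X Xᵀ`. -/
def IsFactorEstimator {N T : ℕ} (X : Matrix (Fin T) (Fin N) ℝ) (Ghat : Matrix (Fin T) (Fin r) ℝ) :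
    Prop :=
  Ghatᵀ * Ghat = (T : ℝ) • (1 : Matrix (Fin r) (Fin r) ℝ) ∧
    gramMatrix X * Ghat = Ghat * phiMatrix r X

/-- `H = (NT)⁻¹ (Λᵀ Λ) (Gᵀ Ghat) Φ_{NT}⁻¹`. -/
def rotation (lam : ℕ → EuclideanSpace ℝ (Fin r)) (g : ℤ → Ω → EuclideanSpace ℝ (Fin r))
    (e : ℕ → ℕ → Ω → ℝ) (N T : ℕ) (ω : Ω) (Ghat : Matrix (Fin T) (Fin r) ℝ) :
    Matrix (Fin r) (Fin r) ℝ :=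
  ((N : ℝ) * T)⁻¹ • (((loadingMatrix lam N)ᵀ * loadingMatrix lam N) *
    ((factorMatrix g T ω)ᵀ * Ghat) * (phiMatrix r (dataMatrix lam g e N T ω))⁻¹)

/-- `Vech(ĝ_t ĝ_tᵀ - I_r)`, where `ĝ_tᵀ` is the `t`-th row of `Ghat`. -/
def scoreVec {T : ℕ} (Ghat : Matrix (Fin T) (Fin r) ℝ) (t : Fin T) : VechIdx r → ℝ :=
  vech (Matrix.vecMulVec (Ghat t) (Ghat t) - 1)

/-- The lag-`l` sample autocovariance: the sum over the pairs `(t, t - l)` of times in the sample,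
divided by `T`. -/
def gammaHat {T : ℕ} (Ghat : Matrix (Fin T) (Fin r) ℝ) (l : ℕ) :
    Matrix (VechIdx r) (VechIdx r) ℝ :=
  (T : ℝ)⁻¹ • ∑ p : Fin T × Fin T with (p.1 : ℕ) = p.2 + l,
    Matrix.vecMulVec (scoreVec Ghat p.1) (scoreVec Ghat p.2)

/-- The HAC estimator with Bartlett weights and bandwidth `m`. -/
def hacEstimator {T : ℕ} (Ghat : Matrix (Fin T) (Fin r) ℝ) (m : ℕ) :
    Matrix (VechIdx r) (VechIdx r) ℝ :=
  gammaHat Ghat 0 + ∑ l ∈ Finset.Icc 1 m,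
    (1 - (l : ℝ) / ((m : ℝ) + 1)) • (gammaHat Ghat l + (gammaHat Ghat l)ᵀ)

/-- `V = L_r (H₀ᵀ ⊗ H₀ᵀ) K_r D K_rᵀ (H₀ ⊗ H₀) L_rᵀ`. -/
def longRunV (H₀ : Matrix (Fin r) (Fin r) ℝ) (D : Matrix (VechIdx r) (VechIdx r) ℝ) :
    Matrix (VechIdx r) (VechIdx r) ℝ :=
  elimMatrix r * (H₀ᵀ ⊗ₖ H₀ᵀ) * dupMatrix r * D * (dupMatrix r)ᵀ * (H₀ ⊗ₖ H₀) * (elimMatrix r)ᵀ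

/-- `X_n = o_P(a_n)` as `n → ∞`. -/
def IsLittleOP (μ : Measure Ω) (X : ℕ → Ω → ℝ) (a : ℕ → ℝ) : Prop :=
  TendstoInMeasure μ (fun n ω => X n ω / a n) atTop (fun _ => 0)

/-- A sequence of random matrices converges in probability to the constant matrix `H₀`. -/
def IsPLim (μ : Measure Ω) (H : ℕ → Ω → Matrix (Fin r) (Fin r) ℝ)
    (H₀ : Matrix (Fin r) (Fin r) ℝ) : Prop :=
  IsLittleOP μ (fun n ω => ‖H n ω - H₀‖) (fun _ => 1)

end

end FactorHAC

/-! Write δ = min(N, T)^(-1/2) and L = log(T/γ). The error splits in two. The HAC estimator built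
from the unobservable scores Vech(f_t f_tᵀ - Σ_F) differs from D by O_P(m/√T) + O(1/m). Replacing
the factors by their estimates costs a further O_P(m δ), after the scores have been transported by
the linear map that S ↦ H₀ᵀ S H₀ induces. The conditions m L δ → 0 and L/m → 0 make both errors
o_P(1/L).

True scores (`FactorAssumption.exists_bounds`). The factors are functions of the past of an i.i.d.
sequence. Exchanging the remote past with an independent copy preserves the joint law, so a centred
product of factor coordinates is uncorrelated with the remote past up to its coupling error, which
decays like a power of the lag. For products at lag l, either the two time pairs are far apart
relative to l, and nearly independent, or l itself is large, and every term is small. The resulting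
covariance bound is uniform in l. Each sample autocovariance thus has mean absolute error of order
T^(-1/2), and the m + 1 lags add up. For the bias, T⁻¹ E(S_T S_Tᵀ) is itself a Bartlett sum with
bandwidth T - 1. Hence D is the limit of the population Bartlett sums, and ∑ l |Γ(l)| < ∞, which
holds because a > 2, gives the rate 1/m.

Estimated factors (`exists_rotation_limit`). The eigenvector equation reads (Ghat - G H) Φ = R,
where R collects the idiosyncratic terms and has entries with average fourth power O(δ⁴), while Φ
stays away from zero. Projected on G, it makes Q = T⁻¹ Gᵀ Ghat an approximate solution of Q Φ = Σ_F
Σ_Λ Q with Qᵀ Σ_Λ Q = Φ. As the eigenvalues are distinct, Q, and with it H, is within O(δ) of one of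
finitely many sign variants of a fixed matrix Hs satisfying Hsᵀ Σ_F Hs = I. All of this is
deterministic under `IsRegular`, a condition that holds with probability close to one by Markov's
inequality (`exists_isRegular`).

Convergence of H to H₀ carries no rate by itself. The rate comes from finiteness: H₀ has to be one
of the sign variants, and H is within O(δ) of the nearest one. The same fact gives H₀ᵀ Σ_F H₀ = I,
so that centring the estimated scores at I matches centring the true ones at Σ_F. -/

namespace FactorHAC
-- I.i.d. sequences and resampling of the remote past
section Iid
variable {S : Type*} [MeasurableSpace S] (ρ : Measure S) [IsProbabilityMeasure ρ]
/-- The law of a doubly infinite i.i.d. sequence with marginal law `ρ`. -/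
noncomputable abbrev iidLaw : Measure (ℤ → S) := Measure.infinitePi fun _ => ρ
/-- The sequence `x` with all entries up to time `c` replaced by those of `y`. -/
def cutMix {S : Type*} (c : ℤ) (x y : ℤ → S) : ℤ → S := fun j => if j ≤ c then y j else x j
/-- The past `(x_t, x_{t-1}, …)` of a doubly infinite sequence. -/
def past {S : Type*} (t : ℤ) (x : ℤ → S) : ℕ → S := fun j => x (t - j)
theorem measurable_cutMix (c : ℤ) :
    Measurable fun p : (ℤ → S) × (ℤ → S) => cutMix c p.1 p.2 := by
  refine measurable_pi_iff.2 fun j => ?_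
  unfold cutMix
  split_ifs <;> fun_prop
theorem measurable_past (t : ℤ) : Measurable (past t : (ℤ → S) → ℕ → S) := by
  unfold past; fun_prop
-- Two independent sequences form one i.i.d. family indexed by ℤ ⊕ ℤ. Exchanging entries between
-- them then becomes an injective reindexing of a single product measure.
theorem map_sumElim_iidLaw_prod :
    ((iidLaw ρ).prod (iidLaw ρ)).map (fun p k => (Sum.elim p.1 p.2 k : S)) =
      Measure.infinitePi fun _ : ℤ ⊕ ℤ => ρ := by
  refine Measure.eq_infinitePi _ fun s t ht => ?_
  have hmeas : Measurable fun (p : (ℤ → S) × (ℤ → S)) (k : ℤ ⊕ ℤ) => (Sum.elim p.1 p.2 k : S) := by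
    refine measurable_pi_iff.2 fun k => ?_
    cases k <;> simp <;> fun_prop
  rw [Measure.map_apply hmeas (MeasurableSet.pi s.countable_toSet fun i _ => ht i)]
  have : (fun (p : (ℤ → S) × (ℤ → S)) (k : ℤ ⊕ ℤ) => (Sum.elim p.1 p.2 k : S)) ⁻¹' (Set.pi s t) =
      (Set.pi s.toLeft fun i => t (Sum.inl i)) ×ˢ (Set.pi s.toRight fun i => t (Sum.inr i)) := by
    ext p
    simp [Set.mem_pi]
  rw [this, Measure.prod_prod, Measure.infinitePi_pi _ (fun i _ => ht _),
    Measure.infinitePi_pi _ (fun i _ => ht _), Finset.prod_sum_eq_prod_toLeft_mul_prod_toRight]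
/-- Exchanging the entries up to time `c` of two independent i.i.d. sequences preserves their
joint law. -/
theorem measurePreserving_exchange (c : ℤ) :
    MeasurePreserving (fun p : (ℤ → S) × (ℤ → S) => (cutMix c p.1 p.2, cutMix c p.2 p.1))
      ((iidLaw ρ).prod (iidLaw ρ)) ((iidLaw ρ).prod (iidLaw ρ)) := by
  have hcm : Measurable fun p : (ℤ → S) × (ℤ → S) => (cutMix c p.1 p.2, cutMix c p.2 p.1) :=
    (measurable_cutMix c).prodMk ((measurable_cutMix c).comp measurable_swap)
  refine ⟨hcm, ?_⟩
  -- The exchange as a map of indices: the two copies of j are swapped when j ≤ c and kept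
  -- otherwise.
  let σ : ℤ ⊕ ℤ → ℤ ⊕ ℤ := Sum.elim (fun j => if j ≤ c then Sum.inr j else Sum.inl j)
    (fun j => if j ≤ c then Sum.inl j else Sum.inr j)
  have hσ : Function.Injective σ := by
    rintro (i | i) (j | j) h <;> simp only [σ, Sum.elim_inl, Sum.elim_inr] at h <;>
      split_ifs at h <;> grind
  let Θ : (ℤ ⊕ ℤ → S) → (ℤ → S) × (ℤ → S) := fun z => (fun j => z (Sum.inl j), fun j => z (Sum.inr j))
  have hΘ : Measurable Θ := by fun_prop
  have hE : Measurable fun (p : (ℤ → S) × (ℤ → S)) (k : ℤ ⊕ ℤ) => (Sum.elim p.1 p.2 k : S) := by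
    refine measurable_pi_iff.2 fun k => ?_
    cases k <;> simp <;> fun_prop
  have hs : Measurable fun (z : ℤ ⊕ ℤ → S) k => z (σ k) := by fun_prop
  have h1 : (fun p : (ℤ → S) × (ℤ → S) => (cutMix c p.1 p.2, cutMix c p.2 p.1)) =
      Θ ∘ (fun z k => z (σ k)) ∘ (fun p k => (Sum.elim p.1 p.2 k : S)) := by
    funext p
    refine Prod.ext ?_ ?_ <;> funext j <;> simp only [Θ, σ, cutMix, Function.comp, Sum.elim_inl,
      Sum.elim_inr] <;> split_ifs <;> rfl
  have h2 : Θ ∘ (fun p k => (Sum.elim p.1 p.2 k : S)) = id := by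
    funext p
    rfl
  rw [h1, ← Measure.map_map hΘ (hs.comp hE), ← Measure.map_map hs hE, map_sumElim_iidLaw_prod,
    Measure.map_infinitePi_infinitePi_of_inj (P := fun _ => ρ) hσ, ← map_sumElim_iidLaw_prod,
    Measure.map_map hΘ hE, h2, Measure.map_id]
theorem measurePreserving_cutMix (c : ℤ) :
    MeasurePreserving (fun p : (ℤ → S) × (ℤ → S) => cutMix c p.1 p.2)
      ((iidLaw ρ).prod (iidLaw ρ)) (iidLaw ρ) :=
  measurePreserving_fst.comp (measurePreserving_exchange ρ c)
theorem measurePreserving_shift (t : ℤ) :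
    MeasurePreserving (fun (x : ℤ → S) j => x (j + t)) (iidLaw ρ) (iidLaw ρ) :=
  ⟨by fun_prop, Measure.map_infinitePi_infinitePi_of_inj (P := fun _ => ρ)
    (add_left_injective t)⟩
-- Measurability of the integrand replaces the assumption that φ is an embedding, which projections
-- and mixings are not.
theorem integral_comp_of_measurePreserving {α β : Type*} [MeasurableSpace α] [MeasurableSpace β]
    {μ : Measure α} {ν : Measure β} {φ : α → β} (hφ : MeasurePreserving φ μ ν) {g : β → ℝ}
    (hg : AEStronglyMeasurable g ν) : ∫ x, g (φ x) ∂μ = ∫ y, g y ∂ν := by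
  rw [← hφ.map_eq, integral_map hφ.measurable.aemeasurable (hφ.map_eq ▸ hg)]
/-- A function of the entries up to time `c` is uncorrelated with any function of the sequence in
which these entries are replaced by independent copies. -/
theorem integral_mul_cutMix (c : ℤ) {A B : (ℤ → S) → ℝ} (hA : Measurable A) (hB : Measurable B)
    (hAc : ∀ x y : ℤ → S, (∀ j ≤ c, x j = y j) → A x = A y) :
    ∫ p, A p.1 * B (cutMix c p.1 p.2) ∂((iidLaw ρ).prod (iidLaw ρ)) =
      (∫ x, A x ∂iidLaw ρ) * ∫ x, B x ∂iidLaw ρ := by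
  -- `A` sees only the entries up to c, so it can be read off the second component of the exchanged
  -- pair, while `B` is read off the first. The exchanged pair has independent components.
  have h1 : ∀ p : (ℤ → S) × (ℤ → S), A p.1 * B (cutMix c p.1 p.2) =
      (fun q : (ℤ → S) × (ℤ → S) => B q.1 * A q.2) (cutMix c p.1 p.2, cutMix c p.2 p.1) := by
    intro p
    have : A p.1 = A (cutMix c p.2 p.1) := hAc _ _ fun j hj => by simp [cutMix, hj]
    simp only [this]
    ring
  simp_rw [h1]
  rw [integral_comp_of_measurePreserving (measurePreserving_exchange ρ c)
    (g := fun q : (ℤ → S) × (ℤ → S) => B q.1 * A q.2) (((hB.comp measurable_fst).mul (hA.comp measurable_snd)).aestronglyMeasurable),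
    integral_prod_mul, mul_comm]
end Iid
/-- The product of four random variables with bounded fourth moments, the first of which is
small. -/
theorem integral_mul_four_le {α : Type*} [MeasurableSpace α] {P : Measure α}
    {X₁ X₂ X₃ X₄ : α → ℝ} {C δ : ℝ} (hδ : 0 < δ)
    (m₁ : AEStronglyMeasurable X₁ P) (m₂ : AEStronglyMeasurable X₂ P)
    (m₃ : AEStronglyMeasurable X₃ P) (m₄ : AEStronglyMeasurable X₄ P)
    (h₁ : Integrable (fun x => X₁ x ^ 4) P) (h₂ : Integrable (fun x => X₂ x ^ 4) P)
    (h₃ : Integrable (fun x => X₃ x ^ 4) P) (h₄ : Integrable (fun x => X₄ x ^ 4) P)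
    (b₁ : ∫ x, X₁ x ^ 4 ∂P ≤ C * δ ^ 4) (b₂ : ∫ x, X₂ x ^ 4 ∂P ≤ C)
    (b₃ : ∫ x, X₃ x ^ 4 ∂P ≤ C) (b₄ : ∫ x, X₄ x ^ 4 ∂P ≤ C) :
    Integrable (fun x => X₁ x * X₂ x * X₃ x * X₄ x) P ∧
      |∫ x, X₁ x * X₂ x * X₃ x * X₄ x ∂P| ≤ C * δ := by
  have hint : Integrable (fun x => δ / 4 * (X₁ x ^ 4 / δ ^ 4 + X₂ x ^ 4 + X₃ x ^ 4 + X₄ x ^ 4)) P :=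
    ((((h₁.div_const _).add h₂).add h₃).add h₄).const_mul _
  have key : ∀ x, |X₁ x * X₂ x * X₃ x * X₄ x| ≤
      δ / 4 * (X₁ x ^ 4 / δ ^ 4 + X₂ x ^ 4 + X₃ x ^ 4 + X₄ x ^ 4) := by
    intro x
    -- Scaling out δ puts the four factors on the same footing. Pointwise AM-GM for fourth powers
    -- then does the work of Hölder's inequality.
    obtain ⟨y, hy⟩ : ∃ y, X₁ x = δ * y := ⟨X₁ x / δ, by field_simp⟩
    have h : (δ * y) ^ 4 / δ ^ 4 = y ^ 4 := by field_simp
    rw [hy, h]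
    have h4 : |y * X₂ x * X₃ x * X₄ x| ≤ (y ^ 4 + X₂ x ^ 4 + X₃ x ^ 4 + X₄ x ^ 4) / 4 := by
      rw [abs_le]
      constructor <;>
        nlinarith [sq_nonneg (y * X₂ x + X₃ x * X₄ x), sq_nonneg (y * X₂ x - X₃ x * X₄ x),
          sq_nonneg (y ^ 2 - X₂ x ^ 2), sq_nonneg (X₃ x ^ 2 - X₄ x ^ 2)]
    calc |δ * y * X₂ x * X₃ x * X₄ x| = δ * |y * X₂ x * X₃ x * X₄ x| := by
          rw [← abs_of_pos hδ, ← abs_mul, abs_of_pos hδ]; ring_nf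
      _ ≤ δ * ((y ^ 4 + X₂ x ^ 4 + X₃ x ^ 4 + X₄ x ^ 4) / 4) := by gcongr
      _ = _ := by ring
  have hi : Integrable (fun x => X₁ x * X₂ x * X₃ x * X₄ x) P :=
    hint.mono' (((m₁.mul m₂).mul m₃).mul m₄) (ae_of_all _ key)
  refine ⟨hi, ?_⟩
  calc |∫ x, X₁ x * X₂ x * X₃ x * X₄ x ∂P|
      ≤ ∫ x, |X₁ x * X₂ x * X₃ x * X₄ x| ∂P := abs_integral_le_integral_abs
    _ ≤ ∫ x, δ / 4 * (X₁ x ^ 4 / δ ^ 4 + X₂ x ^ 4 + X₃ x ^ 4 + X₄ x ^ 4) ∂P :=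
        integral_mono hi.abs hint key
    _ = δ / 4 * ((∫ x, X₁ x ^ 4 ∂P) / δ ^ 4 + ∫ x, X₂ x ^ 4 ∂P + ∫ x, X₃ x ^ 4 ∂P +
          ∫ x, X₄ x ^ 4 ∂P) := by
        have i₂ : Integrable (fun x => X₁ x ^ 4 / δ ^ 4 + X₂ x ^ 4) P := (h₁.div_const _).add h₂
        have i₃ : Integrable (fun x => X₁ x ^ 4 / δ ^ 4 + X₂ x ^ 4 + X₃ x ^ 4) P := i₂.add h₃
        rw [integral_const_mul, integral_add i₃ h₄, integral_add i₂ h₃,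
          integral_add (h₁.div_const _) h₂, integral_div]
    _ ≤ δ / 4 * (C + C + C + C) := by
        have : (∫ x, X₁ x ^ 4 ∂P) / δ ^ 4 ≤ C := by
          rw [div_le_iff₀ (by positivity)]; exact b₁
        gcongr
    _ = C * δ := by ring
end FactorHAC
-- Power-law decay
namespace FactorHAC
/-- The decay rate `(k + 1)^{-a}`. -/
noncomputable def decay (a : ℝ) (k : ℕ) : ℝ := ((k : ℝ) + 1) ^ (-a)
theorem decay_pos (a : ℝ) (k : ℕ) : 0 < decay a k := by unfold decay; positivity
theorem decay_zero (a : ℝ) : decay a 0 = 1 := by simp [decay]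
theorem decay_le_one {a : ℝ} (ha : 0 ≤ a) (k : ℕ) : decay a k ≤ 1 :=
  Real.rpow_le_one_of_one_le_of_nonpos (by simp) (by linarith)
-- Halving a lag costs only the constant 2^a. Any time gap of at least half the relevant one may
-- therefore stand in for it.
theorem decay_le {a : ℝ} (ha : 0 ≤ a) {j k : ℕ} (h : k ≤ 2 * j) :
    decay a j ≤ 2 ^ a * decay a k := by
  have h1 : ((k : ℝ) + 1) / 2 ≤ j + 1 := by
    have : (k : ℝ) ≤ 2 * j := by exact_mod_cast h
    linarith
  calc decay a j ≤ (((k : ℝ) + 1) / 2) ^ (-a) :=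
        Real.rpow_le_rpow_of_nonpos (by positivity) h1 (by linarith)
    _ = 2 ^ a * decay a k := by
        rw [Real.div_rpow (by positivity) (by norm_num), Real.rpow_neg (by norm_num : (0:ℝ) ≤ 2),
          decay, div_inv_eq_mul, mul_comm]
theorem summable_decay {a : ℝ} (ha : 1 < a) : Summable (decay a) := by
  have h := (summable_nat_add_iff 1).2 (Real.summable_nat_rpow.2 (by linarith : -a < -1))
  refine h.congr fun k => ?_
  simp [decay]
-- The factor k lowers the exponent by one, whence a > 2. This series controls the bias of Bartlett
-- sums.
theorem summable_mul_decay {a : ℝ} (ha : 2 < a) : Summable fun k : ℕ => (k : ℝ) * decay a k := by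
  refine Summable.of_nonneg_of_le (fun k => mul_nonneg k.cast_nonneg (decay_pos a k).le) ?_
    (summable_decay (by linarith : 1 < a - 1))
  intro k
  have : decay (a - 1) k = ((k : ℝ) + 1) * decay a k := by
    unfold decay
    rw [show -(a - 1) = 1 + -a by ring, Real.rpow_add (by positivity), Real.rpow_one]
  rw [this]
  exact mul_le_mul_of_nonneg_right (by linarith) (decay_pos a k).le
/-- Double sums of a summable function of the time lag are of linear order. -/
theorem sum_sum_decay_le {a : ℝ} (ha : 1 < a) :
    ∃ W : ℝ, 0 ≤ W ∧ ∀ I : Finset ℤ, ∑ s ∈ I, ∑ t ∈ I, decay a (s - t).natAbs ≤ W * I.card := by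
  have hs : Summable fun n : ℤ => decay a n.natAbs := by
    refine Summable.of_nat_of_neg ?_ ?_ <;> simpa using summable_decay ha
  refine ⟨∑' n : ℤ, decay a n.natAbs, tsum_nonneg fun n => (decay_pos _ _).le, fun I => ?_⟩
  calc ∑ s ∈ I, ∑ t ∈ I, decay a (s - t).natAbs
      ≤ ∑ s ∈ I, ∑' n : ℤ, decay a n.natAbs := by
        refine Finset.sum_le_sum fun s _ => ?_
        have : ∑ t ∈ I, decay a (s - t).natAbs =
            ∑ n ∈ I.image (fun t => s - t), decay a n.natAbs := by
          rw [Finset.sum_image (fun x _ y _ h => by simpa using h)]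
        rw [this]
        exact hs.sum_le_tsum _ fun n _ => (decay_pos _ _).le
    _ = _ := by rw [Finset.sum_const, nsmul_eq_mul, mul_comm]
-- Short-memory functions of an i.i.d. past
section ShortMemory
variable {S : Type*} [MeasurableSpace S] {ρ : Measure S} [IsProbabilityMeasure ρ]
/-- A centred function of the past of an i.i.d. sequence with finite fourth moment, which depends
little on the remote past. -/
structure ShortMemory (ρ : Measure S) [IsProbabilityMeasure ρ] (a C : ℝ) (u : (ℕ → S) → ℝ) :
    Prop where
  meas : Measurable u
  mean : ∫ x, u (past 0 x) ∂iidLaw ρ = 0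
  int : Integrable (fun x => u (past 0 x) ^ 4) (iidLaw ρ)
  bound : ∫ x, u (past 0 x) ^ 4 ∂iidLaw ρ ≤ C
  diffInt : ∀ t c : ℤ, c < t → Integrable (fun p : (ℤ → S) × (ℤ → S) =>
    (u (past t p.1) - u (past t (cutMix c p.1 p.2))) ^ 4) ((iidLaw ρ).prod (iidLaw ρ))
  diffBound : ∀ t c : ℤ, c < t →
    ∫ p : (ℤ → S) × (ℤ → S), (u (past t p.1) - u (past t (cutMix c p.1 p.2))) ^ 4
      ∂((iidLaw ρ).prod (iidLaw ρ)) ≤ C * decay a (t - c).toNat ^ 4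
theorem past_shift {S : Type*} (t k : ℤ) (x : ℤ → S) : past t (fun j => x (j + k)) = past (t + k) x := by
  funext j
  simp only [past]
  congr 1
  ring
/-- A random variable with fourth moment at most `C`, determined by the entries up to time `c`. -/
structure IsPastVar (ρ : Measure S) [IsProbabilityMeasure ρ] (C : ℝ) (c : ℤ)
    (A : (ℤ → S) → ℝ) : Prop where
  meas : Measurable A
  int : Integrable (fun x => A x ^ 4) (iidLaw ρ)
  bound : ∫ x, A x ^ 4 ∂iidLaw ρ ≤ C
  dep : ∀ x y : ℤ → S, (∀ j ≤ c, x j = y j) → A x = A y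
-- Constants fill up products with fewer than four factors; this is why C ≥ 1 is assumed later on.
theorem IsPastVar.one {C : ℝ} (hC : 1 ≤ C) (c : ℤ) : IsPastVar ρ C c fun _ => 1 :=
  ⟨by fun_prop, by simp, by simpa using hC, fun _ _ _ => rfl⟩
theorem IsPastVar.aestronglyMeasurable_fst {C : ℝ} {c : ℤ} {A : (ℤ → S) → ℝ}
    (h : IsPastVar ρ C c A) :
    AEStronglyMeasurable (fun p : (ℤ → S) × (ℤ → S) => A p.1) ((iidLaw ρ).prod (iidLaw ρ)) :=
  (h.meas.comp measurable_fst).aestronglyMeasurable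
theorem IsPastVar.fst {C : ℝ} {c : ℤ} {A : (ℤ → S) → ℝ} (h : IsPastVar ρ C c A) :
    Integrable (fun p : (ℤ → S) × (ℤ → S) => A p.1 ^ 4) ((iidLaw ρ).prod (iidLaw ρ)) ∧
      ∫ p : (ℤ → S) × (ℤ → S), A p.1 ^ 4 ∂((iidLaw ρ).prod (iidLaw ρ)) ≤ C :=
  ⟨measurePreserving_fst.integrable_comp_of_integrable h.int,
    (integral_comp_of_measurePreserving measurePreserving_fst
      h.int.aestronglyMeasurable).trans_le h.bound⟩
theorem IsPastVar.mix {C : ℝ} {c : ℤ} {A : (ℤ → S) → ℝ} (h : IsPastVar ρ C c A) (b : ℤ) :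
    Integrable (fun p : (ℤ → S) × (ℤ → S) => A (cutMix b p.1 p.2) ^ 4)
      ((iidLaw ρ).prod (iidLaw ρ)) ∧
      ∫ p : (ℤ → S) × (ℤ → S), A (cutMix b p.1 p.2) ^ 4 ∂((iidLaw ρ).prod (iidLaw ρ)) ≤ C :=
  ⟨(measurePreserving_cutMix ρ b).integrable_comp_of_integrable h.int,
    (integral_comp_of_measurePreserving (measurePreserving_cutMix ρ b)
      h.int.aestronglyMeasurable).trans_le h.bound⟩
theorem integrable_mul_four {C : ℝ} {c₁ c₂ c₃ c₄ : ℤ} {A₁ A₂ A₃ A₄ : (ℤ → S) → ℝ}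
    (h₁ : IsPastVar ρ C c₁ A₁) (h₂ : IsPastVar ρ C c₂ A₂) (h₃ : IsPastVar ρ C c₃ A₃)
    (h₄ : IsPastVar ρ C c₄ A₄) :
    Integrable (fun x => A₁ x * A₂ x * A₃ x * A₄ x) (iidLaw ρ) ∧
      |∫ x, A₁ x * A₂ x * A₃ x * A₄ x ∂iidLaw ρ| ≤ C := by
  have := integral_mul_four_le (C := C) one_pos h₁.meas.aestronglyMeasurable
    h₂.meas.aestronglyMeasurable h₃.meas.aestronglyMeasurable h₄.meas.aestronglyMeasurable
    h₁.int h₂.int h₃.int h₄.int (by simpa using h₁.bound) h₂.bound h₃.bound h₄.bound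
  simpa using this
namespace ShortMemory
variable {a C : ℝ} {u v : (ℕ → S) → ℝ}
theorem isPastVar (hu : ShortMemory ρ a C u) {t c : ℤ} (h : t ≤ c) :
    IsPastVar ρ C c fun x => u (past t x) := by
  have hm : Measurable fun x : ℤ → S => u (past t x) := hu.meas.comp (measurable_past t)
  have hm0 : Measurable fun x : ℤ → S => u (past 0 x) := hu.meas.comp (measurable_past 0)
  have he : ∀ x : ℤ → S, u (past t x) = u (past 0 fun j => x (j + t)) := fun x => by
    rw [past_shift, zero_add]
  refine ⟨hm, ?_, ?_, fun x y hxy => ?_⟩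
  · simp_rw [he]
    exact (measurePreserving_shift ρ t).integrable_comp_of_integrable hu.int
  · simp_rw [he]
    exact (integral_comp_of_measurePreserving (measurePreserving_shift ρ t)
      hu.int.aestronglyMeasurable).trans_le hu.bound
  · have : past t x = past t y := by
      funext j
      exact hxy _ (by have : (0:ℤ) ≤ j := by positivity
                      linarith)
    simp only [this]
theorem mean_eq_zero (hu : ShortMemory ρ a C u) (t : ℤ) : ∫ x, u (past t x) ∂iidLaw ρ = 0 := by
  have he : ∀ x : ℤ → S, u (past t x) = u (past 0 fun j => x (j + t)) := fun x => by
    rw [past_shift, zero_add]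
  simp_rw [he]
  rw [integral_comp_of_measurePreserving (measurePreserving_shift ρ t) (g := fun x => u (past 0 x))
    (hu.meas.comp (measurable_past 0)).aestronglyMeasurable, hu.mean]
theorem integral_mul_shift (hu : ShortMemory ρ a C u) (hv : ShortMemory ρ a C v) (t s k : ℤ) :
    ∫ x, u (past (t + k) x) * v (past (s + k) x) ∂iidLaw ρ =
      ∫ x, u (past t x) * v (past s x) ∂iidLaw ρ := by
  simp_rw [← past_shift]
  exact integral_comp_of_measurePreserving (measurePreserving_shift ρ k)
    (g := fun x => u (past t x) * v (past s x))
    ((hu.meas.comp (measurable_past t)).mul (hv.meas.comp (measurable_past s))).aestronglyMeasurable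
/-- A short-memory variable is nearly uncorrelated with the remote past. -/
theorem abs_integral_mul_past_le (hu : ShortMemory ρ a C u) {t c : ℤ} (hc : c < t)
    {A₂ A₃ A₄ : (ℤ → S) → ℝ} (h₂ : IsPastVar ρ C c A₂) (h₃ : IsPastVar ρ C c A₃)
    (h₄ : IsPastVar ρ C c A₄) :
    |∫ x, u (past t x) * A₂ x * A₃ x * A₄ x ∂iidLaw ρ| ≤ C * decay a (t - c).toNat := by
  have mu : Measurable fun x : ℤ → S => u (past t x) := hu.meas.comp (measurable_past t)
  have mf : Measurable fun p : (ℤ → S) × (ℤ → S) => u (past t p.1) := mu.comp measurable_fst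
  have mm : Measurable fun p : (ℤ → S) × (ℤ → S) => u (past t (cutMix c p.1 p.2)) :=
    mu.comp (measurable_cutMix c)
  have n₂ := h₂.aestronglyMeasurable_fst
  have n₃ := h₃.aestronglyMeasurable_fst
  have n₄ := h₄.aestronglyMeasurable_fst
  -- The coupling error, the only part that contributes to the integral.
  have k1 := integral_mul_four_le (decay_pos a (t - c).toNat) (mf.sub mm).aestronglyMeasurable
    n₂ n₃ n₄ (hu.diffInt t c hc) h₂.fst.1 h₃.fst.1 h₄.fst.1 (hu.diffBound t c hc) h₂.fst.2
    h₃.fst.2 h₄.fst.2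
  simp only [Pi.sub_apply] at k1
  have hup := hu.isPastVar (le_refl t)
  have k2 := (integral_mul_four_le (C := C) one_pos mm.aestronglyMeasurable n₂ n₃ n₄
    (hup.mix c).1 h₂.fst.1 h₃.fst.1 h₄.fst.1 (by simpa using (hup.mix c).2) h₂.fst.2 h₃.fst.2
    h₄.fst.2).1
  -- With the entries up to c resampled, `u` is centred and uncorrelated with the three past
  -- variables, so this part vanishes.
  have k3 : ∫ p : (ℤ → S) × (ℤ → S), u (past t (cutMix c p.1 p.2)) * A₂ p.1 * A₃ p.1 * A₄ p.1
      ∂((iidLaw ρ).prod (iidLaw ρ)) = 0 := by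
    have := integral_mul_cutMix ρ c (A := fun x => A₂ x * A₃ x * A₄ x)
      (B := fun x => u (past t x)) ((h₂.meas.mul h₃.meas).mul h₄.meas) mu
      (fun x y hxy => by rw [h₂.dep x y hxy, h₃.dep x y hxy, h₄.dep x y hxy])
    rw [hu.mean_eq_zero, mul_zero] at this
    rw [← this]
    exact integral_congr_ae (ae_of_all _ fun p => by ring)
  have k4 : ∫ x, u (past t x) * A₂ x * A₃ x * A₄ x ∂iidLaw ρ =
      ∫ p : (ℤ → S) × (ℤ → S), (u (past t p.1) - u (past t (cutMix c p.1 p.2))) * A₂ p.1 * A₃ p.1 *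
        A₄ p.1 ∂((iidLaw ρ).prod (iidLaw ρ)) := by
    rw [← integral_comp_of_measurePreserving (measurePreserving_fst (ν := iidLaw ρ))
      (g := fun x => u (past t x) * A₂ x * A₃ x * A₄ x)
      (((mu.mul h₂.meas).mul h₃.meas).mul h₄.meas).aestronglyMeasurable,
      ← add_zero (∫ p : (ℤ → S) × (ℤ → S), (u (past t p.1) - u (past t (cutMix c p.1 p.2))) *
        A₂ p.1 * A₃ p.1 * A₄ p.1 ∂((iidLaw ρ).prod (iidLaw ρ))), ← k3, ← integral_add k1.1 k2]
    exact integral_congr_ae (ae_of_all _ fun p => by ring)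
  rw [k4]
  exact k1.2
/-- The product of two short-memory variables is nearly uncorrelated with the remote past. -/
theorem abs_integral_mul_mul_past_sub_le (hu : ShortMemory ρ a C u) (hv : ShortMemory ρ a C v)
    {t s c : ℤ} (ht : c < t) (hs : c < s)
    {A₃ A₄ : (ℤ → S) → ℝ} (h₃ : IsPastVar ρ C c A₃) (h₄ : IsPastVar ρ C c A₄) :
    |∫ x, u (past t x) * v (past s x) * A₃ x * A₄ x ∂iidLaw ρ -
        (∫ x, A₃ x * A₄ x ∂iidLaw ρ) * ∫ x, u (past t x) * v (past s x) ∂iidLaw ρ| ≤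
      C * decay a (t - c).toNat + C * decay a (s - c).toNat := by
  have mu : Measurable fun x : ℤ → S => u (past t x) := hu.meas.comp (measurable_past t)
  have mv : Measurable fun x : ℤ → S => v (past s x) := hv.meas.comp (measurable_past s)
  have uf : Measurable fun p : (ℤ → S) × (ℤ → S) => u (past t p.1) := mu.comp measurable_fst
  have um : Measurable fun p : (ℤ → S) × (ℤ → S) => u (past t (cutMix c p.1 p.2)) :=
    mu.comp (measurable_cutMix c)
  have vf : Measurable fun p : (ℤ → S) × (ℤ → S) => v (past s p.1) := mv.comp measurable_fst
  have vm : Measurable fun p : (ℤ → S) × (ℤ → S) => v (past s (cutMix c p.1 p.2)) :=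
    mv.comp (measurable_cutMix c)
  have n₃ := h₃.aestronglyMeasurable_fst
  have n₄ := h₄.aestronglyMeasurable_fst
  have hup := hu.isPastVar (le_refl t)
  have hvp := hv.isPastVar (le_refl s)
  -- With stars for resampled variables, u v = (u - u*) v + (v - v*) u* + u* v*. The first two terms
  -- have a small factor each; the third factorises against the past.
  have k1 := integral_mul_four_le (decay_pos a (t - c).toNat) (uf.sub um).aestronglyMeasurable
    vf.aestronglyMeasurable n₃ n₄ (hu.diffInt t c ht) hvp.fst.1 h₃.fst.1 h₄.fst.1
    (hu.diffBound t c ht) hvp.fst.2 h₃.fst.2 h₄.fst.2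
  have k2 := integral_mul_four_le (decay_pos a (s - c).toNat) (vf.sub vm).aestronglyMeasurable
    um.aestronglyMeasurable n₃ n₄ (hv.diffInt s c hs) (hup.mix c).1 h₃.fst.1 h₄.fst.1
    (hv.diffBound s c hs) (hup.mix c).2 h₃.fst.2 h₄.fst.2
  have k3 := (integral_mul_four_le (C := C) one_pos um.aestronglyMeasurable
    vm.aestronglyMeasurable n₃ n₄ (hup.mix c).1 (hvp.mix c).1 h₃.fst.1 h₄.fst.1
    (by simpa using (hup.mix c).2) (hvp.mix c).2 h₃.fst.2 h₄.fst.2).1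
  have k4 := integral_mul_cutMix ρ c (A := fun x => A₃ x * A₄ x)
      (B := fun x => u (past t x) * v (past s x)) (h₃.meas.mul h₄.meas) (mu.mul mv)
      (fun x y hxy => by rw [h₃.dep x y hxy, h₄.dep x y hxy])
  have k5 : ∫ p : (ℤ → S) × (ℤ → S), A₃ p.1 * A₄ p.1 *
        (u (past t (cutMix c p.1 p.2)) * v (past s (cutMix c p.1 p.2)))
        ∂((iidLaw ρ).prod (iidLaw ρ)) =
      ∫ p : (ℤ → S) × (ℤ → S), u (past t (cutMix c p.1 p.2)) * v (past s (cutMix c p.1 p.2)) *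
        A₃ p.1 * A₄ p.1 ∂((iidLaw ρ).prod (iidLaw ρ)) :=
    integral_congr_ae (ae_of_all _ fun p => by ring)
  rw [← k4, k5, ← integral_comp_of_measurePreserving (measurePreserving_fst (ν := iidLaw ρ))
      (g := fun x => u (past t x) * v (past s x) * A₃ x * A₄ x)
      (((mu.mul mv).mul h₃.meas).mul h₄.meas).aestronglyMeasurable]
  have k6 : ∫ p : (ℤ → S) × (ℤ → S), u (past t p.1) * v (past s p.1) * A₃ p.1 * A₄ p.1
        ∂((iidLaw ρ).prod (iidLaw ρ)) = _ + _ + _ :=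
    (integral_congr_ae (ae_of_all _ fun p => by
      simp only [Pi.sub_apply, Pi.add_apply]; ring)).trans
      ((integral_add (k1.1.add k2.1) k3).trans (by rw [integral_add' k1.1 k2.1]))
  rw [k6, add_sub_cancel_right]
  exact (abs_add_le _ _).trans (add_le_add k1.2 k2.2)
end ShortMemory
end ShortMemory
end FactorHAC
-- Covariances of lagged products, uniformly in the lag
namespace FactorHAC
namespace ShortMemory
variable {S : Type*} [MeasurableSpace S] {ρ : Measure S} [IsProbabilityMeasure ρ]
  {a C : ℝ} {u v : (ℕ → S) → ℝ}
theorem integrable_mul (hC : 1 ≤ C) (hu : ShortMemory ρ a C u) (hv : ShortMemory ρ a C v)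
    (t s : ℤ) : Integrable (fun x => u (past t x) * v (past s x)) (iidLaw ρ) := by
  have := (integrable_mul_four (hu.isPastVar (le_refl t)) (hv.isPastVar (le_refl s))
    (IsPastVar.one hC 0) (IsPastVar.one hC 0)).1
  simpa using this
theorem abs_integral_mul_le_of_lt (hC : 1 ≤ C) (hu : ShortMemory ρ a C u)
    (hv : ShortMemory ρ a C v) {t s : ℤ} (h : s < t) :
    |∫ x, u (past t x) * v (past s x) ∂iidLaw ρ| ≤ C * decay a (t - s).natAbs := by
  have := hu.abs_integral_mul_past_le h (hv.isPastVar (le_refl s)) (IsPastVar.one hC s)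
    (IsPastVar.one hC s)
  rw [show (t - s).natAbs = (t - s).toNat by omega]
  simpa using this
theorem abs_integral_mul_le (hC : 1 ≤ C) (hu : ShortMemory ρ a C u)
    (hv : ShortMemory ρ a C v) (t s : ℤ) :
    |∫ x, u (past t x) * v (past s x) ∂iidLaw ρ| ≤ C * decay a (t - s).natAbs := by
  rcases lt_trichotomy s t with h | rfl | h
  · exact abs_integral_mul_le_of_lt hC hu hv h
  · have := (integrable_mul_four (hu.isPastVar (le_refl s)) (hv.isPastVar (le_refl s))
      (IsPastVar.one hC 0) (IsPastVar.one hC 0)).2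
    simpa [decay_zero] using this
  · have := abs_integral_mul_le_of_lt hC hv hu h
    rw [show (t - s).natAbs = (s - t).natAbs by omega]
    simp_rw [mul_comm (u _)]
    exact this
theorem integrable_prod_mul_prod (hu : ShortMemory ρ a C u)
    (hv : ShortMemory ρ a C v) (s t l : ℤ) :
    Integrable (fun x => u (past s x) * v (past (s - l) x) * (u (past t x) * v (past (t - l) x)))
      (iidLaw ρ) := by
  have := (integrable_mul_four (hu.isPastVar (le_refl s)) (hv.isPastVar (le_refl (s - l)))
    (hu.isPastVar (le_refl t)) (hv.isPastVar (le_refl (t - l)))).1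
  simpa only [mul_assoc] using this
-- If s - t > 2 l, the times s and s - l both lie beyond t by at least half the gap s - t, and the
-- pair there is nearly independent of the pair at t. Otherwise l is at least half the gap, and the
-- mean of the product and the squared autocovariance are each small. The constant is thus free of
-- l.
theorem abs_integral_prod_mul_prod_sub_le_of_lt (ha : 0 ≤ a) (hC : 1 ≤ C)
    (hu : ShortMemory ρ a C u) (hv : ShortMemory ρ a C v) {s t : ℤ} (l : ℕ) (h : t < s) :
    |∫ x, u (past s x) * v (past (s - l) x) * (u (past t x) * v (past (t - l) x)) ∂iidLaw ρ -
        (∫ x, u (past l x) * v (past 0 x) ∂iidLaw ρ) ^ 2| ≤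
      2 * C ^ 2 * 2 ^ a * decay a (s - t).natAbs := by
  have h1 : ∀ w : ℤ, ∫ x, u (past w x) * v (past (w - l) x) ∂iidLaw ρ =
      ∫ x, u (past l x) * v (past 0 x) ∂iidLaw ρ := by
    intro w
    rw [← hu.integral_mul_shift hv l 0 (w - l)]
    simp
  have hCC : C ≤ C ^ 2 := by nlinarith
  have h2a : (0:ℝ) < 2 ^ a := by positivity
  have hl : (0 : ℤ) ≤ l := by positivity
  rcases lt_or_ge (2 * (l : ℤ)) (s - t) with hlt | hge
  · have k := hu.abs_integral_mul_mul_past_sub_le hv (t := s) (s := s - l) (c := t) h (by omega)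
      (hu.isPastVar (le_refl t)) (hv.isPastVar (by omega : t - l ≤ t))
    rw [h1, h1, ← sq] at k
    simp only [mul_assoc] at k ⊢
    refine k.trans ?_
    have d1 : decay a (s - t).toNat ≤ 2 ^ a * decay a (s - t).natAbs := decay_le ha (by omega)
    have d2 : decay a (s - l - t).toNat ≤ 2 ^ a * decay a (s - t).natAbs := decay_le ha (by omega)
    have hp : 0 ≤ 2 ^ a * decay a (s - t).natAbs := mul_nonneg h2a.le (decay_pos _ _).le
    nlinarith
  · have hl0 : 0 < l := by omega
    -- The other three factors live at times up to max t (s - l), and s exceeds this maximum by min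
    -- (s - t) l, at least half the gap.
    have hc : max t (s - l) < s := by omega
    have k := hu.abs_integral_mul_past_le hc (hv.isPastVar (le_max_right t (s - l)))
      (hu.isPastVar (le_max_left t (s - l)))
      (hv.isPastVar (show t - l ≤ max t (s - l) from by omega))
    have d1 : decay a (s - max t (s - l)).toNat ≤ 2 ^ a * decay a (s - t).natAbs :=
      decay_le ha (by omega)
    have k2 := abs_integral_mul_le hC hu hv l 0
    have d2 : decay a ((l : ℤ) - 0).natAbs ≤ 2 ^ a * decay a (s - t).natAbs :=
      decay_le ha (by omega)
    have d3 := decay_le_one ha ((l : ℤ) - 0).natAbs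
    have d4 := decay_pos a ((l : ℤ) - 0).natAbs
    have hp : 0 ≤ 2 ^ a * decay a (s - t).natAbs := mul_nonneg h2a.le (decay_pos _ _).le
    have k3 : (∫ x, u (past l x) * v (past 0 x) ∂iidLaw ρ) ^ 2 ≤
        C ^ 2 * (2 ^ a * decay a (s - t).natAbs) := by
      calc (∫ x, u (past l x) * v (past 0 x) ∂iidLaw ρ) ^ 2
          = |∫ x, u (past l x) * v (past 0 x) ∂iidLaw ρ| ^ 2 := (sq_abs _).symm
        _ ≤ (C * decay a ((l : ℤ) - 0).natAbs) ^ 2 := by gcongr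
        _ = C ^ 2 * (decay a ((l : ℤ) - 0).natAbs * decay a ((l : ℤ) - 0).natAbs) := by ring
        _ ≤ C ^ 2 * (2 ^ a * decay a (s - t).natAbs * 1) := by gcongr
        _ = _ := by ring
    simp only [mul_assoc] at k ⊢
    refine (abs_sub _ _).trans ?_
    rw [abs_pow, sq_abs]
    have : C * decay a (s - max t (s - l)).toNat ≤ C ^ 2 * (2 ^ a * decay a (s - t).natAbs) :=
      mul_le_mul hCC d1 (decay_pos _ _).le (by positivity)
    linarith
theorem abs_integral_prod_mul_prod_sub_le (ha : 0 ≤ a) (hC : 1 ≤ C)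
    (hu : ShortMemory ρ a C u) (hv : ShortMemory ρ a C v) (s t : ℤ) (l : ℕ) :
    |∫ x, u (past s x) * v (past (s - l) x) * (u (past t x) * v (past (t - l) x)) ∂iidLaw ρ -
        (∫ x, u (past l x) * v (past 0 x) ∂iidLaw ρ) ^ 2| ≤
      2 * C ^ 2 * 2 ^ a * decay a (s - t).natAbs := by
  rcases lt_trichotomy t s with h | rfl | h
  · exact abs_integral_prod_mul_prod_sub_le_of_lt ha hC hu hv l h
  · have k := (integrable_mul_four (hu.isPastVar (le_refl t)) (hv.isPastVar (le_refl (t - l)))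
      (hu.isPastVar (le_refl t)) (hv.isPastVar (le_refl (t - l)))).2
    have k2 := abs_integral_mul_le hC hu hv l 0
    have d3 := decay_le_one ha ((l : ℤ) - 0).natAbs
    have k3 : (∫ x, u (past l x) * v (past 0 x) ∂iidLaw ρ) ^ 2 ≤ C ^ 2 := by
      rw [← sq_abs]
      refine pow_le_pow_left₀ (abs_nonneg _) (k2.trans ?_) 2
      nlinarith
    simp only [mul_assoc] at k ⊢
    refine (abs_sub _ _).trans ?_
    rw [abs_pow, sq_abs]
    have h2a : (1:ℝ) ≤ 2 ^ a := Real.one_le_rpow (by norm_num) ha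
    simp only [sub_self, Int.natAbs_zero, decay_zero, mul_one]
    nlinarith
  · rw [show (s - t).natAbs = (t - s).natAbs by omega]
    simp_rw [mul_comm (u (past s _) * v (past (s - l) _))]
    exact abs_integral_prod_mul_prod_sub_le_of_lt ha hC hu hv l h
end ShortMemory
/-- A sum of random variables whose covariances decay has variance of linear order. -/
theorem integral_sum_sq_le {α : Type*} [MeasurableSpace α] {P : Measure α} {Z : ℤ → α → ℝ}
    {a K W : ℝ} (hW : ∀ I : Finset ℤ, ∑ s ∈ I, ∑ t ∈ I, decay a (s - t).natAbs ≤ W * I.card)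
    (hK : 0 ≤ K) (hint : ∀ s t, Integrable (fun x => Z s x * Z t x) P)
    (hcov : ∀ s t, |∫ x, Z s x * Z t x ∂P| ≤ K * decay a (s - t).natAbs) (I : Finset ℤ) :
    Integrable (fun x => (∑ t ∈ I, Z t x) ^ 2) P ∧
      ∫ x, (∑ t ∈ I, Z t x) ^ 2 ∂P ≤ K * W * I.card := by
  have h : (fun x => (∑ t ∈ I, Z t x) ^ 2) = fun x => ∑ s ∈ I, ∑ t ∈ I, Z s x * Z t x := by
    funext x
    rw [sq, Finset.sum_mul_sum]
  rw [h]
  refine ⟨integrable_finsetSum _ fun s _ => integrable_finsetSum _ fun t _ => hint s t, ?_⟩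
  rw [integral_finsetSum _ fun s _ => integrable_finsetSum _ fun t _ => hint s t]
  calc ∑ s ∈ I, ∫ x, ∑ t ∈ I, Z s x * Z t x ∂P
      = ∑ s ∈ I, ∑ t ∈ I, ∫ x, Z s x * Z t x ∂P :=
        Finset.sum_congr rfl fun s _ => integral_finsetSum _ fun t _ => hint s t
    _ ≤ ∑ s ∈ I, ∑ t ∈ I, K * decay a (s - t).natAbs :=
        Finset.sum_le_sum fun s _ => Finset.sum_le_sum fun t _ => (le_abs_self _).trans (hcov s t)
    _ = K * ∑ s ∈ I, ∑ t ∈ I, decay a (s - t).natAbs := by simp_rw [Finset.mul_sum]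
    _ ≤ K * (W * I.card) := mul_le_mul_of_nonneg_left (hW I) hK
    _ = _ := by ring
namespace ShortMemory
variable {S : Type*} [MeasurableSpace S] {ρ : Measure S} [IsProbabilityMeasure ρ]
  {a C W : ℝ} {u v : (ℕ → S) → ℝ}
theorem integral_sum_sq_le (hW : ∀ I : Finset ℤ, ∑ s ∈ I, ∑ t ∈ I, decay a (s - t).natAbs ≤
      W * I.card) (hC : 1 ≤ C) (hu : ShortMemory ρ a C u) (I : Finset ℤ) :
    Integrable (fun x => (∑ t ∈ I, u (past t x)) ^ 2) (iidLaw ρ) ∧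
      ∫ x, (∑ t ∈ I, u (past t x)) ^ 2 ∂iidLaw ρ ≤ C * W * I.card :=
  FactorHAC.integral_sum_sq_le (Z := fun t x => u (past t x)) hW (by linarith)
    (fun s t => integrable_mul hC hu hu s t) (fun s t => abs_integral_mul_le hC hu hu s t) I
-- The bound does not deteriorate with the lag, so the errors of m + 1 sample autocovariances can
-- simply be added.
theorem integral_sum_prod_sq_le (hW : ∀ I : Finset ℤ, ∑ s ∈ I, ∑ t ∈ I, decay a (s - t).natAbs ≤
      W * I.card) (ha : 0 ≤ a) (hC : 1 ≤ C) (hu : ShortMemory ρ a C u) (hv : ShortMemory ρ a C v)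
    (l : ℕ) (I : Finset ℤ) :
    Integrable (fun x => (∑ t ∈ I, (u (past t x) * v (past (t - l) x) -
        ∫ y, u (past l y) * v (past 0 y) ∂iidLaw ρ)) ^ 2) (iidLaw ρ) ∧
      ∫ x, (∑ t ∈ I, (u (past t x) * v (past (t - l) x) -
        ∫ y, u (past l y) * v (past 0 y) ∂iidLaw ρ)) ^ 2 ∂iidLaw ρ ≤
        2 * C ^ 2 * 2 ^ a * W * I.card := by
  have hmean : ∀ w : ℤ, ∫ x, u (past w x) * v (past (w - l) x) ∂iidLaw ρ =
      ∫ x, u (past l x) * v (past 0 x) ∂iidLaw ρ := by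
    intro w
    rw [← hu.integral_mul_shift hv l 0 (w - l)]
    simp
  set g := ∫ y, u (past l y) * v (past 0 y) ∂iidLaw ρ with hg
  have he : ∀ s t : ℤ, (fun x => (u (past s x) * v (past (s - l) x) - g) *
      (u (past t x) * v (past (t - l) x) - g)) = fun x =>
      u (past s x) * v (past (s - l) x) * (u (past t x) * v (past (t - l) x)) -
        g * (u (past s x) * v (past (s - l) x)) - g * (u (past t x) * v (past (t - l) x)) +
        g ^ 2 := by
    intro s t
    funext x
    ring
  have i1 := fun s t => integrable_prod_mul_prod hu hv s t l
  have i2 := fun s : ℤ => (integrable_mul hC hu hv s (s - l)).const_mul g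
  have i3 : ∀ s t : ℤ, Integrable (fun x =>
      u (past s x) * v (past (s - l) x) * (u (past t x) * v (past (t - l) x)) -
        g * (u (past s x) * v (past (s - l) x))) (iidLaw ρ) := fun s t => (i1 s t).sub (i2 s)
  have i4 : ∀ s t : ℤ, Integrable (fun x =>
      u (past s x) * v (past (s - l) x) * (u (past t x) * v (past (t - l) x)) -
        g * (u (past s x) * v (past (s - l) x)) - g * (u (past t x) * v (past (t - l) x)))
      (iidLaw ρ) := fun s t => (i3 s t).sub (i2 t)
  refine FactorHAC.integral_sum_sq_le (Z := fun t x => u (past t x) * v (past (t - l) x) - g) hW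
    (by positivity) (fun s t => ?_) (fun s t => ?_) I
  · rw [he]
    exact (i4 s t).add (integrable_const _)
  -- Both cross terms have mean g², so the expansion leaves the mean of the fourfold product minus
  -- g².
  · rw [he, integral_add (i4 s t) (integrable_const _), integral_sub (i3 s t) (i2 t),
      integral_sub (i1 s t) (i2 s), integral_const_mul, integral_const_mul, hmean, hmean]
    have := abs_integral_prod_mul_prod_sub_le ha hC hu hv s t l
    rw [← hg] at this
    convert this using 2
    simp
    ring
end ShortMemory
end FactorHAC
-- From Bernoulli shifts to short-memory variables
namespace FactorHAC
-- L^p norms increase in p on a probability space. The real exponent ν is traded here for the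
-- integer eight, the only moment used afterwards.
theorem integral_norm_pow_eight_le {α E : Type*} [MeasurableSpace α] [NormedAddCommGroup E]
    {P : Measure α} [IsProbabilityMeasure P] {g : α → E} (hg : AEStronglyMeasurable g P) {ν c : ℝ}
    (hν : 8 ≤ ν) (hc : 0 ≤ c) (h : eLpNorm g (ENNReal.ofReal ν) P ≤ ENNReal.ofReal c) :
    Integrable (fun x => ‖g x‖ ^ 8) P ∧ ∫ x, ‖g x‖ ^ 8 ∂P ≤ c ^ 8 := by
  have h8 : (8 : ℝ≥0∞) ≤ ENNReal.ofReal ν := by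
    rw [show (8 : ℝ≥0∞) = ENNReal.ofReal 8 by norm_num]
    exact ENNReal.ofReal_le_ofReal hν
  have hle : eLpNorm g 8 P ≤ ENNReal.ofReal c :=
    (eLpNorm_le_eLpNorm_of_exponent_le h8 hg).trans h
  have hmem : MemLp g 8 P := ⟨hg, hle.trans_lt ENNReal.ofReal_lt_top⟩
  have hint : Integrable (fun x => ‖g x‖ ^ 8) P := hmem.integrable_norm_pow (p := 8) (by norm_num)
  refine ⟨hint, ?_⟩
  have he := hmem.eLpNorm_eq_integral_rpow_norm (by norm_num) (by norm_num)
  rw [he] at hle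
  have hle' := (ENNReal.ofReal_le_ofReal_iff hc).1 hle
  have h0 : 0 ≤ ∫ x, ‖g x‖ ^ 8 ∂P := integral_nonneg fun x => by positivity
  simp only [ENNReal.toReal_ofNat] at hle'
  have e8 : ∀ x, ‖g x‖ ^ (8 : ℝ) = ‖g x‖ ^ 8 := fun x => by exact_mod_cast Real.rpow_natCast _ 8
  simp_rw [e8] at hle'
  calc ∫ x, ‖g x‖ ^ 8 ∂P = ((∫ x, ‖g x‖ ^ 8 ∂P) ^ (8 : ℝ)⁻¹) ^ 8 := by
        rw [← Real.rpow_natCast, ← Real.rpow_mul h0]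
        norm_num
    _ ≤ c ^ 8 := by gcongr
variable {Ω : Type*} [MeasurableSpace Ω] {r : ℕ}
/-- The centred product `f_{t,i} f_{t,j} - E(f_{t,i} f_{t,j})`. -/
noncomputable def centredProd (μ : Measure Ω) (f : ℤ → Ω → EuclideanSpace ℝ (Fin r)) (t : ℤ)
    (p : Fin r × Fin r) (ω : Ω) : ℝ :=
  f t ω p.1 * f t ω p.2 - sigmaF μ f p.1 p.2
theorem add_pow_four_le (x y : ℝ) : (x + y) ^ 4 ≤ 8 * (x ^ 4 + y ^ 4) := by
  nlinarith [sq_nonneg (x - y), sq_nonneg (x ^ 2 - y ^ 2), sq_nonneg (x + y),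
    mul_nonneg (sq_nonneg (x - y)) (sq_nonneg (x + y)), sq_nonneg ((x - y) ^ 2)]
theorem abs_coord_le_norm (x : EuclideanSpace ℝ (Fin r)) (i : Fin r) : |x i| ≤ ‖x‖ := by
  simpa using PiLp.norm_apply_le x i
theorem pow_four_mul_coord_le (x : EuclideanSpace ℝ (Fin r)) (i j : Fin r) :
    (x i * x j) ^ 4 ≤ ‖x‖ ^ 8 := by
  have h : |x i * x j| ≤ ‖x‖ ^ 2 := by
    rw [abs_mul, sq]
    exact mul_le_mul (abs_coord_le_norm x i) (abs_coord_le_norm x j) (abs_nonneg _) (norm_nonneg _)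
  calc (x i * x j) ^ 4 = |x i * x j| ^ 4 := (Even.pow_abs (by decide) _).symm
    _ ≤ (‖x‖ ^ 2) ^ 4 := by gcongr
    _ = _ := by ring
-- Split x_i x_j - y_i y_j = x_i (x_j - y_j) + y_j (x_i - y_i), then apply AM-GM with weight δ. When
-- ‖x - y‖⁸ has mean of order δ⁸, the right side has mean of order δ⁴.
theorem pow_four_mul_coord_sub_le (x y : EuclideanSpace ℝ (Fin r)) (i j : Fin r) {δ : ℝ}
    (hδ : 0 < δ) :
    (x i * x j - y i * y j) ^ 4 ≤
      4 * δ ^ 4 * (‖x‖ ^ 8 + 2 * (‖x - y‖ ^ 8 / δ ^ 8) + ‖y‖ ^ 8) := by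
  have h1 : ∀ i, (x i - y i) ^ 4 ≤ ‖x - y‖ ^ 4 := fun i => by
    rw [← Even.pow_abs (by decide)]
    exact pow_le_pow_left₀ (abs_nonneg _) (abs_coord_le_norm (x - y) i) 4
  have h2 : ∀ (z : EuclideanSpace ℝ (Fin r)) i, z i ^ 4 ≤ ‖z‖ ^ 4 := fun z i => by
    rw [← Even.pow_abs (by decide)]
    exact pow_le_pow_left₀ (abs_nonneg _) (abs_coord_le_norm z i) 4
  have h3 : ∀ z : EuclideanSpace ℝ (Fin r), ‖z‖ ^ 4 * ‖x - y‖ ^ 4 ≤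
      δ ^ 4 / 2 * (‖z‖ ^ 8 + ‖x - y‖ ^ 8 / δ ^ 8) := by
    intro z
    obtain ⟨w, hw⟩ : ∃ w, ‖x - y‖ = δ * w := ⟨‖x - y‖ / δ, by field_simp⟩
    have e : (δ * w) ^ 8 / δ ^ 8 = w ^ 8 := by field_simp
    rw [hw, e]
    have : ‖z‖ ^ 4 * w ^ 4 ≤ (‖z‖ ^ 8 + w ^ 8) / 2 := by nlinarith [sq_nonneg (‖z‖ ^ 4 - w ^ 4)]
    calc ‖z‖ ^ 4 * (δ * w) ^ 4 = δ ^ 4 * (‖z‖ ^ 4 * w ^ 4) := by ring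
      _ ≤ δ ^ 4 * ((‖z‖ ^ 8 + w ^ 8) / 2) := by gcongr
      _ = _ := by ring
  calc (x i * x j - y i * y j) ^ 4
      = (x i * (x j - y j) + y j * (x i - y i)) ^ 4 := by ring
    _ ≤ 8 * ((x i * (x j - y j)) ^ 4 + (y j * (x i - y i)) ^ 4) := add_pow_four_le _ _
    _ = 8 * (x i ^ 4 * (x j - y j) ^ 4 + y j ^ 4 * (x i - y i) ^ 4) := by ring
    _ ≤ 8 * (‖x‖ ^ 4 * ‖x - y‖ ^ 4 + ‖y‖ ^ 4 * ‖x - y‖ ^ 4) := by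
        have k1 := mul_le_mul (h2 x i) (h1 j) (Even.pow_nonneg (by decide) _) (by positivity)
        have k2 := mul_le_mul (h2 y j) (h1 i) (Even.pow_nonneg (by decide) _) (by positivity)
        linarith
    _ ≤ 8 * (δ ^ 4 / 2 * (‖x‖ ^ 8 + ‖x - y‖ ^ 8 / δ ^ 8) +
          δ ^ 4 / 2 * (‖y‖ ^ 8 + ‖x - y‖ ^ 8 / δ ^ 8)) := by
        linarith [h3 x, h3 y]
    _ = _ := by ring
theorem measurePreserving_iid {S : Type*} [MeasurableSpace S] {μ : Measure Ω}
    [IsProbabilityMeasure μ] {η : ℤ → Ω → S} (hη : ∀ t, Measurable (η t)) (hind : iIndepFun η μ)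
    (hid : ∀ t, IdentDistrib (η t) (η 0) μ μ) [IsProbabilityMeasure (μ.map (η 0))] :
    MeasurePreserving (fun ω j => η j ω) μ (iidLaw (μ.map (η 0))) := by
  refine ⟨measurable_pi_iff.2 hη, ?_⟩
  rw [hind.map_fun_eq_infinitePi_map hη]
  simp_rw [fun t => (hid t).map_eq]
-- Position j of the past of t is time t - j, so the positions from l on are exactly the times up to
-- t - l, the latter included.
theorem past_cutMix_eq_splice {S : Type*} (t : ℤ) (l : ℕ) (x y : ℤ → S) :
    past t (cutMix (t - l) x y) = splice l (fun j : ℕ => x (t - j)) (fun j : ℕ => y (t - j)) := by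
  funext j
  simp only [past, cutMix, splice]
  by_cases h : j < l
  · rw [if_neg (by omega), if_pos h]
  · rw [if_pos (by omega), if_neg h]
-- Eighth moments of `h` give fourth moments of products. The constant serves two bounds: 8 M + 8 σ⁴
-- is needed for the fourth moment, 8 M + 8 c₁ for the coupling error.
theorem shortMemory_mul_sub {S : Type*} [MeasurableSpace S] {ρ : Measure S}
    [IsProbabilityMeasure ρ] {a M c₁ : ℝ} {σ : Matrix (Fin r) (Fin r) ℝ}
    {h : (ℕ → S) → EuclideanSpace ℝ (Fin r)} (hh : Measurable h)
    (hint : ∀ t, Integrable (fun x => ‖h (past t x)‖ ^ 8) (iidLaw ρ) ∧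
      ∫ x, ‖h (past t x)‖ ^ 8 ∂iidLaw ρ ≤ M)
    (hmean : ∀ i j, ∫ x, h (past 0 x) i * h (past 0 x) j ∂iidLaw ρ = σ i j)
    (hdiff : ∀ t c : ℤ, c < t →
      Integrable (fun p : (ℤ → S) × (ℤ → S) =>
        ‖h (past t p.1) - h (past t (cutMix c p.1 p.2))‖ ^ 8) ((iidLaw ρ).prod (iidLaw ρ)) ∧
      ∫ p : (ℤ → S) × (ℤ → S), ‖h (past t p.1) - h (past t (cutMix c p.1 p.2))‖ ^ 8
        ∂((iidLaw ρ).prod (iidLaw ρ)) ≤ c₁ * decay a (t - c).toNat ^ 8) (i j : Fin r) :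
    ShortMemory ρ a (8 * M + 8 * (σ i j) ^ 4 + 8 * c₁) fun z => h z i * h z j - σ i j := by
  have mh : ∀ (t : ℤ) i, Measurable fun x : ℤ → S => h (past t x) i := fun t i => by
    exact (by fun_prop : Measurable fun z => h z i).comp (measurable_past t)
  have mu : Measurable fun z => h z i * h z j - σ i j := by fun_prop
  have hM : 0 ≤ M := le_trans (integral_nonneg fun x => by positivity) (hint 0).2
  have hc1 : 0 ≤ c₁ := by
    have := le_trans (integral_nonneg fun x => by positivity) (hdiff 0 (-1) (by norm_num)).2
    exact nonneg_of_mul_nonneg_left this (pow_pos (decay_pos _ _) 8)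
  have hprod : Integrable (fun x => h (past 0 x) i * h (past 0 x) j) (iidLaw ρ) := by
    refine ((hint 0).1.add (integrable_const (1:ℝ))).mono'
      ((mh 0 i).mul (mh 0 j)).aestronglyMeasurable (ae_of_all _ fun x => ?_)
    have := pow_four_mul_coord_le (h (past 0 x)) i j
    simp only [Real.norm_eq_abs, Pi.add_apply]
    set y := h (past 0 x) i * h (past 0 x) j
    rw [abs_le]
    constructor <;> nlinarith [sq_nonneg (y ^ 2 - 1), sq_nonneg (y - 1), sq_nonneg (y + 1)]
  have b4 : ∀ x : ℤ → S, (h (past 0 x) i * h (past 0 x) j - σ i j) ^ 4 ≤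
      8 * (‖h (past 0 x)‖ ^ 8 + σ i j ^ 4) := fun x => by
    have h1 := add_pow_four_le (h (past 0 x) i * h (past 0 x) j) (-σ i j)
    have h2 := pow_four_mul_coord_le (h (past 0 x)) i j
    rw [← sub_eq_add_neg, Even.neg_pow (by decide)] at h1
    linarith
  have i4 : Integrable (fun x => 8 * (‖h (past 0 x)‖ ^ 8 + σ i j ^ 4)) (iidLaw ρ) :=
    ((hint 0).1.add (integrable_const _)).const_mul _
  have int4 : Integrable (fun x => (h (past 0 x) i * h (past 0 x) j - σ i j) ^ 4) (iidLaw ρ) := by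
    refine i4.mono' (((mh 0 i).mul (mh 0 j)).sub_const _ |>.pow_const 4).aestronglyMeasurable
      (ae_of_all _ fun x => ?_)
    rw [Real.norm_of_nonneg (Even.pow_nonneg (by decide) _)]
    exact b4 x
  have dd : ∀ t c : ℤ, c < t → Integrable (fun p : (ℤ → S) × (ℤ → S) =>
      4 * decay a (t - c).toNat ^ 4 * (‖h (past t p.1)‖ ^ 8 +
        2 * (‖h (past t p.1) - h (past t (cutMix c p.1 p.2))‖ ^ 8 / decay a (t - c).toNat ^ 8) +
        ‖h (past t (cutMix c p.1 p.2))‖ ^ 8)) ((iidLaw ρ).prod (iidLaw ρ)) ∧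
      ∫ p : (ℤ → S) × (ℤ → S), 4 * decay a (t - c).toNat ^ 4 * (‖h (past t p.1)‖ ^ 8 +
        2 * (‖h (past t p.1) - h (past t (cutMix c p.1 p.2))‖ ^ 8 / decay a (t - c).toNat ^ 8) +
        ‖h (past t (cutMix c p.1 p.2))‖ ^ 8) ∂((iidLaw ρ).prod (iidLaw ρ)) ≤
        (8 * M + 8 * (σ i j) ^ 4 + 8 * c₁) * decay a (t - c).toNat ^ 4 := by
    intro t c hc
    have j1 : Integrable (fun p : (ℤ → S) × (ℤ → S) => ‖h (past t p.1)‖ ^ 8)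
        ((iidLaw ρ).prod (iidLaw ρ)) :=
      measurePreserving_fst.integrable_comp_of_integrable (hint t).1
    have j2 : Integrable (fun p : (ℤ → S) × (ℤ → S) => ‖h (past t (cutMix c p.1 p.2))‖ ^ 8)
        ((iidLaw ρ).prod (iidLaw ρ)) :=
      (measurePreserving_cutMix ρ c).integrable_comp_of_integrable (hint t).1
    have v1 : ∫ p : (ℤ → S) × (ℤ → S), ‖h (past t p.1)‖ ^ 8 ∂((iidLaw ρ).prod (iidLaw ρ)) ≤ M :=
      (integral_comp_of_measurePreserving measurePreserving_fst
        (hint t).1.aestronglyMeasurable).trans_le (hint t).2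
    have v2 : ∫ p : (ℤ → S) × (ℤ → S), ‖h (past t (cutMix c p.1 p.2))‖ ^ 8
        ∂((iidLaw ρ).prod (iidLaw ρ)) ≤ M :=
      (integral_comp_of_measurePreserving (measurePreserving_cutMix ρ c)
        (hint t).1.aestronglyMeasurable).trans_le (hint t).2
    obtain ⟨j3, v3⟩ := hdiff t c hc
    have hd := decay_pos a (t - c).toNat
    set δ := decay a (t - c).toNat
    have j4 : Integrable (fun p : (ℤ → S) × (ℤ → S) =>
        2 * (‖h (past t p.1) - h (past t (cutMix c p.1 p.2))‖ ^ 8 / δ ^ 8))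
        ((iidLaw ρ).prod (iidLaw ρ)) := (j3.div_const _).const_mul _
    have j5 : Integrable (fun p : (ℤ → S) × (ℤ → S) => ‖h (past t p.1)‖ ^ 8 +
        2 * (‖h (past t p.1) - h (past t (cutMix c p.1 p.2))‖ ^ 8 / δ ^ 8))
        ((iidLaw ρ).prod (iidLaw ρ)) := j1.add j4
    refine ⟨(j5.add j2).const_mul _, ?_⟩
    rw [integral_const_mul, integral_add j5 j2, integral_add j1 j4, integral_const_mul,
      integral_div]
    have v4 := (div_le_iff₀ (pow_pos hd 8)).2 v3
    have hσ : 0 ≤ σ i j ^ 4 := Even.pow_nonneg (by decide) _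
    have hd4 : 0 < δ ^ 4 := pow_pos hd 4
    calc _ ≤ 4 * δ ^ 4 * (M + 2 * c₁ + M) := by gcongr
      _ ≤ _ := by nlinarith [mul_nonneg hd4.le hσ]
  have db : ∀ t c : ℤ, c < t → ∀ p : (ℤ → S) × (ℤ → S),
      ((h (past t p.1) i * h (past t p.1) j - σ i j) -
        (h (past t (cutMix c p.1 p.2)) i * h (past t (cutMix c p.1 p.2)) j - σ i j)) ^ 4 ≤
      4 * decay a (t - c).toNat ^ 4 * (‖h (past t p.1)‖ ^ 8 +
        2 * (‖h (past t p.1) - h (past t (cutMix c p.1 p.2))‖ ^ 8 / decay a (t - c).toNat ^ 8) +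
        ‖h (past t (cutMix c p.1 p.2))‖ ^ 8) := fun t c _ p => by
    rw [sub_sub_sub_cancel_right]
    exact pow_four_mul_coord_sub_le _ _ i j (decay_pos _ _)
  have dint : ∀ t c : ℤ, c < t → Integrable (fun p : (ℤ → S) × (ℤ → S) =>
      ((h (past t p.1) i * h (past t p.1) j - σ i j) -
        (h (past t (cutMix c p.1 p.2)) i * h (past t (cutMix c p.1 p.2)) j - σ i j)) ^ 4)
      ((iidLaw ρ).prod (iidLaw ρ)) := fun t c hc => by
    have m1 : Measurable fun x : ℤ → S => h (past t x) i * h (past t x) j - σ i j :=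
      ((mh t i).mul (mh t j)).sub_const _
    refine (dd t c hc).1.mono' (((m1.comp measurable_fst).sub
      (m1.comp (measurable_cutMix c))).pow_const 4).aestronglyMeasurable (ae_of_all _ fun p => ?_)
    rw [Real.norm_of_nonneg (Even.pow_nonneg (by decide) _)]
    exact db t c hc p
  refine ⟨mu, ?_, int4, ?_, dint, fun t c hc => ?_⟩
  · rw [integral_sub hprod (integrable_const _), hmean]
    simp
  · refine (integral_mono int4 i4 b4).trans ?_
    rw [integral_const_mul, integral_add (hint 0).1 (integrable_const _)]
    simp only [integral_const, probReal_univ, smul_eq_mul, one_mul]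
    linarith [(hint 0).2]
  · exact (integral_mono (dint t c hc) (dd t c hc).1 (db t c hc)).trans (dd t c hc).2
end FactorHAC
-- Moment bounds for the factors
namespace FactorHAC
universe u v
variable {Ω : Type u} [MeasurableSpace Ω] {r : ℕ}
theorem ShortMemory.mono {S : Type*} [MeasurableSpace S] {ρ : Measure S} [IsProbabilityMeasure ρ]
    {a C C' : ℝ} {w : (ℕ → S) → ℝ} (h : ShortMemory ρ a C w) (hC : C ≤ C') :
    ShortMemory ρ a C' w :=
  ⟨h.meas, h.mean, h.int, h.bound.trans hC, h.diffInt, fun t c hc =>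
    (h.diffBound t c hc).trans
      (mul_le_mul_of_nonneg_right hC (pow_nonneg (decay_pos _ _).le 4))⟩
/-- The centred products of the coordinates of a decomposable Bernoulli shift are short-memory
functions of an i.i.d. sequence. -/
theorem IsBernoulliShift.exists_shortMemory {μ : Measure Ω} [IsProbabilityMeasure μ]
    {f : ℤ → Ω → EuclideanSpace ℝ (Fin r)} {ν a : ℝ} (hν : 8 ≤ ν)
    (ha : 0 ≤ a) (hf : IsBernoulliShift.{u, v} μ ν a f) :
    ∃ (S : Type v) (_ : MeasurableSpace S) (ρ : Measure S) (_ : IsProbabilityMeasure ρ)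
      (φ : Ω → ℤ → S) (w : Fin r × Fin r → (ℕ → S) → ℝ) (C₁ M : ℝ),
      MeasurePreserving φ μ (iidLaw ρ) ∧ 1 ≤ C₁ ∧ 0 ≤ M ∧ (∀ p, ShortMemory ρ a C₁ (w p)) ∧
      (∀ t p, ∀ᵐ ω ∂μ, centredProd μ f t p ω = w p (past t (φ ω))) ∧
      ∀ t, Integrable (fun ω => ‖f t ω‖ ^ 8) μ ∧ ∫ ω, ‖f t ω‖ ^ 8 ∂μ = M := by
  obtain ⟨S, _, η, h, hh, hη, hind, hid, hfh, hmem, -, c₀, hc₀, hdec⟩ := hf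
  have hρ : IsProbabilityMeasure (μ.map (η 0)) :=
    Measure.isProbabilityMeasure_map (hη 0).aemeasurable
  set ρ := μ.map (η 0) with hρdef
  have hmp : MeasurePreserving (fun ω j => η j ω) μ (iidLaw ρ) :=
    measurePreserving_iid hη hind hid
  have hmp2 : MeasurePreserving (Prod.map (fun ω j => η j ω) (fun ω j => η j ω)) (μ.prod μ)
      ((iidLaw ρ).prod (iidLaw ρ)) := hmp.prod hmp
  have hfp : ∀ t, ∀ᵐ ω ∂μ, f t ω = h (past t fun j => η j ω) := hfh
  have mh : ∀ t : ℤ, Measurable fun x : ℤ → S => h (past t x) := fun t => hh.comp (measurable_past t)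
  have mh8 : ∀ t : ℤ, AEStronglyMeasurable (fun x : ℤ → S => ‖h (past t x)‖ ^ 8) (iidLaw ρ) :=
    fun t => ((mh t).norm.pow_const 8).aestronglyMeasurable
  have h8 : ∀ t, Integrable (fun ω => ‖f t ω‖ ^ 8) μ := fun t =>
    (integral_norm_pow_eight_le (hmem t).1 hν ENNReal.toReal_nonneg
      (ENNReal.ofReal_toReal (hmem t).2.ne).ge).1
  have h8' : ∀ t, Integrable (fun x => ‖h (past t x)‖ ^ 8) (iidLaw ρ) := fun t => by
    rw [← hmp.integrable_comp (mh8 t)]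
    refine (h8 t).congr ?_
    filter_upwards [hfp t] with ω hω
    simp only [Function.comp, hω]
  have e8 : ∀ t, ∫ ω, ‖f t ω‖ ^ 8 ∂μ = ∫ x, ‖h (past t x)‖ ^ 8 ∂iidLaw ρ := fun t => by
    rw [← integral_comp_of_measurePreserving hmp (mh8 t)]
    refine integral_congr_ae ?_
    filter_upwards [hfp t] with ω hω
    simp only [hω]
  set M := ∫ x, ‖h (past 0 x)‖ ^ 8 ∂iidLaw ρ with hM
  have hM0 : 0 ≤ M := integral_nonneg fun x => by positivity
  have hMt : ∀ t, ∫ x, ‖h (past t x)‖ ^ 8 ∂iidLaw ρ = M := fun t => by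
    have he : ∀ x : ℤ → S, ‖h (past t x)‖ ^ 8 = ‖h (past 0 fun j => x (j + t))‖ ^ 8 := fun x => by
      rw [past_shift, zero_add]
    simp_rw [he]
    exact integral_comp_of_measurePreserving (measurePreserving_shift ρ t) (mh8 0)
  have hmean : ∀ i j, ∫ x, h (past 0 x) i * h (past 0 x) j ∂iidLaw ρ = sigmaF μ f i j := by
    intro i j
    have hm : Measurable fun x : ℤ → S => h (past 0 x) i * h (past 0 x) j :=
      (by fun_prop : Measurable fun z => h z i * h z j).comp (measurable_past 0)
    rw [← integral_comp_of_measurePreserving hmp hm.aestronglyMeasurable]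
    simp only [sigmaF, Matrix.of_apply]
    refine integral_congr_ae ?_
    filter_upwards [hfp 0] with ω hω
    simp only [hω]
  have hdiff : ∀ t c : ℤ, c < t →
      Integrable (fun p : (ℤ → S) × (ℤ → S) =>
        ‖h (past t p.1) - h (past t (cutMix c p.1 p.2))‖ ^ 8) ((iidLaw ρ).prod (iidLaw ρ)) ∧
      ∫ p : (ℤ → S) × (ℤ → S), ‖h (past t p.1) - h (past t (cutMix c p.1 p.2))‖ ^ 8
        ∂((iidLaw ρ).prod (iidLaw ρ)) ≤ (c₀ * 2 ^ a) ^ 8 * decay a (t - c).toNat ^ 8 := by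
    intro t c hc
    have md : Measurable fun p : (ℤ → S) × (ℤ → S) =>
        h (past t p.1) - h (past t (cutMix c p.1 p.2)) :=
      ((mh t).comp measurable_fst).sub ((mh t).comp (measurable_cutMix c))
    have hl : 1 ≤ (t - c).toNat := by omega
    have hd := hdec t (t - c).toNat hl
    have hd' := integral_norm_pow_eight_le
      (g := fun w : Ω × Ω => h (past t fun j => η j w.1) -
        h (past t (cutMix c (fun j => η j w.1) fun j => η j w.2)))
      (md.comp hmp2.measurable).aestronglyMeasurable hν
      (c := c₀ * 2 ^ a * decay a (t - c).toNat)
      (mul_nonneg (by positivity) (decay_pos _ _).le) (by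
        have e1 : c = t - ((t - c).toNat : ℤ) := by omega
        have e2 : ∀ w : Ω × Ω, past t (cutMix c (fun j => η j w.1) fun j => η j w.2) =
            splice (t - c).toNat (fun j : ℕ => η (t - j) w.1) (fun j : ℕ => η (t - j) w.2) := by
          intro w
          conv_lhs => rw [e1]
          exact past_cutMix_eq_splice t _ (fun j => η j w.1) fun j => η j w.2
        simp_rw [e2]
        refine hd.trans (ENNReal.ofReal_le_ofReal ?_)
        rw [mul_assoc]
        refine mul_le_mul_of_nonneg_left ?_ hc₀.le
        -- For l ≥ 1 one has l ≥ (l + 1)/2, which converts l^(-a) into `decay` at the cost of 2^a.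
        have hl' : (1 : ℝ) ≤ ((t - c).toNat : ℕ) := by exact_mod_cast hl
        calc (((t - c).toNat : ℕ) : ℝ) ^ (-a) ≤ ((((t - c).toNat : ℕ) + 1 : ℝ) / 2) ^ (-a) :=
              Real.rpow_le_rpow_of_nonpos (by positivity) (by linarith) (by linarith)
          _ = 2 ^ a * decay a (t - c).toNat := by
            rw [Real.div_rpow (by positivity) (by norm_num),
              Real.rpow_neg (by norm_num : (0:ℝ) ≤ 2), decay, div_inv_eq_mul, mul_comm])
    have ms : AEStronglyMeasurable (fun p : (ℤ → S) × (ℤ → S) =>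
        ‖h (past t p.1) - h (past t (cutMix c p.1 p.2))‖ ^ 8) ((iidLaw ρ).prod (iidLaw ρ)) :=
      (md.norm.pow_const 8).aestronglyMeasurable
    constructor
    · rw [← hmp2.integrable_comp ms]
      exact hd'.1
    · rw [← integral_comp_of_measurePreserving hmp2 ms, ← mul_pow]
      exact hd'.2
  -- One constant for all coordinate pairs: the double sum dominates each fourth power of an entry
  -- of Σ_F, and the summand 1 secures C₁ ≥ 1.
  set C₁ : ℝ := 1 + 8 * M + 8 * ∑ i, ∑ j, sigmaF μ f i j ^ 4 + 8 * (c₀ * 2 ^ a) ^ 8 with hC₁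
  have hσn : ∀ i j, 0 ≤ sigmaF μ f i j ^ 4 := fun i j => Even.pow_nonneg (by decide) _
  have hσ : ∀ i j, sigmaF μ f i j ^ 4 ≤ ∑ i, ∑ j, sigmaF μ f i j ^ 4 := fun i j =>
    (Finset.single_le_sum (fun j _ => hσn i j) (Finset.mem_univ j)).trans
      (Finset.single_le_sum (f := fun i => ∑ j, sigmaF μ f i j ^ 4)
        (fun i _ => Finset.sum_nonneg fun j _ => hσn i j) (Finset.mem_univ i))
  have hσ0 : 0 ≤ ∑ i, ∑ j, sigmaF μ f i j ^ 4 :=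
    Finset.sum_nonneg fun i _ => Finset.sum_nonneg fun j _ => hσn i j
  have hc8 : 0 ≤ (c₀ * 2 ^ a) ^ 8 := by positivity
  have hC1 : 1 ≤ C₁ := by rw [hC₁]; linarith
  let w : Fin r × Fin r → (ℕ → S) → ℝ := fun p z => h z p.1 * h z p.2 - sigmaF μ f p.1 p.2
  have hw : ∀ p, ShortMemory ρ a C₁ (w p) := fun p =>
    (shortMemory_mul_sub hh (fun t => ⟨h8' t, (hMt t).le⟩) hmean hdiff p.1 p.2).mono
      (by rw [hC₁]; linarith [hσ p.1 p.2])
  refine ⟨S, _, ρ, hρ, fun ω j => η j ω, w, C₁, M, hmp, hC1, hM0, hw, fun t p => ?_,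
    fun t => ⟨h8 t, (e8 t).trans (hMt t)⟩⟩
  · filter_upwards [hfp t] with ω hω
    simp only [centredProd, w, hω]
/-- Moment bounds for the centred products of the coordinates of a decomposable Bernoulli shift:
decay of the autocovariances, and the order of the variance of partial sums and of sample
autocovariances, uniformly in the lag. -/
theorem IsBernoulliShift.exists_moment_bounds {μ : Measure Ω} [IsProbabilityMeasure μ]
    {f : ℤ → Ω → EuclideanSpace ℝ (Fin r)} {ν a : ℝ} (hν : 8 ≤ ν) (ha : 2 < a)
    (hf : IsBernoulliShift.{u, v} μ ν a f) :
    ∃ C : ℝ, 0 < C ∧ ∃ Γ : Fin r × Fin r → Fin r × Fin r → ℕ → ℝ,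
      (∀ p q l, |Γ p q l| ≤ C * decay a l) ∧
      (∀ t, Integrable (fun ω => ‖f t ω‖ ^ 8) μ ∧ ∫ ω, ‖f t ω‖ ^ 8 ∂μ ≤ C) ∧
      (∀ t p, Integrable (centredProd μ f t p) μ ∧ ∫ ω, centredProd μ f t p ω ∂μ = 0) ∧
      (∀ p q s (l : ℕ),
        Integrable (fun ω => centredProd μ f (s + l) p ω * centredProd μ f s q ω) μ ∧
        ∫ ω, centredProd μ f (s + l) p ω * centredProd μ f s q ω ∂μ = Γ p q l) ∧
      (∀ p (I : Finset ℤ), Integrable (fun ω => (∑ t ∈ I, centredProd μ f t p ω) ^ 2) μ ∧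
        ∫ ω, (∑ t ∈ I, centredProd μ f t p ω) ^ 2 ∂μ ≤ C * I.card) ∧
      (∀ p q (l : ℕ) (I : Finset ℤ),
        Integrable (fun ω => (∑ t ∈ I, (centredProd μ f t p ω * centredProd μ f (t - l) q ω -
          Γ p q l)) ^ 2) μ ∧
        ∫ ω, (∑ t ∈ I, (centredProd μ f t p ω * centredProd μ f (t - l) q ω - Γ p q l)) ^ 2 ∂μ ≤
          C * I.card) := by
  obtain ⟨S, _, ρ, _, φ, w, C₁, M, hmp, hC1, hM0, hw, hcp, h8⟩ :=
    hf.exists_shortMemory hν (by linarith)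
  obtain ⟨W, hW0, hW⟩ := sum_sum_decay_le (a := a) (by linarith)
  have mw : ∀ t p, Measurable fun x : ℤ → S => w p (past t x) := fun t p =>
    (hw p).meas.comp (measurable_past t)
  have mS : ∀ p (I : Finset ℤ), Measurable fun x : ℤ → S => (∑ t ∈ I, w p (past t x)) ^ 2 :=
    fun p I => (Finset.measurable_fun_sum I fun t _ => mw t p).pow_const 2
  have mP : ∀ p q (l : ℕ) (I : Finset ℤ) (g : ℝ), Measurable fun x : ℤ → S =>
      (∑ t ∈ I, (w p (past t x) * w q (past (t - l) x) - g)) ^ 2 :=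
    fun p q l I g => (Finset.measurable_fun_sum I fun t _ =>
      ((mw t p).mul (mw (t - l) q)).sub_const g).pow_const 2
  have ha0 : 0 ≤ a := by linarith
  -- Every variable of interest is almost surely a function of the innovations, whose joint law is
  -- `iidLaw ρ`.
  have transfer : ∀ (F : Ω → ℝ) (G : (ℤ → S) → ℝ), Measurable G →
      (∀ᵐ ω ∂μ, F ω = G (φ ω)) → Integrable G (iidLaw ρ) →
      Integrable F μ ∧ ∫ ω, F ω ∂μ = ∫ x, G x ∂iidLaw ρ := by
    intro F G hG hFG hi
    have hi' : Integrable (fun ω => G (φ ω)) μ := hmp.integrable_comp_of_integrable hi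
    refine ⟨hi'.congr (hFG.mono fun ω hω => hω.symm), ?_⟩
    rw [← integral_comp_of_measurePreserving hmp hG.aestronglyMeasurable]
    exact integral_congr_ae hFG
  have hlin : ∀ t p, Integrable (fun x => w p (past t x)) (iidLaw ρ) := fun t p => by
    have hp := (hw p).isPastVar (le_refl t)
    have := (integrable_mul_four hp (IsPastVar.one hC1 0) (IsPastVar.one hC1 0)
      (IsPastVar.one hC1 0)).1
    simpa using this
  -- The summands serve, in turn, the decay of autocovariances, the eighth moments, the variance of
  -- sums and the variance of sample autocovariances.
  let C : ℝ := C₁ + M + C₁ * W + 2 * C₁ ^ 2 * 2 ^ a * W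
  have hCW : 0 ≤ C₁ * W := by positivity
  have hCW2 : 0 ≤ 2 * C₁ ^ 2 * 2 ^ a * W := by positivity
  refine ⟨C, by simp only [C]; linarith, fun p q l => ∫ x, w p (past l x) * w q (past 0 x) ∂iidLaw ρ,
    fun p q l => ?_, fun t => ⟨(h8 t).1, ?_⟩, fun t p => ?_, fun p q s l => ?_, fun p I => ?_,
    fun p q l I => ?_⟩
  · have := ShortMemory.abs_integral_mul_le hC1 (hw p) (hw q) l 0
    simp only [sub_zero, Int.natAbs_natCast] at this
    refine this.trans (mul_le_mul_of_nonneg_right ?_ (decay_pos _ _).le)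
    simp only [C]; linarith
  · rw [(h8 t).2]
    simp only [C]; linarith
  · obtain ⟨k1, k2⟩ := transfer _ _ (mw t p) (hcp t p) (hlin t p)
    exact ⟨k1, k2.trans ((hw p).mean_eq_zero t)⟩
  · obtain ⟨k1, k2⟩ := transfer (fun ω => centredProd μ f (s + l) p ω * centredProd μ f s q ω)
      (fun x => w p (past (s + l) x) * w q (past s x)) ((mw _ _).mul (mw _ _))
      (by filter_upwards [hcp (s + l) p, hcp s q] with ω h1 h2
          rw [h1, h2])
      (ShortMemory.integrable_mul hC1 (hw p) (hw q) _ _)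
    refine ⟨k1, k2.trans ?_⟩
    have := (hw p).integral_mul_shift (hw q) l 0 s
    rw [add_comm (l : ℤ) s, zero_add] at this
    exact this
  · have hI := ShortMemory.integral_sum_sq_le hW hC1 (hw p) I
    obtain ⟨k1, k2⟩ := transfer (fun ω => (∑ t ∈ I, centredProd μ f t p ω) ^ 2)
      (fun x => (∑ t ∈ I, w p (past t x)) ^ 2)
      (mS p I)
      (by filter_upwards [(Finset.eventually_all I).2 fun t _ => hcp t p] with ω h1
          rw [Finset.sum_congr rfl fun t ht => h1 t ht]) hI.1
    refine ⟨k1, k2.trans_le (hI.2.trans (mul_le_mul_of_nonneg_right ?_ (Nat.cast_nonneg _)))⟩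
    simp only [C]; linarith
  · have hI := ShortMemory.integral_sum_prod_sq_le hW ha0 hC1 (hw p) (hw q) l I
    obtain ⟨k1, k2⟩ := transfer (fun ω => (∑ t ∈ I, (centredProd μ f t p ω *
        centredProd μ f (t - l) q ω - ∫ x, w p (past l x) * w q (past 0 x) ∂iidLaw ρ)) ^ 2)
      (fun x => (∑ t ∈ I, (w p (past t x) * w q (past (t - l) x) -
        ∫ x, w p (past l x) * w q (past 0 x) ∂iidLaw ρ)) ^ 2)
      (mP p q l I _)
      (by filter_upwards [(Finset.eventually_all I).2 fun t _ => hcp t p,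
            (Finset.eventually_all I).2 fun t _ => hcp (t - l) q] with ω h1 h2
          rw [Finset.sum_congr rfl fun t ht => by rw [h1 t ht, h2 t ht]]) hI.1
    refine ⟨k1, k2.trans_le (hI.2.trans (mul_le_mul_of_nonneg_right ?_ (Nat.cast_nonneg _)))⟩
    simp only [C]; linarith
end FactorHAC
-- Bartlett sums
namespace FactorHAC
section Bartlett
variable {ι κ : Type*}
/-- The lag-`l` sample second-moment matrix of the scores `S`. -/
noncomputable def sampleCov {T : ℕ} (S : Fin T → ι → ℝ) (l : ℕ) : Matrix ι ι ℝ :=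
  Matrix.of fun p q => (T : ℝ)⁻¹ * ∑ x : Fin T × Fin T with (x.1 : ℕ) = x.2 + l, S x.1 p * S x.2 q
/-- The Bartlett-weighted sum of a sequence of autocovariance matrices. -/
noncomputable def bartlett (Γ : ℕ → Matrix ι ι ℝ) (m : ℕ) : Matrix ι ι ℝ :=
  Γ 0 + ∑ l ∈ Finset.Icc 1 m, (1 - (l : ℝ) / ((m : ℝ) + 1)) • (Γ l + (Γ l)ᵀ)
theorem sampleCov_eq_sum {T : ℕ} (S : Fin T → ι → ℝ) (l : ℕ) : sampleCov S l = (T : ℝ)⁻¹ •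
    ∑ x : Fin T × Fin T with (x.1 : ℕ) = x.2 + l, Matrix.vecMulVec (S x.1) (S x.2) := by
  ext p q
  simp [sampleCov, Matrix.sum_apply, Matrix.vecMulVec_apply]
theorem gammaHat_eq_sampleCov {r T : ℕ} (Ghat : Matrix (Fin T) (Fin r) ℝ) :
    gammaHat Ghat = sampleCov (scoreVec Ghat) := by
  funext l
  rw [gammaHat, sampleCov_eq_sum]
theorem hacEstimator_eq_bartlett {r T : ℕ} (Ghat : Matrix (Fin T) (Fin r) ℝ) (m : ℕ) :
    hacEstimator Ghat m = bartlett (sampleCov (scoreVec Ghat)) m := by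
  rw [hacEstimator, bartlett, gammaHat_eq_sampleCov]
theorem bartlett_apply (Γ : ℕ → Matrix ι ι ℝ) (m : ℕ) (p q : ι) :
    bartlett Γ m p q =
      Γ 0 p q + ∑ l ∈ Finset.Icc 1 m, (1 - (l : ℝ) / ((m : ℝ) + 1)) * (Γ l p q + Γ l q p) := by
  simp [bartlett, Matrix.sum_apply, mul_add]
-- Bartlett weights lie in [0, 1], so entrywise errors add up over the lags 0, …, m.
theorem abs_bartlett_sub_le (Γ Γ' : ℕ → Matrix ι ι ℝ) (m : ℕ) (p q : ι) :
    |bartlett Γ m p q - bartlett Γ' m p q| ≤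
      ∑ l ∈ Finset.range (m + 1), (|Γ l p q - Γ' l p q| + |Γ l q p - Γ' l q p|) := by
  have h : bartlett Γ m p q - bartlett Γ' m p q = (Γ 0 p q - Γ' 0 p q) +
      ∑ l ∈ Finset.Icc 1 m, (1 - (l : ℝ) / ((m : ℝ) + 1)) *
        ((Γ l p q - Γ' l p q) + (Γ l q p - Γ' l q p)) := by
    rw [bartlett_apply, bartlett_apply, add_sub_add_comm, ← Finset.sum_sub_distrib]
    congr 1
    exact Finset.sum_congr rfl fun l _ => by ring
  have hr : Finset.range (m + 1) = insert 0 (Finset.Icc 1 m) := by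
    ext l
    simp only [Finset.mem_range, Finset.mem_insert, Finset.mem_Icc]
    omega
  rw [h, hr, Finset.sum_insert (by simp)]
  refine (abs_add_le _ _).trans (add_le_add (by simp) ?_)
  refine (Finset.abs_sum_le_sum_abs _ _).trans (Finset.sum_le_sum fun l hl => ?_)
  have hlm : (l : ℝ) ≤ m := by exact_mod_cast (Finset.mem_Icc.1 hl).2
  have hw : |1 - (l : ℝ) / ((m : ℝ) + 1)| ≤ 1 := by
    have h1 : (l : ℝ) / ((m : ℝ) + 1) ≤ 1 := (div_le_one (by positivity)).2 (by linarith)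
    have h2 : 0 ≤ (l : ℝ) / ((m : ℝ) + 1) := by positivity
    rw [abs_le]
    constructor <;> linarith
  rw [abs_mul]
  calc _ ≤ 1 * |Γ l p q - Γ' l p q + (Γ l q p - Γ' l q p)| :=
        mul_le_mul_of_nonneg_right hw (abs_nonneg _)
    _ ≤ _ := by rw [one_mul]; exact abs_add_le _ _
-- With `sampleCov_mulVec`, this makes the HAC estimator equivariant under linear maps of the
-- scores, in accordance with the sandwich form of V.
theorem bartlett_mul_mul_transpose [Fintype ι] (J : Matrix κ ι ℝ) (Γ : ℕ → Matrix ι ι ℝ) (m : ℕ) :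
    bartlett (fun l => J * Γ l * Jᵀ) m = J * bartlett Γ m * Jᵀ := by
  simp only [bartlett, Matrix.mul_add, Matrix.add_mul, Matrix.mul_sum, Matrix.sum_mul,
    Matrix.mul_smul, Matrix.smul_mul, Matrix.transpose_mul, Matrix.transpose_transpose,
    Matrix.mul_assoc]
theorem sampleCov_mulVec [Fintype ι] {T : ℕ} (J : Matrix κ ι ℝ) (S : Fin T → ι → ℝ) :
    sampleCov (fun t => J *ᵥ S t) = fun l => J * sampleCov S l * Jᵀ := by
  funext l
  rw [sampleCov_eq_sum, sampleCov_eq_sum, Matrix.mul_smul, Matrix.smul_mul, Matrix.mul_sum,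
    Matrix.sum_mul]
  simp_rw [Matrix.mul_vecMulVec, Matrix.vecMulVec_mul, Matrix.vecMul_transpose]
/-- Summation over the pairs of times according to their lag. -/
theorem sum_sum_lag (A B : ℕ → ℝ) (k : ℕ) :
    ∑ s ∈ Finset.range k, ∑ t ∈ Finset.range k, (if t ≤ s then A (s - t) else B (t - s)) =
      k * A 0 + ∑ l ∈ Finset.Icc 1 k, ((k : ℝ) - l) * (A l + B l) := by
  induction k with
  | zero => simp
  | succ k ih =>
    -- The step from k to k + 1 adds a row and a column, in which each lag 1, …, k occurs once, and
    -- a diagonal corner with lag zero.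
    have h1 : ∑ t ∈ Finset.range k, (if t ≤ k then A (k - t) else B (t - k)) =
        ∑ l ∈ Finset.Icc 1 k, A l := by
      refine Finset.sum_bij (fun t _ => k - t) ?_ ?_ ?_ ?_
      · intro t ht; simp only [Finset.mem_range, Finset.mem_Icc] at *; omega
      · intro t ht t' ht' h; simp only [Finset.mem_range] at *; omega
      · intro l hl
        simp only [Finset.mem_Icc] at hl
        exact ⟨k - l, by simp only [Finset.mem_range]; omega, by omega⟩
      · intro t ht
        rw [if_pos (Finset.mem_range.1 ht).le]
    have h2 : ∑ s ∈ Finset.range k, (if k ≤ s then A (s - k) else B (k - s)) =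
        ∑ l ∈ Finset.Icc 1 k, B l := by
      refine Finset.sum_bij (fun t _ => k - t) ?_ ?_ ?_ ?_
      · intro t ht; simp only [Finset.mem_range, Finset.mem_Icc] at *; omega
      · intro t ht t' ht' h; simp only [Finset.mem_range] at *; omega
      · intro l hl
        simp only [Finset.mem_Icc] at hl
        exact ⟨k - l, by simp only [Finset.mem_range]; omega, by omega⟩
      · intro t ht
        rw [if_neg (not_le.2 (Finset.mem_range.1 ht))]
    rw [Finset.sum_range_succ, Finset.sum_range_succ]
    simp_rw [Finset.sum_range_succ]
    rw [Finset.sum_add_distrib, ih, h1, h2, Finset.sum_Icc_succ_top (by omega)]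
    simp only [le_refl, if_true, Nat.sub_self, Nat.cast_add, Nat.cast_one, sub_self, zero_mul,
      add_zero]
    have : ∑ l ∈ Finset.Icc 1 k, ((k : ℝ) + 1 - l) * (A l + B l) =
        ∑ l ∈ Finset.Icc 1 k, ((k : ℝ) - l) * (A l + B l) + ∑ l ∈ Finset.Icc 1 k, A l +
          ∑ l ∈ Finset.Icc 1 k, B l := by
      rw [← Finset.sum_add_distrib, ← Finset.sum_add_distrib]
      exact Finset.sum_congr rfl fun l _ => by ring
    rw [this]
    ring
/-- The Cesàro-type means of absolutely summable autocovariances converge at rate `1 / k`. -/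
theorem abs_sub_bartlett_le {Γ : ℕ → Matrix ι ι ℝ} {a C : ℝ} (ha : 2 < a) (hC : 0 ≤ C)
    (hΓ : ∀ p q l, |Γ l p q| ≤ C * decay a l) {D : Matrix ι ι ℝ} {p q : ι}
    (hD : Tendsto (fun m => bartlett Γ m p q) atTop (𝓝 (D p q))) (m : ℕ) :
    |bartlett Γ m p q - D p q| ≤ 2 * C * (∑' l : ℕ, (l : ℝ) * decay a l) / (m + 1) := by
  have hs := summable_mul_decay ha
  have hn : ∀ l : ℕ, 0 ≤ (l : ℝ) * decay a l := fun l => mul_nonneg l.cast_nonneg (decay_pos _ _).le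
  -- Compare with a larger bandwidth m' and let m' tend to infinity: the weights of lag l differ by
  -- at most l/(m + 1), so ∑ l |Γ(l)| enters.
  have key : ∀ m' ≥ m, |bartlett Γ m p q - bartlett Γ m' p q| ≤
      2 * C * (∑' l : ℕ, (l : ℝ) * decay a l) / (m + 1) := by
    intro m' hm
    have hmr : (m : ℝ) ≤ m' := by exact_mod_cast hm
    -- Truncating the weight at zero extends the sum from m to m' without changing it.
    have e1 : bartlett Γ m p q = Γ 0 p q + ∑ l ∈ Finset.Icc 1 m',
        max 0 (1 - (l : ℝ) / ((m : ℝ) + 1)) * (Γ l p q + Γ l q p) := by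
      rw [bartlett_apply]
      congr 1
      rw [← Finset.sum_subset (Finset.Icc_subset_Icc_right hm)]
      · refine Finset.sum_congr rfl fun l hl => ?_
        have hlm : (l : ℝ) ≤ m := by exact_mod_cast (Finset.mem_Icc.1 hl).2
        rw [max_eq_right]
        have h1 : (l : ℝ) / ((m : ℝ) + 1) ≤ 1 := (div_le_one (by positivity)).2 (by linarith)
        linarith
      · intro l hl hl'
        have : m + 1 ≤ l := by
          simp only [Finset.mem_Icc] at hl hl'
          omega
        have hlm : (m : ℝ) + 1 ≤ l := by exact_mod_cast this
        have h1 : 1 ≤ (l : ℝ) / ((m : ℝ) + 1) := (one_le_div (by positivity)).2 (by linarith)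
        rw [max_eq_left (by linarith), zero_mul]
    rw [e1, bartlett_apply, add_sub_add_left_eq_sub, ← Finset.sum_sub_distrib]
    refine (Finset.abs_sum_le_sum_abs _ _).trans ?_
    calc ∑ l ∈ Finset.Icc 1 m', |max 0 (1 - (l : ℝ) / ((m : ℝ) + 1)) * (Γ l p q + Γ l q p) -
          (1 - (l : ℝ) / ((m' : ℝ) + 1)) * (Γ l p q + Γ l q p)|
        ≤ ∑ l ∈ Finset.Icc 1 m', 2 * C / (m + 1) * ((l : ℝ) * decay a l) := by
          refine Finset.sum_le_sum fun l hl => ?_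
          have hlm : (l : ℝ) ≤ m' := by exact_mod_cast (Finset.mem_Icc.1 hl).2
          have h1 : (l : ℝ) / ((m' : ℝ) + 1) ≤ 1 := (div_le_one (by positivity)).2 (by linarith)
          have h2 : (l : ℝ) / ((m' : ℝ) + 1) ≤ (l : ℝ) / ((m : ℝ) + 1) := by gcongr
          have h3 : 0 ≤ (l : ℝ) / ((m' : ℝ) + 1) := by positivity
          rw [← sub_mul, abs_mul]
          have hw : |max 0 (1 - (l : ℝ) / ((m : ℝ) + 1)) - (1 - (l : ℝ) / ((m' : ℝ) + 1))| ≤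
              (l : ℝ) / ((m : ℝ) + 1) := by
            rcases max_cases 0 (1 - (l : ℝ) / ((m : ℝ) + 1)) with ⟨h, h'⟩ | ⟨h, h'⟩ <;>
              rw [h, abs_le] <;> constructor <;> linarith
          have hg : |Γ l p q + Γ l q p| ≤ 2 * (C * decay a l) := by
            refine (abs_add_le _ _).trans ?_
            linarith [hΓ p q l, hΓ q p l]
          calc _ ≤ (l : ℝ) / ((m : ℝ) + 1) * (2 * (C * decay a l)) :=
                mul_le_mul hw hg (abs_nonneg _) (by positivity)
            _ = _ := by ring
      _ = 2 * C / (m + 1) * ∑ l ∈ Finset.Icc 1 m', (l : ℝ) * decay a l := by rw [Finset.mul_sum]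
      _ ≤ 2 * C / (m + 1) * ∑' l : ℕ, (l : ℝ) * decay a l := by
          refine mul_le_mul_of_nonneg_left (hs.sum_le_tsum _ fun l _ => hn l) (by positivity)
      _ = _ := by ring
  have ht : Tendsto (fun m' => |bartlett Γ m p q - bartlett Γ m' p q|) atTop
      (𝓝 |bartlett Γ m p q - D p q|) := (tendsto_const_nhds.sub hD).abs
  exact le_of_tendsto ht (eventually_atTop.2 ⟨m, key⟩)
end Bartlett
end FactorHAC
-- The HAC estimator computed from the true scores
namespace FactorHAC
-- Index x of `Fin T` stands for time x + 1, so the later time of a pair with lag l runs over l + 1,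
-- …, T.
theorem sum_pairs_eq_sum_Ioc (T l : ℕ) (φ : ℤ → ℤ → ℝ) :
    ∑ x : Fin T × Fin T with (x.1 : ℕ) = x.2 + l, φ ((x.1 : ℕ) + 1) ((x.2 : ℕ) + 1) =
      ∑ t ∈ Finset.Ioc (l : ℤ) T, φ t (t - l) := by
  refine Finset.sum_bij (fun x _ => ((x.1 : ℕ) : ℤ) + 1) ?_ ?_ ?_ ?_
  · rintro ⟨x, y⟩ hx
    simp only [Finset.mem_filter, Finset.mem_univ, true_and, Finset.mem_Ioc] at *
    have := x.2
    omega
  · rintro ⟨x, y⟩ hx ⟨x', y'⟩ hx' h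
    simp only [Finset.mem_filter, Finset.mem_univ, true_and] at *
    ext <;> simp <;> omega
  · intro t ht
    simp only [Finset.mem_Ioc] at ht
    refine ⟨(⟨(t - 1).toNat, by omega⟩, ⟨(t - 1 - l).toNat, by omega⟩), ?_, ?_⟩
    · simp only [Finset.mem_filter, Finset.mem_univ, true_and]
      omega
    · simp only
      omega
  · rintro ⟨x, y⟩ hx
    simp only [Finset.mem_filter, Finset.mem_univ, true_and] at hx
    congr 1
    push_cast [hx]
    ring
theorem sum_fin_eq_sum_Ioc (T : ℕ) (φ : ℤ → ℝ) :
    ∑ t : Fin T, φ ((t : ℕ) + 1) = ∑ t ∈ Finset.Ioc (0 : ℤ) T, φ t := by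
  refine Finset.sum_bij (fun x _ => ((x : ℕ) : ℤ) + 1) ?_ ?_ ?_ ?_
  · intro x _
    simp only [Finset.mem_Ioc]
    have := x.2
    omega
  · intro x _ y _ h
    ext
    omega
  · intro t ht
    simp only [Finset.mem_Ioc] at ht
    exact ⟨⟨(t - 1).toNat, by omega⟩, Finset.mem_univ _, by simp only; omega⟩
  · intro x _
    rfl
theorem sum_Icc_eq_sum_range (T : ℕ) (φ : ℕ → ℝ) :
    ∑ t ∈ Finset.Icc 1 T, φ t = ∑ t ∈ Finset.range T, φ (t + 1) := by
  refine Finset.sum_nbij' (fun t => t - 1) (fun t => t + 1) ?_ ?_ ?_ ?_ ?_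
  · intro t ht; simp only [Finset.mem_Icc, Finset.mem_range] at *; omega
  · intro t ht; simp only [Finset.mem_Icc, Finset.mem_range] at *; omega
  · intro t ht; simp only [Finset.mem_Icc] at *; omega
  · intro t ht; simp
  · intro t ht
    rw [Nat.sub_add_cancel (Finset.mem_Icc.1 ht).1]
-- Young's inequality with weight √T: if x² has mean O(1/T), then |x| has mean O(1/√T).
theorem abs_le_of_sqrt_weight {T : ℝ} (hT : 0 < T) (x : ℝ) :
    |x| ≤ (√T * x ^ 2 + 1 / √T) / 2 := by
  have hs : 0 < √T := Real.sqrt_pos.2 hT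
  have h : 0 ≤ (√T * |x| - 1) ^ 2 / √T := by positivity
  have e : (√T * |x| - 1) ^ 2 / √T = √T * x ^ 2 + 1 / √T - 2 * |x| := by
    field_simp
    rw [← sq_abs x]
    ring
  linarith
universe u v
variable {Ω : Type u} [MeasurableSpace Ω] {r : ℕ}
/-- The centred scores `Vech(f_t f_tᵀ) - E Vech(f_t f_tᵀ)`, `1 ≤ t ≤ T`. -/
noncomputable def trueScore (μ : Measure Ω) (f : ℤ → Ω → EuclideanSpace ℝ (Fin r)) (T : ℕ) (ω : Ω)
    (t : Fin T) (p : VechIdx r) : ℝ :=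
  centredProd μ f (((t : ℕ) : ℤ) + 1) p.1 ω
-- Among m + 1 consecutive times, lag l occurs m + 1 - l times in each direction; division by m + 1
-- yields exactly the Bartlett weight. Thus D is a limit of Bartlett sums.
theorem partialSumCov_succ_eq_bartlett {μ : Measure Ω} [IsProbabilityMeasure μ]
    {f : ℤ → Ω → EuclideanSpace ℝ (Fin r)} {Γ : Fin r × Fin r → Fin r × Fin r → ℕ → ℝ}
    (h₁ : ∀ t p, Integrable (centredProd μ f t p) μ ∧ ∫ ω, centredProd μ f t p ω ∂μ = 0)
    (h₂ : ∀ p q s (l : ℕ),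
        Integrable (fun ω => centredProd μ f (s + l) p ω * centredProd μ f s q ω) μ ∧
        ∫ ω, centredProd μ f (s + l) p ω * centredProd μ f s q ω ∂μ = Γ p q l) (m : ℕ) :
    partialSumCov μ f (m + 1) = bartlett (fun l => Matrix.of fun p q => Γ p.1 q.1 l) m := by
  have hv : ∀ (t : ℤ) (p : VechIdx r) ω,
      vechF f t ω p - ∫ ω', vechF f t ω' p ∂μ = centredProd μ f t p.1 ω := by
    intro t p ω
    have e : ∀ ω, vechF f t ω p = centredProd μ f t p.1 ω + sigmaF μ f p.1.1 p.1.2 := fun ω => by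
      simp [vechF, vech, centredProd, Matrix.vecMulVec_apply]
    simp_rw [e]
    rw [integral_add (h₁ t p.1).1 (integrable_const _), (h₁ t p.1).2]
    simp
  have hcov : ∀ (p q : Fin r × Fin r) (s t : ℕ),
      Integrable (fun ω => centredProd μ f ((s + 1 : ℕ) : ℤ) p ω *
        centredProd μ f ((t + 1 : ℕ) : ℤ) q ω) μ ∧
      ∫ ω, centredProd μ f ((s + 1 : ℕ) : ℤ) p ω * centredProd μ f ((t + 1 : ℕ) : ℤ) q ω ∂μ =
        if t ≤ s then Γ p q (s - t) else Γ q p (t - s) := by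
    intro p q s t
    split_ifs with h
    · have := h₂ p q ((t + 1 : ℕ) : ℤ) (s - t)
      rwa [show ((t + 1 : ℕ) : ℤ) + (s - t : ℕ) = ((s + 1 : ℕ) : ℤ) by omega] at this
    · have := h₂ q p ((s + 1 : ℕ) : ℤ) (t - s)
      rw [show ((s + 1 : ℕ) : ℤ) + (t - s : ℕ) = ((t + 1 : ℕ) : ℤ) by omega] at this
      simp_rw [mul_comm (centredProd μ f ((s + 1 : ℕ) : ℤ) p _)]
      exact this
  ext p q
  simp only [partialSumCov, Matrix.of_apply, hv]
  simp_rw [sum_Icc_eq_sum_range, Finset.sum_mul_sum]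
  rw [bartlett_apply]
  simp only [Matrix.of_apply]
  rw [integral_finsetSum _ fun s _ => integrable_finsetSum _ fun t _ => (hcov p.1 q.1 s t).1]
  rw [Finset.sum_congr rfl fun s _ => integral_finsetSum _ fun t _ => (hcov p.1 q.1 s t).1]
  simp_rw [fun s t => (hcov p.1 q.1 s t).2]
  rw [sum_sum_lag (fun l => Γ p.1 q.1 l) (fun l => Γ q.1 p.1 l), mul_add, Finset.mul_sum,
    Finset.sum_Icc_succ_top (by omega)]
  have hm : ((m : ℝ) + 1) ≠ 0 := by positivity
  push_cast
  rw [sub_self, zero_mul, mul_zero, add_zero]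
  congr 1
  · field_simp
  · refine Finset.sum_congr rfl fun l _ => ?_
    field_simp
/-- Stochastic and deterministic error of the HAC estimator computed from the true scores. -/
theorem FactorAssumption.exists_bounds {μ : Measure Ω} [IsProbabilityMeasure μ]
    {f : ℤ → Ω → EuclideanSpace ℝ (Fin r)} {D : Matrix (VechIdx r) (VechIdx r) ℝ}
    (h : FactorAssumption.{u, v} 1 μ f D) :
    ∃ K : ℝ, 0 < K ∧
      (∀ t, Integrable (fun ω => ‖f t ω‖ ^ 8) μ ∧ ∫ ω, ‖f t ω‖ ^ 8 ∂μ ≤ K) ∧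
      (∀ T : ℕ, 1 ≤ T → ∀ p, Integrable (fun ω => ((T : ℝ)⁻¹ *
          ∑ t : Fin T, centredProd μ f (((t : ℕ) : ℤ) + 1) p ω) ^ 2) μ ∧
        ∫ ω, ((T : ℝ)⁻¹ * ∑ t : Fin T, centredProd μ f (((t : ℕ) : ℤ) + 1) p ω) ^ 2 ∂μ ≤ K / T) ∧
      ∃ Y : ℕ → ℕ → Ω → ℝ, ∀ T m : ℕ, 1 ≤ T → 1 ≤ m →
        (Integrable (Y T m) μ ∧ ∫ ω, Y T m ω ∂μ ≤ K * (m / √T)) ∧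
        ∀ ω, 0 ≤ Y T m ω ∧ ∀ p q,
          |bartlett (sampleCov (trueScore μ f T ω)) m p q - D p q| ≤ Y T m ω + K / m := by
  obtain ⟨ε, ν, a, hε, -, hν, ha, hsh⟩ := h.shift
  obtain ⟨C, hC, Γ, hΓ, h8, h1, h2, hS, hP⟩ :=
    hsh.exists_moment_bounds (by push_cast at hν; linarith) ha
  set G : ℕ → Matrix (VechIdx r) (VechIdx r) ℝ := fun l => Matrix.of fun p q => Γ p.1 q.1 l with hG
  have hGb : ∀ p q l, |G l p q| ≤ C * decay a l := fun p q l => hΓ p.1 q.1 l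
  have hlim : ∀ p q, Tendsto (fun m => bartlett G m p q) atTop (𝓝 (D p q)) := by
    intro p q
    have h3 := (h.longRun.comp (tendsto_add_atTop_nat 1))
    have h4 : (partialSumCov μ f ∘ fun m => m + 1) = fun m => bartlett G m :=
      funext fun m => partialSumCov_succ_eq_bartlett h1 h2 m
    rw [h4] at h3
    exact tendsto_pi_nhds.1 (tendsto_pi_nhds.1 h3 p) q
  set A : ℝ := ∑' l : ℕ, (l : ℝ) * decay a l with hA
  have hn : ∀ l : ℕ, 0 ≤ (l : ℝ) * decay a l := fun l => mul_nonneg l.cast_nonneg (decay_pos _ _).le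
  have hA0 : 0 ≤ A := tsum_nonneg hn
  have hle : ∀ s : Finset ℕ, ∑ l ∈ s, (l : ℝ) * decay a l ≤ A := fun s =>
    (summable_mul_decay ha).sum_le_tsum _ fun l _ => hn l
  let U : ℕ → Fin r × Fin r → Fin r × Fin r → ℕ → Ω → ℝ := fun T p q l ω =>
    (T : ℝ)⁻¹ * ∑ t ∈ Finset.Ioc (l : ℤ) T,
      (centredProd μ f t p ω * centredProd μ f (t - l) q ω - Γ p q l)
  have hdev : ∀ (T l : ℕ) (p q : VechIdx r) ω, 1 ≤ T →
      |sampleCov (trueScore μ f T ω) l p q - G l p q| ≤ |U T p.1 q.1 l ω| +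
        C * ((l : ℝ) * decay a l) / T := by
    intro T l p q ω hT
    have hT' : (0 : ℝ) < T := by exact_mod_cast hT
    have e : sampleCov (trueScore μ f T ω) l p q = (T : ℝ)⁻¹ * ∑ t ∈ Finset.Ioc (l : ℤ) T,
        (centredProd μ f t p.1 ω * centredProd μ f (t - l) q.1 ω) := by
      simp only [sampleCov, Matrix.of_apply, trueScore]
      rw [sum_pairs_eq_sum_Ioc T l fun s t => centredProd μ f s p.1 ω * centredProd μ f t q.1 ω]
    have e2 : sampleCov (trueScore μ f T ω) l p q - G l p q = U T p.1 q.1 l ω +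
        ((T : ℝ)⁻¹ * (T - l : ℕ) - 1) * G l p q := by
      have hc : ((T : ℤ) - l).toNat = T - l := by omega
      rw [e]
      simp only [U, hG, Matrix.of_apply, Finset.sum_sub_distrib, Finset.sum_const, Int.card_Ioc,
        nsmul_eq_mul, hc]
      ring
    -- The sum has T - l terms but is divided by T. For l > T it is empty, the truncated subtraction
    -- gives 0, and the bound still holds since l/T ≥ 1.
    have e3 : |(T : ℝ)⁻¹ * (T - l : ℕ) - 1| ≤ l / T := by
      have k1 : ((T - l : ℕ) : ℝ) ≤ T := by exact_mod_cast Nat.sub_le T l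
      have k2 : (T : ℝ) - l ≤ ((T - l : ℕ) : ℝ) := by
        have : T ≤ (T - l) + l := by omega
        have : (T : ℝ) ≤ ((T - l : ℕ) : ℝ) + l := by exact_mod_cast this
        linarith
      have e4 : (T : ℝ)⁻¹ * (T - l : ℕ) - 1 = (((T - l : ℕ) : ℝ) - T) / T := by field_simp
      rw [e4, abs_div, abs_of_pos hT']
      gcongr
      rw [abs_le]
      constructor <;> linarith [(Nat.cast_nonneg l : (0:ℝ) ≤ l)]
    rw [e2]
    refine (abs_add_le _ _).trans (add_le_add le_rfl ?_)
    rw [abs_mul]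
    calc _ ≤ (l : ℝ) / T * (C * decay a l) :=
          mul_le_mul e3 (hGb p q l) (abs_nonneg _) (by positivity)
      _ = _ := by ring
  have hUi : ∀ T : ℕ, 1 ≤ T → ∀ p q l, Integrable (fun ω => |U T p q l ω|) μ ∧
      ∫ ω, |U T p q l ω| ∂μ ≤ (C + 1) / √T := by
    intro T hT p q l
    have hT' : (0 : ℝ) < T := by exact_mod_cast hT
    have hs : 0 < √(T : ℝ) := Real.sqrt_pos.2 hT'
    obtain ⟨k1, k2⟩ := hP p q l (Finset.Ioc (l : ℤ) T)
    have k3 : Integrable (fun ω => U T p q l ω ^ 2) μ := by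
      simp only [U, mul_pow]
      exact k1.const_mul _
    have k4 : ∫ ω, U T p q l ω ^ 2 ∂μ ≤ C / T := by
      simp only [U, mul_pow]
      rw [integral_const_mul]
      have hcard : ((Finset.Ioc (l : ℤ) T).card : ℝ) ≤ T := by
        rw [Int.card_Ioc]
        exact_mod_cast (by omega : ((T : ℤ) - l).toNat ≤ T)
      calc _ ≤ ((T : ℝ)⁻¹) ^ 2 * (C * T) := by
            refine mul_le_mul_of_nonneg_left (k2.trans ?_) (by positivity)
            gcongr
        _ = C / T := by field_simp
    have mU : AEStronglyMeasurable (U T p q l) μ := by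
      refine AEStronglyMeasurable.const_mul ?_ _
      refine Finset.aestronglyMeasurable_fun_sum _ fun t _ => ?_
      exact ((h1 t p).1.aestronglyMeasurable.mul (h1 _ q).1.aestronglyMeasurable).sub
        aestronglyMeasurable_const
    have k5 : Integrable (fun ω => (√T * U T p q l ω ^ 2 + 1 / √T) / 2) μ :=
      ((k3.const_mul _).add (integrable_const _)).div_const _
    have k6 : Integrable (fun ω => |U T p q l ω|) μ := by
      refine k5.mono' mU.norm (ae_of_all _ fun ω => ?_)
      rw [Real.norm_eq_abs, abs_abs]
      exact abs_le_of_sqrt_weight hT' _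
    refine ⟨k6, (integral_mono k6 k5 fun ω => abs_le_of_sqrt_weight hT' _).trans ?_⟩
    rw [integral_div, integral_add (k3.const_mul _) (integrable_const _), integral_const_mul]
    simp only [integral_const, probReal_univ, smul_eq_mul, one_mul]
    have k7 : √T * (∫ ω, U T p q l ω ^ 2 ∂μ) ≤ C / √T := by
      calc _ ≤ √T * (C / T) := mul_le_mul_of_nonneg_left k4 hs.le
        _ = C / √T := by
          field_simp
          rw [Real.sq_sqrt hT'.le]
    have k8 : 0 ≤ 1 / √(T : ℝ) := by positivity
    have k9 : 0 ≤ C / √(T : ℝ) := by positivity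
    have k10 : (C + 1) / √(T : ℝ) = C / √T + 1 / √T := add_div _ _ _
    linarith
  set n : ℝ := (Fintype.card (VechIdx r) : ℝ) * Fintype.card (VechIdx r) with hndef
  have hn0 : 0 ≤ n := by positivity
  -- A single variable that dominates the deviations of all matrix entries at lag l.
  let Z : ℕ → ℕ → Ω → ℝ := fun T l ω => ∑ p : VechIdx r, ∑ q : VechIdx r, |U T p.1 q.1 l ω|
  have hUZ : ∀ T l ω (p q : VechIdx r), |U T p.1 q.1 l ω| ≤ Z T l ω := fun T l ω p q =>
    (Finset.single_le_sum (f := fun q : VechIdx r => |U T p.1 q.1 l ω|)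
      (fun q _ => abs_nonneg _) (Finset.mem_univ q)).trans
      (Finset.single_le_sum (f := fun p : VechIdx r => ∑ q : VechIdx r, |U T p.1 q.1 l ω|)
        (fun p _ => Finset.sum_nonneg fun q _ => abs_nonneg _) (Finset.mem_univ p))
  have hZ0 : ∀ T l ω, 0 ≤ Z T l ω := fun T l ω =>
    Finset.sum_nonneg fun p _ => Finset.sum_nonneg fun q _ => abs_nonneg _
  have hZi : ∀ T : ℕ, 1 ≤ T → ∀ l, Integrable (Z T l) μ ∧ ∫ ω, Z T l ω ∂μ ≤ n * ((C + 1) / √T) := by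
    intro T hT l
    have i1 : ∀ p : VechIdx r, Integrable (fun ω => ∑ q : VechIdx r, |U T p.1 q.1 l ω|) μ :=
      fun p => integrable_finsetSum _ fun q _ => (hUi T hT p.1 q.1 l).1
    refine ⟨integrable_finsetSum _ fun p _ => i1 p, ?_⟩
    simp only [Z]
    rw [integral_finsetSum _ fun p _ => i1 p]
    calc _ ≤ ∑ _p : VechIdx r, ∑ _q : VechIdx r, (C + 1) / √(T : ℝ) := by
          refine Finset.sum_le_sum fun p _ => ?_
          rw [integral_finsetSum _ fun q _ => (hUi T hT p.1 q.1 l).1]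
          exact Finset.sum_le_sum fun q _ => (hUi T hT p.1 q.1 l).2
      _ = _ := by
          simp only [Finset.sum_const, Finset.card_univ, nsmul_eq_mul, hndef]
          ring
  -- The variable `Y` adds 2 Z over m + 1 ≤ 2 m lags, which gives 4 n (C + 1), and the total
  -- truncation bias 2 C A/T. The last summand of K also covers the Bartlett bias, the first the
  -- moments of the factors.
  refine ⟨C + 4 * n * (C + 1) + 2 * C * A, by positivity, fun t => ⟨(h8 t).1, (h8 t).2.trans ?_⟩,
    fun T hT p => ?_, fun T m ω => ∑ l ∈ Finset.range (m + 1), 2 * Z T l ω + 2 * C * A / T,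
    fun T m hT hm => ⟨⟨?_, ?_⟩, fun ω => ⟨?_, fun p q => ?_⟩⟩⟩
  · have : 0 ≤ 4 * n * (C + 1) := by positivity
    have : 0 ≤ 2 * C * A := by positivity
    linarith
  · have hT' : (0 : ℝ) < T := by exact_mod_cast hT
    obtain ⟨k1, k2⟩ := hS p (Finset.Ioc (0 : ℤ) T)
    have e : ∀ ω, ∑ t : Fin T, centredProd μ f (((t : ℕ) : ℤ) + 1) p ω =
        ∑ t ∈ Finset.Ioc (0 : ℤ) T, centredProd μ f t p ω := fun ω =>
      sum_fin_eq_sum_Ioc T fun t => centredProd μ f t p ω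
    simp only [mul_pow, e]
    refine ⟨k1.const_mul _, ?_⟩
    rw [integral_const_mul]
    calc _ ≤ ((T : ℝ)⁻¹) ^ 2 * (C * T) := by
          refine mul_le_mul_of_nonneg_left (k2.trans ?_) (by positivity)
          simp
      _ = C / T := by field_simp
      _ ≤ _ := by
          gcongr
          have : 0 ≤ 4 * n * (C + 1) := by positivity
          have : 0 ≤ 2 * C * A := by positivity
          linarith
  · exact (integrable_finsetSum _ fun l _ => (hZi T hT l).1.const_mul _).add (integrable_const _)
  · have hT' : (1 : ℝ) ≤ T := by exact_mod_cast hT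
    have hm' : (1 : ℝ) ≤ m := by exact_mod_cast hm
    have hs : 0 < √(T : ℝ) := Real.sqrt_pos.2 (by linarith)
    rw [integral_add (integrable_finsetSum _ fun l _ => (hZi T hT l).1.const_mul _)
      (integrable_const _), integral_finsetSum _ fun l _ => (hZi T hT l).1.const_mul _]
    simp only [integral_const, probReal_univ, smul_eq_mul, one_mul, integral_const_mul]
    have k1 : ∑ l ∈ Finset.range (m + 1), 2 * ∫ ω, Z T l ω ∂μ ≤
        4 * n * (C + 1) * (m / √T) := by
      calc _ ≤ ∑ l ∈ Finset.range (m + 1), 2 * (n * ((C + 1) / √T)) :=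
            Finset.sum_le_sum fun l _ => mul_le_mul_of_nonneg_left (hZi T hT l).2 (by norm_num)
        _ = ((m : ℝ) + 1) * (2 * (n * ((C + 1) / √T))) := by
            rw [Finset.sum_const, Finset.card_range, nsmul_eq_mul]
            push_cast
            ring
        _ ≤ (2 * m) * (2 * (n * ((C + 1) / √T))) := by
            gcongr
            linarith
        _ = _ := by ring
    have k2 : 2 * C * A / T ≤ 2 * C * A * (m / √T) := by
      rw [div_eq_mul_one_div]
      refine mul_le_mul_of_nonneg_left ?_ (by positivity)
      have k3 : √(T : ℝ) ≤ T := Real.sqrt_le_iff.2 ⟨by linarith, by nlinarith⟩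
      calc (1 : ℝ) / T ≤ 1 / √T := by gcongr
        _ ≤ m / √T := by gcongr
    have k4 : 0 ≤ C * (m / √T) := by positivity
    linarith
  · have : 0 ≤ 2 * C * A / T := by positivity
    have := Finset.sum_nonneg fun l (_ : l ∈ Finset.range (m + 1)) =>
      mul_nonneg (zero_le_two (α := ℝ)) (hZ0 T l ω)
    linarith
  · have hm' : (1 : ℝ) ≤ m := by exact_mod_cast hm
    have hT' : (0 : ℝ) < T := by exact_mod_cast hT
    have k1 := abs_bartlett_sub_le (sampleCov (trueScore μ f T ω)) G m p q
    have k2 := abs_sub_bartlett_le ha hC.le hGb (hlim p q) m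
    have k3 : ∑ l ∈ Finset.range (m + 1), (|sampleCov (trueScore μ f T ω) l p q - G l p q| +
        |sampleCov (trueScore μ f T ω) l q p - G l q p|) ≤
        ∑ l ∈ Finset.range (m + 1), (2 * Z T l ω + 2 * C / T * ((l : ℝ) * decay a l)) := by
      refine Finset.sum_le_sum fun l _ => ?_
      have e1 := (hdev T l p q ω hT).trans (add_le_add_left (hUZ T l ω p q) _)
      have e2 := (hdev T l q p ω hT).trans (add_le_add_left (hUZ T l ω q p) _)
      have e3 : 2 * C / T * ((l : ℝ) * decay a l) = C * ((l : ℝ) * decay a l) / T +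
        C * ((l : ℝ) * decay a l) / T := by ring
      linarith
    have k3' : ∑ l ∈ Finset.range (m + 1), (2 * Z T l ω + 2 * C / T * ((l : ℝ) * decay a l)) =
        ∑ l ∈ Finset.range (m + 1), 2 * Z T l ω +
          2 * C / T * ∑ l ∈ Finset.range (m + 1), (l : ℝ) * decay a l := by
      rw [Finset.sum_add_distrib, Finset.mul_sum]
    rw [k3'] at k3
    have k4 : 2 * C / T * ∑ l ∈ Finset.range (m + 1), (l : ℝ) * decay a l ≤ 2 * C * A / T := by
      calc _ ≤ 2 * C / T * A := mul_le_mul_of_nonneg_left (hle _) (by positivity)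
        _ = _ := by ring
    have k5 : 2 * C * A / ((m : ℝ) + 1) ≤ (C + 4 * n * (C + 1) + 2 * C * A) / m := by
      have h0 : 0 ≤ 4 * n * (C + 1) := by positivity
      have h0' : 0 ≤ 2 * C * A := by positivity
      refine div_le_div₀ (by positivity) (by linarith) (by linarith) (by linarith)
    have k6 := abs_sub_le (bartlett (sampleCov (trueScore μ f T ω)) m p q) (bartlett G m p q)
      (D p q)
    linarith
end FactorHAC
-- Operator norm and matrix entries
namespace FactorHAC
section MatrixNorm
variable {m n : Type*} [Fintype m] [Fintype n] [DecidableEq n]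
theorem abs_apply_le_l2_opNorm (M : Matrix m n ℝ) (i : m) (j : n) : |M i j| ≤ ‖M‖ := by
  have h := Matrix.l2_opNorm_mulVec M (EuclideanSpace.single j 1)
  have h2 := PiLp.norm_apply_le ((EuclideanSpace.equiv m ℝ).symm
    (M *ᵥ (EuclideanSpace.single j (1 : ℝ)).ofLp)) i
  simp only [PiLp.norm_single, norm_one, mul_one] at h
  have h3 := h2.trans h
  simpa [Matrix.mulVec_single] using h3
-- By the C*-identity it suffices to know the norm of a diagonal matrix.
theorem l2_opNorm_single_le [DecidableEq m] (i : m) (j : n) (c : ℝ) : ‖Matrix.single i j c‖ ≤ |c| := by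
  have h := Matrix.l2_opNorm_conjTranspose_mul_self (Matrix.single i j c)
  rw [Matrix.conjTranspose_single, Matrix.single_mul_single_same, ← Matrix.diagonal_single,
    Matrix.l2_opNorm_diagonal, Pi.norm_single] at h
  have h2 : ‖Matrix.single i j c‖ * ‖Matrix.single i j c‖ = |c| * |c| := by
    rw [← h]; simp
  nlinarith [norm_nonneg (Matrix.single i j c), abs_nonneg c]
theorem l2_opNorm_le_sum_abs [DecidableEq m] (M : Matrix m n ℝ) : ‖M‖ ≤ ∑ i, ∑ j, |M i j| := by
  conv_lhs => rw [Matrix.matrix_eq_sum_single M]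
  refine (norm_sum_le _ _).trans (Finset.sum_le_sum fun i _ => ?_)
  exact (norm_sum_le _ _).trans (Finset.sum_le_sum fun j _ => l2_opNorm_single_le i j _)
end MatrixNorm
-- Simultaneous diagonalisation and eigenvalue bounds
section Spectral
variable {r : ℕ}
/-- Simultaneous diagonalisation of two positive definite matrices whose product has distinct
eigenvalues. -/
theorem exists_simultaneous_diagonalization {A B : Matrix (Fin r) (Fin r) ℝ} (hA : A.PosDef)
    (hB : B.PosDef) (h : HasPositiveDistinctEigenvalues (B * A)) :
    ∃ (K : Matrix (Fin r) (Fin r) ℝ) (d : Fin r → ℝ), StrictAnti d ∧ (∀ i, 0 < d i) ∧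
      Kᵀ * A * K = 1 ∧ K * Matrix.diagonal d * Kᵀ = B := by
  obtain ⟨d₀, hinj, -, hchar⟩ := h
  obtain ⟨Y, hY⟩ : ∃ Y : Matrix (Fin r) (Fin r) ℝ, A = Yᵀ * Y := by
    open scoped MatrixOrder in
    obtain ⟨Y, hY⟩ := CStarAlgebra.nonneg_iff_eq_star_mul_self.mp hA.posSemidef.nonneg
    exact ⟨Y, by rw [hY, Matrix.star_eq_conjTranspose,
      Matrix.conjTranspose_eq_transpose_of_trivial]⟩
  have hYdet : IsUnit Y.det := by
    have h1 : IsUnit A.det := (Matrix.isUnit_iff_isUnit_det A).1 hA.isUnit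
    rw [hY, Matrix.det_mul] at h1
    exact isUnit_of_mul_isUnit_right h1
  have hYu : IsUnit Y := (Matrix.isUnit_iff_isUnit_det Y).2 hYdet
  -- Since A = Yᵀ Y, this symmetric matrix has the characteristic polynomial of B A. If the columns
  -- of O' are its orthonormal eigenvectors in decreasing order of eigenvalues, K = Y⁻¹ O' is as
  -- required.
  set M := Y * B * Yᵀ with hM
  have hMpos : M.PosDef := by
    have := hB.mul_mul_conjTranspose_same (B := Y) (Matrix.vecMul_injective_iff_isUnit.2 hYu)
    rwa [Matrix.conjTranspose_eq_transpose_of_trivial] at this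
  have hMh := hMpos.isHermitian
  have hMchar : M.charpoly = ∏ i, (Polynomial.X - Polynomial.C (d₀ i)) := by
    rw [← hchar, hM, Matrix.mul_assoc, Matrix.charpoly_mul_comm, hY, Matrix.mul_assoc]
  have hinj₀ : Function.Injective hMh.eigenvalues₀ := by
    have h1 := hMh.roots_charpoly_eq_eigenvalues₀
    have hroots : (∏ i, (Polynomial.X - Polynomial.C (d₀ i))).roots = Finset.univ.val.map d₀ := by
      rw [Polynomial.roots_prod]
      · simp
      · simp [Finset.prod_ne_zero_iff, Polynomial.X_sub_C_ne_zero]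
    rw [hMchar, hroots] at h1
    have h2 : (Finset.univ.val.map d₀).Nodup := by
      exact Multiset.Nodup.map hinj Finset.univ.nodup
    have h3 : (Multiset.map (RCLike.ofReal ∘ hMh.eigenvalues₀) Finset.univ.val : Multiset ℝ).Nodup := by
      rw [← h1]
      exact h2
    intro i j hij
    exact Multiset.inj_on_of_nodup_map h3 i (Finset.mem_univ i) j (Finset.mem_univ j)
      (by simp [hij])
  -- The family `eigenvalues` is `eigenvalues₀` carried along this equivalence, which need not
  -- respect the order; composing with it restores the decreasing order.
  let e : Fin (Fintype.card (Fin r)) ≃ Fin r := Fintype.equivOfCardEq (Fintype.card_fin _)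
  let π : Fin r ≃ Fin r := (finCongr (Fintype.card_fin r).symm).trans e
  let d : Fin r → ℝ := fun k => hMh.eigenvalues (π k)
  have hd₀ : ∀ k, d k = hMh.eigenvalues₀ (finCongr (Fintype.card_fin r).symm k) := by
    intro k
    simp only [d, Matrix.IsHermitian.eigenvalues, π, e, Equiv.trans_apply, Equiv.symm_apply_apply]
  have hanti : StrictAnti d := by
    intro i j hij
    rw [hd₀, hd₀]
    refine lt_of_le_of_ne (hMh.eigenvalues₀_antitone (by simpa using hij.le)) fun hne => ?_
    have := hinj₀ hne
    simp at this
    exact hij.ne this.symm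
  set O : Matrix (Fin r) (Fin r) ℝ := (hMh.eigenvectorUnitary : Matrix (Fin r) (Fin r) ℝ) with hO
  have hOO : Oᵀ * O = 1 := by
    have := (Matrix.mem_unitaryGroup_iff'.1 hMh.eigenvectorUnitary.2)
    rwa [Matrix.star_eq_conjTranspose, Matrix.conjTranspose_eq_transpose_of_trivial] at this
  have hspec : M = O * Matrix.diagonal hMh.eigenvalues * Oᵀ := by
    have := hMh.spectral_theorem
    rw [Unitary.conjStarAlgAut_apply, Matrix.star_eq_conjTranspose,
      Matrix.conjTranspose_eq_transpose_of_trivial] at this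
    exact this
  let O' : Matrix (Fin r) (Fin r) ℝ := O.submatrix id π
  have hO'O' : O'ᵀ * O' = 1 := by
    have : O'ᵀ * O' = (Oᵀ * O).submatrix π π := by
      simp [O', Matrix.transpose_submatrix]
      rfl
    rw [this, hOO]
    exact Matrix.submatrix_one_equiv π
  have hspec' : M = O' * Matrix.diagonal d * O'ᵀ := by
    have h1 : Matrix.diagonal d = (Matrix.diagonal hMh.eigenvalues).submatrix π π := by
      rw [Matrix.submatrix_diagonal_equiv]
      rfl
    rw [h1]
    simp only [O', Matrix.transpose_submatrix, Matrix.submatrix_mul_equiv]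
    exact hspec
  refine ⟨Y⁻¹ * O', d, hanti, fun i => hMpos.eigenvalues_pos _, ?_, ?_⟩
  · have h1 : Y * Y⁻¹ = 1 := Matrix.mul_nonsing_inv Y hYdet
    calc (Y⁻¹ * O')ᵀ * A * (Y⁻¹ * O') = O'ᵀ * ((Y * Y⁻¹)ᵀ * (Y * Y⁻¹)) * O' := by
          rw [hY]
          simp only [Matrix.transpose_mul, Matrix.mul_assoc]
      _ = 1 := by rw [h1, Matrix.transpose_one, Matrix.mul_one, Matrix.mul_one, hO'O']
  · have h1 : Y⁻¹ * Y = 1 := Matrix.nonsing_inv_mul Y hYdet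
    calc Y⁻¹ * O' * Matrix.diagonal d * (Y⁻¹ * O')ᵀ
        = Y⁻¹ * (O' * Matrix.diagonal d * O'ᵀ) * (Y⁻¹)ᵀ := by
          simp only [Matrix.transpose_mul, Matrix.mul_assoc]
      _ = (Y⁻¹ * Y) * B * (Y⁻¹ * Y)ᵀ := by
          rw [← hspec', hM]
          simp only [Matrix.transpose_mul, Matrix.mul_assoc]
      _ = B := by rw [h1, Matrix.transpose_one, Matrix.mul_one, Matrix.one_mul]
/-- A lower bound for the quadratic form of `M` on the range of an injective `G` with `r` columns
is a lower bound for the `r` largest eigenvalues of `M`. -/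
theorem le_eigenvalues₀_of_forall_range {T : ℕ} {M : Matrix (Fin T) (Fin T) ℝ}
    (hM : M.IsHermitian) (G : Matrix (Fin T) (Fin r) ℝ) {c : ℝ}
    (hG : ∀ x : Fin r → ℝ, x ≠ 0 → G *ᵥ x ≠ 0)
    (hc : ∀ x : Fin r → ℝ, c * ((G *ᵥ x) ⬝ᵥ (G *ᵥ x)) ≤ (G *ᵥ x) ⬝ᵥ (M *ᵥ (G *ᵥ x)))
    {k : ℕ} (hk : k < r) (hkT : k < Fintype.card (Fin T)) :
    c ≤ hM.eigenvalues₀ ⟨k, hkT⟩ := by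
  set U : Matrix (Fin T) (Fin T) ℝ := (hM.eigenvectorUnitary : Matrix (Fin T) (Fin T) ℝ) with hU
  have hUU : U * Uᵀ = 1 := by
    have := (Matrix.mem_unitaryGroup_iff.1 hM.eigenvectorUnitary.2)
    rwa [Matrix.star_eq_conjTranspose, Matrix.conjTranspose_eq_transpose_of_trivial] at this
  have hspec : M = U * Matrix.diagonal hM.eigenvalues * Uᵀ := by
    have := hM.spectral_theorem
    rw [Unitary.conjStarAlgAut_apply, Matrix.star_eq_conjTranspose,
      Matrix.conjTranspose_eq_transpose_of_trivial] at this
    exact this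
  let e : Fin (Fintype.card (Fin T)) ≃ Fin T := Fintype.equivOfCardEq (Fintype.card_fin _)
  have he : ∀ i, hM.eigenvalues (e i) = hM.eigenvalues₀ i := fun i => by
    simp only [Matrix.IsHermitian.eigenvalues, e, Equiv.symm_apply_apply]
  -- Courant–Fischer by counting dimensions. Orthogonality of G x to the first k eigenvectors
  -- imposes k < r linear conditions, so some x ≠ 0 meets them. There the Rayleigh quotient is at
  -- most the eigenvalue with index k.
  let φ : (Fin r → ℝ) →ₗ[ℝ] (Fin k → ℝ) :=
    LinearMap.pi fun j => (LinearMap.proj (e ⟨j, j.2.trans hkT⟩)).comp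
      ((Uᵀ * G).mulVecLin)
  obtain ⟨x, hx, hx0⟩ := Submodule.exists_mem_ne_zero_of_ne_bot
    (LinearMap.ker_ne_bot_of_finrank_lt (f := φ) (by simpa using hk))
  set v := G *ᵥ x with hv
  set w := Uᵀ *ᵥ v with hw
  have hw0 : ∀ i : Fin (Fintype.card (Fin T)), (i : ℕ) < k → w (e i) = 0 := by
    intro i hi
    have := congrFun (LinearMap.mem_ker.1 hx) ⟨i, hi⟩
    rw [hw, hv, Matrix.mulVec_mulVec]
    exact this
  have hvw : v = U *ᵥ w := by rw [hw, Matrix.mulVec_mulVec, hUU, Matrix.one_mulVec]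
  have h1 : v ⬝ᵥ (M *ᵥ v) = ∑ i, hM.eigenvalues i * w i ^ 2 := by
    have : M *ᵥ v = U *ᵥ (Matrix.diagonal hM.eigenvalues *ᵥ w) := by
      conv_lhs => rw [hspec]
      simp only [hw, Matrix.mulVec_mulVec, Matrix.mul_assoc]
    rw [this, Matrix.dotProduct_mulVec, ← Matrix.mulVec_transpose, ← hw]
    simp only [dotProduct, Matrix.mulVec_diagonal]
    exact Finset.sum_congr rfl fun i _ => by ring
  have h2 : v ⬝ᵥ v = ∑ i, w i ^ 2 := by
    conv_lhs => rw [hvw]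
    rw [Matrix.dotProduct_mulVec, ← Matrix.mulVec_transpose, ← hvw, ← hw]
    simp only [dotProduct]
    exact Finset.sum_congr rfl fun i _ => by ring
  have hpos : 0 < v ⬝ᵥ v := by
    have h3 : v ≠ 0 := hG x hx0
    have h4 : 0 ≤ v ⬝ᵥ v := by rw [h2]; positivity
    exact lt_of_le_of_ne h4 fun h5 => h3 (dotProduct_self_eq_zero.1 h5.symm)
  have h3 : ∑ i, hM.eigenvalues i * w i ^ 2 ≤ hM.eigenvalues₀ ⟨k, hkT⟩ * ∑ i, w i ^ 2 := by
    rw [Finset.mul_sum]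
    refine Finset.sum_le_sum fun i _ => ?_
    obtain ⟨j, rfl⟩ := e.surjective i
    rcases lt_or_ge (j : ℕ) k with hj | hj
    · rw [hw0 j hj]; simp
    · rw [he]
      exact mul_le_mul_of_nonneg_right (hM.eigenvalues₀_antitone (Fin.mk_le_of_le_val hj))
        (sq_nonneg _)
  have h4 := hc x
  rw [← hv, h1] at h4
  rw [← h2] at h3
  exact le_of_mul_le_mul_right (h4.trans h3) hpos
end Spectral
end FactorHAC
-- Near-eigenvectors of a diagonal matrix
namespace FactorHAC
variable {r : ℕ}
theorem exists_gap {d : Fin r → ℝ} (hd : StrictAnti d) :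
    ∃ g : ℝ, 0 < g ∧ ∀ i j, i ≠ j → g ≤ |d i - d j| := by
  by_cases h : (Finset.univ.filter fun p : Fin r × Fin r => p.1 ≠ p.2).Nonempty
  · obtain ⟨p, hp, hmin⟩ := Finset.exists_min_image _ (fun p : Fin r × Fin r => |d p.1 - d p.2|) h
    refine ⟨|d p.1 - d p.2|, abs_pos.2 (sub_ne_zero.2 fun e => ?_), fun i j hij => ?_⟩
    · exact (Finset.mem_filter.1 hp).2 (hd.injective e)
    · exact hmin (i, j) (Finset.mem_filter.2 ⟨Finset.mem_univ _, hij⟩)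
  -- Without two distinct indices any gap will do.
  · refine ⟨1, one_pos, fun i j hij => absurd ?_ h⟩
    exact ⟨(i, j), Finset.mem_filter.2 ⟨Finset.mem_univ _, hij⟩⟩
/-- If the columns of `Z` are nearly orthogonal, and nearly eigenvectors of a diagonal matrix with
distinct entries for the decreasing approximate eigenvalues `φ`, then `Z` is nearly diagonal. -/
theorem exists_sign_of_near_eigen {d : Fin r → ℝ} (hd : StrictAnti d) (hpos : ∀ i, 0 < d i)
    {c : ℝ} (hc : 0 < c) :
    ∃ ε₀ : ℝ, 0 < ε₀ ∧ ∃ C : ℝ, 0 ≤ C ∧ ∀ ε : ℝ, 0 ≤ ε → ε ≤ ε₀ →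
      ∀ (φ : Fin r → ℝ) (Z : Matrix (Fin r) (Fin r) ℝ), Antitone φ → (∀ k, c ≤ φ k) →
      (∀ i k, |Z i k * (φ k - d i)| ≤ ε) →
      (∀ j k, |∑ i, Z i j * Z i k - if j = k then φ k else 0| ≤ ε) →
      ∃ s : Fin r → ℤˣ, (∀ k, |φ k - d k| ≤ C * ε) ∧
        ∀ i k, |Z i k - if i = k then ((s k : ℤ) : ℝ) * √(d k) else 0| ≤ C * ε := by
  rcases Nat.eq_zero_or_pos r with rfl | hr
  · exact ⟨1, one_pos, 0, le_rfl, fun ε _ _ φ Z _ _ _ _ => ⟨fun k => 1, fun k => k.elim0,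
      fun i => i.elim0⟩⟩
  obtain ⟨g, hg, hgap⟩ := exists_gap hd
  have hr' : (0 : ℝ) < r := by exact_mod_cast hr
  -- Column k of Z has squared norm at least c - ε ≥ c/2, so one of its r entries is at least ρ in
  -- absolute value.
  set ρ : ℝ := √(c / (2 * r)) with hρ
  have hρ0 : 0 < ρ := Real.sqrt_pos.2 (by positivity)
  have hρ2 : ρ ^ 2 = c / (2 * r) := Real.sq_sqrt (by positivity)
  -- C₃ ε bounds Z_ii² - d_i: the summands come from the normalisation, the error of φ, and the
  -- off-diagonal entries of the column.
  set C₃ : ℝ := 1 + 1 / ρ + 2 * r / g with hC₃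
  have hC₃0 : 0 < C₃ := by positivity
  set Q : ℝ := ∑ k, 1 / √(d k) with hQ
  have hQk : ∀ k, 1 / √(d k) ≤ Q := fun k =>
    Finset.single_le_sum (f := fun k => 1 / √(d k)) (fun k _ => by positivity) (Finset.mem_univ k)
  have hQ0 : 0 ≤ Q := Finset.sum_nonneg fun k _ => by positivity
  -- Four demands on ε: a dominant entry in each column; off-diagonal entries at most 1; each φ k
  -- within g/4 of its eigenvalue; and ε (1 + 2 r/g) ≤ ρ²/2, so that two columns cannot be dominated
  -- by the same row.
  refine ⟨min (min (c / 2) (g / 2)) (min (ρ * g / 4) (ρ ^ 2 / 2 / (1 + 2 * r / g))), by positivity,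
    1 / ρ + 2 / g + C₃ * Q, by positivity, ?_⟩
  intro ε hε0 hε φ Z hφ hcφ hZ hZZ
  have hε1 : ε ≤ c / 2 := hε.trans ((min_le_left _ _).trans (min_le_left _ _))
  have hε2 : ε ≤ g / 2 := hε.trans ((min_le_left _ _).trans (min_le_right _ _))
  have hε3 : ε ≤ ρ * g / 4 := hε.trans ((min_le_right _ _).trans (min_le_left _ _))
  have hε4 : ε ≤ ρ ^ 2 / 2 / (1 + 2 * r / g) :=
    hε.trans ((min_le_right _ _).trans (min_le_right _ _))
  rw [le_div_iff₀ (by positivity)] at hε4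
  have hερ : ε / ρ ≤ g / 4 := by
    rw [div_le_iff₀ hρ0]; linarith
  have hdom : ∀ k, ∃ i, ρ ≤ |Z i k| := by
    intro k
    by_contra! hlt
    have h1 : ∑ i, Z i k * Z i k < ∑ _i : Fin r, ρ ^ 2 := by
      refine Finset.sum_lt_sum_of_nonempty ⟨k, Finset.mem_univ k⟩ fun i _ => ?_
      rw [← sq, ← sq_abs]
      exact pow_lt_pow_left₀ (hlt i) (abs_nonneg _) (by norm_num)
    have h2 := (abs_le.1 (hZZ k k)).1
    rw [if_pos rfl] at h2
    have h3 : ∑ _i : Fin r, ρ ^ 2 = c / 2 := by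
      rw [Finset.sum_const, Finset.card_univ, Fintype.card_fin, nsmul_eq_mul, hρ2]
      field_simp
    linarith [hcφ k]
  choose σ hσ using hdom
  have hφσ : ∀ k, |φ k - d (σ k)| ≤ ε / ρ := by
    intro k
    rw [le_div_iff₀ hρ0]
    have h1 := hZ (σ k) k
    rw [abs_mul] at h1
    nlinarith [hσ k, abs_nonneg (φ k - d (σ k))]
  have hoff : ∀ i k, i ≠ σ k → |Z i k| ≤ 2 * ε / g := by
    intro i k hik
    have h1 := hgap i (σ k) hik
    have h2 : g / 2 ≤ |φ k - d i| := by
      have h3 : |d i - d (σ k)| ≤ |d i - φ k| + |φ k - d (σ k)| := abs_sub_le _ _ _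
      linarith [hφσ k, abs_sub_comm (φ k) (d i)]
    have h3 := hZ i k
    rw [abs_mul] at h3
    rw [le_div_iff₀ hg]
    nlinarith [abs_nonneg (Z i k)]
  have hoff2 : ∀ i k, i ≠ σ k → |Z i k| ^ 2 ≤ 2 * ε / g := by
    intro i k hik
    have h1 := hoff i k hik
    have h2 : 2 * ε / g ≤ 1 := by rw [div_le_one hg]; linarith
    nlinarith [abs_nonneg (Z i k)]
  have hrest : ∀ (k k' : Fin r) (i₀ : Fin r), σ k = i₀ → σ k' = i₀ →
      |∑ i, Z i k * Z i k' - Z i₀ k * Z i₀ k'| ≤ 2 * r / g * ε := by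
    intro k k' i₀ h1 h2
    rw [← Finset.add_sum_erase _ _ (Finset.mem_univ i₀), add_sub_cancel_left]
    refine (Finset.abs_sum_le_sum_abs _ _).trans ?_
    calc _ ≤ ∑ _i ∈ Finset.univ.erase i₀, 2 * ε / g := by
          refine Finset.sum_le_sum fun i hi => ?_
          have hne := Finset.ne_of_mem_erase hi
          have a1 := hoff2 i k (by rwa [h1])
          have a2 := hoff2 i k' (by rwa [h2])
          rw [abs_mul]
          nlinarith [sq_nonneg (|Z i k| - |Z i k'|)]
      _ = ((Finset.univ.erase i₀).card : ℝ) * (2 * ε / g) := by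
          rw [Finset.sum_const, nsmul_eq_mul]
      _ ≤ r * (2 * ε / g) := by
          refine mul_le_mul_of_nonneg_right ?_ (by positivity)
          exact_mod_cast (Finset.card_le_univ _).trans (by simp)
      _ = _ := by ring
  -- Two columns with the same dominant row would have an inner product of at least ρ² up to O(ε),
  -- against near orthogonality.
  have hinj : Function.Injective σ := by
    intro k k' hkk
    by_contra hne
    have h1 := hrest k k' (σ k) rfl hkk.symm
    have h2 := hZZ k k'
    rw [if_neg hne, sub_zero] at h2
    have h3 : ρ ^ 2 ≤ |Z (σ k) k * Z (σ k) k'| := by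
      rw [abs_mul, sq]
      exact mul_le_mul (hσ k) (hkk ▸ hσ k') hρ0.le (abs_nonneg _)
    have h4 : |Z (σ k) k * Z (σ k) k'| ≤ ε + 2 * r / g * ε := by
      have := abs_sub_le (Z (σ k) k * Z (σ k) k') (∑ i, Z i k * Z i k') 0
      rw [sub_zero, sub_zero, abs_sub_comm] at this
      linarith
    have h5 : 0 < ρ ^ 2 := by positivity
    nlinarith
  -- φ decreases, d strictly decreases, and φ k is close to d (σ k), so σ keeps the order. A
  -- strictly increasing self-map of `Fin r` is the identity.
  have hmono : StrictMono σ := by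
    intro k k' hkk
    rcases lt_trichotomy (σ k) (σ k') with h | h | h
    · exact h
    · exact absurd (hinj h) hkk.ne
    · exfalso
      have h1 := hd h
      have h2 := hgap (σ k) (σ k') h.ne'
      rw [abs_of_neg (by linarith)] at h2
      have h3 := abs_le.1 (hφσ k)
      have h4 := abs_le.1 (hφσ k')
      have h5 := hφ hkk.le
      linarith
  have hid : ∀ k, σ k = k := fun k => congrFun hmono.eq_id k
  refine ⟨fun k => if 0 ≤ Z k k then 1 else -1, fun k => ?_, fun i k => ?_⟩
  · have h1 := hφσ k
    rw [hid] at h1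
    have h2 : 0 ≤ (2 / g + C₃ * Q) * ε := by positivity
    calc _ ≤ ε / ρ := h1
      _ = 1 / ρ * ε := by ring
      _ ≤ _ := by linarith
  · by_cases hik : i = k
    · subst hik
      rw [if_pos rfl]
      have h1 := hrest i i i (hid i) (hid i)
      have h2 := hZZ i i
      rw [if_pos rfl] at h2
      have h3 := hφσ i
      rw [hid] at h3
      have h4 : |Z i i ^ 2 - d i| ≤ C₃ * ε := by
        have e : C₃ * ε = 2 * r / g * ε + ε + ε / ρ := by rw [hC₃]; ring
        rw [abs_le] at *
        constructor <;> nlinarith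
      have hs : 0 < √(d i) := Real.sqrt_pos.2 (hpos i)
      have h5 : |(|Z i i| - √(d i))| ≤ C₃ * ε * (1 / √(d i)) := by
        rw [mul_one_div, le_div_iff₀ hs]
        have e : Z i i ^ 2 - d i = (|Z i i| - √(d i)) * (|Z i i| + √(d i)) := by
          have := Real.sq_sqrt (hpos i).le
          have := sq_abs (Z i i)
          ring_nf
          linarith
        rw [e, abs_mul, abs_of_pos (by positivity : 0 < |Z i i| + √(d i))] at h4
        nlinarith [abs_nonneg (|Z i i| - √(d i)), abs_nonneg (Z i i)]
      have h6 : |Z i i - (((if 0 ≤ Z i i then 1 else -1 : ℤˣ) : ℤ) : ℝ) * √(d i)| =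
          |(|Z i i| - √(d i))| := by
        split_ifs with h
        · simp [abs_of_nonneg h]
        · rw [abs_of_neg (not_le.1 h)]
          simp only [Units.val_neg, Units.val_one, Int.cast_neg, Int.cast_one]
          rw [← abs_neg]
          congr 1
          ring
      rw [h6]
      have h7 : C₃ * ε * (1 / √(d i)) ≤ C₃ * ε * Q :=
        mul_le_mul_of_nonneg_left (hQk i) (by positivity)
      have h8 : 0 ≤ (1 / ρ + 2 / g) * ε := by positivity
      linarith
    · rw [if_neg hik, sub_zero]
      have h1 := hoff i k (by rwa [hid])
      have h2 : 0 ≤ (1 / ρ + C₃ * Q) * ε := by positivity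
      calc _ ≤ 2 * ε / g := h1
        _ = 2 / g * ε := by ring
        _ ≤ _ := by linarith
end FactorHAC
-- Sample averages and the idiosyncratic remainder
namespace FactorHAC
section Avg
variable {T : ℕ}
/-- The average of `φ` over the sample. -/
noncomputable def avg (φ : Fin T → ℝ) : ℝ := (T : ℝ)⁻¹ * ∑ t, φ t
theorem avg_mono {φ ψ : Fin T → ℝ} (h : ∀ t, φ t ≤ ψ t) : avg φ ≤ avg ψ :=
  mul_le_mul_of_nonneg_left (Finset.sum_le_sum fun t _ => h t) (by positivity)
theorem avg_nonneg {φ : Fin T → ℝ} (h : ∀ t, 0 ≤ φ t) : 0 ≤ avg φ :=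
  mul_nonneg (by positivity) (Finset.sum_nonneg fun t _ => h t)
theorem avg_add (φ ψ : Fin T → ℝ) : avg (fun t => φ t + ψ t) = avg φ + avg ψ := by
  simp [avg, Finset.sum_add_distrib, mul_add]
theorem avg_const_mul (c : ℝ) (φ : Fin T → ℝ) : avg (fun t => c * φ t) = c * avg φ := by
  simp only [avg, ← Finset.mul_sum]
  ring
theorem avg_sum {ι : Type*} (s : Finset ι) (φ : ι → Fin T → ℝ) :
    avg (fun t => ∑ i ∈ s, φ i t) = ∑ i ∈ s, avg (φ i) := by
  simp only [avg, ← Finset.mul_sum]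
  rw [Finset.sum_comm]
-- Not an equality in general: the average over an empty sample is zero.
theorem avg_const_le (c : ℝ) (hc : 0 ≤ c) : avg (fun _ : Fin T => c) ≤ c := by
  simp only [avg, Finset.sum_const, Finset.card_univ, Fintype.card_fin, nsmul_eq_mul]
  rcases Nat.eq_zero_or_pos T with rfl | hT
  · simpa using hc
  · have : (0 : ℝ) < T := by exact_mod_cast hT
    field_simp
    exact le_rfl
theorem sq_avg_mul_le (a b : Fin T → ℝ) :
    (avg fun t => a t * b t) ^ 2 ≤ (avg fun t => a t ^ 2) * avg fun t => b t ^ 2 := by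
  have h := Finset.sum_mul_sq_le_sq_mul_sq Finset.univ a b
  calc (avg fun t => a t * b t) ^ 2 = ((T : ℝ)⁻¹) ^ 2 * (∑ t, a t * b t) ^ 2 := by
        simp only [avg]; ring
    _ ≤ ((T : ℝ)⁻¹) ^ 2 * ((∑ t, a t ^ 2) * ∑ t, b t ^ 2) := by gcongr
    _ = _ := by simp only [avg]; ring
theorem sq_avg_le (a : Fin T → ℝ) : (avg a) ^ 2 ≤ avg fun t => a t ^ 2 := by
  have h := sq_avg_mul_le a fun _ => 1
  simp only [mul_one, one_pow] at h
  have h1 := avg_const_le (T := T) 1 zero_le_one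
  have h2 : 0 ≤ avg fun t => a t ^ 2 := avg_nonneg fun t => sq_nonneg _
  nlinarith
end Avg
section Remainder
variable {N T r : ℕ}
/-- The squared Euclidean norm of row `t`. -/
def rowSq {n : ℕ} (M : Matrix (Fin T) (Fin n) ℝ) (t : Fin T) : ℝ := ∑ j, M t j ^ 2
theorem rowSq_nonneg {n : ℕ} (M : Matrix (Fin T) (Fin n) ℝ) (t : Fin T) : 0 ≤ rowSq M t :=
  Finset.sum_nonneg fun _ _ => sq_nonneg _
theorem sq_le_rowSq {n : ℕ} (M : Matrix (Fin T) (Fin n) ℝ) (t : Fin T) (j : Fin n) :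
    M t j ^ 2 ≤ rowSq M t :=
  Finset.single_le_sum (f := fun j => M t j ^ 2) (fun _ _ => sq_nonneg _) (Finset.mem_univ j)
/-- The part of `(NT)⁻¹ X Xᵀ Ghat` that is due to the idiosyncratic components. -/
noncomputable def remainder (G : Matrix (Fin T) (Fin r) ℝ) (Λ : Matrix (Fin N) (Fin r) ℝ)
    (E : Matrix (Fin T) (Fin N) ℝ) (Ghat : Matrix (Fin T) (Fin r) ℝ) :
    Matrix (Fin T) (Fin r) ℝ :=
  G * ((T : ℝ)⁻¹ • (((N : ℝ)⁻¹ • (E * Λ))ᵀ * Ghat)) +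
    ((N : ℝ)⁻¹ • (E * Λ)) * ((T : ℝ)⁻¹ • (Gᵀ * Ghat)) +
    (T : ℝ)⁻¹ • (((N : ℝ)⁻¹ • (E * Eᵀ)) * Ghat)
theorem gramMatrix_mul_eq (G : Matrix (Fin T) (Fin r) ℝ) (Λ : Matrix (Fin N) (Fin r) ℝ)
    (E : Matrix (Fin T) (Fin N) ℝ) (Ghat : Matrix (Fin T) (Fin r) ℝ) :
    gramMatrix (G * Λᵀ + E) * Ghat =
      G * ((N : ℝ)⁻¹ • (Λᵀ * Λ)) * ((T : ℝ)⁻¹ • (Gᵀ * Ghat)) + remainder G Λ E Ghat := by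
  simp only [gramMatrix, remainder, Matrix.transpose_add, Matrix.transpose_mul,
    Matrix.transpose_transpose, Matrix.transpose_smul, Matrix.add_mul, Matrix.mul_add,
    Matrix.smul_mul, Matrix.mul_smul, Matrix.mul_assoc, smul_add, smul_smul, mul_inv]
  rw [mul_comm (T : ℝ)⁻¹ (N : ℝ)⁻¹]
  abel
theorem add_add_pow_four_le (x y z : ℝ) :
    (x + y + z) ^ 4 ≤ 27 * ((x ^ 2) ^ 2 + (y ^ 2) ^ 2 + (z ^ 2) ^ 2) := by
  have h1 : (x + y + z) ^ 2 ≤ 3 * (x ^ 2 + y ^ 2 + z ^ 2) := by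
    nlinarith [sq_nonneg (x - y), sq_nonneg (y - z), sq_nonneg (x - z)]
  have h2 : (x ^ 2 + y ^ 2 + z ^ 2) ^ 2 ≤ 3 * ((x ^ 2) ^ 2 + (y ^ 2) ^ 2 + (z ^ 2) ^ 2) := by
    nlinarith [sq_nonneg (x ^ 2 - y ^ 2), sq_nonneg (y ^ 2 - z ^ 2), sq_nonneg (x ^ 2 - z ^ 2)]
  calc (x + y + z) ^ 4 = ((x + y + z) ^ 2) ^ 2 := by ring
    _ ≤ (3 * (x ^ 2 + y ^ 2 + z ^ 2)) ^ 2 := by gcongr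
    _ ≤ _ := by nlinarith
/-- Product moments with the normalised columns of `Ghat`. -/
theorem sq_avg_mul_col_le {Ghat : Matrix (Fin T) (Fin r) ℝ}
    (hG : ∀ k, avg (fun t => Ghat t k ^ 2) = 1) (a : Fin T → ℝ) (k : Fin r) :
    (avg fun t => a t * Ghat t k) ^ 2 ≤ avg fun t => a t ^ 2 := by
  have := sq_avg_mul_le a fun t => Ghat t k
  rwa [hG, mul_one] at this
theorem sq_mul_apply_le (M : Matrix (Fin T) (Fin r) ℝ) {Ghat : Matrix (Fin T) (Fin r) ℝ}
    (hG : ∀ k, avg (fun t => Ghat t k ^ 2) = 1) (W : Matrix (Fin T) (Fin r) ℝ) (t : Fin T)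
    (k : Fin r) :
    ((M * ((T : ℝ)⁻¹ • (Wᵀ * Ghat))) t k) ^ 2 ≤ rowSq M t * avg (rowSq W) := by
  have e : ∀ j, ((T : ℝ)⁻¹ • (Wᵀ * Ghat)) j k = avg fun s => W s j * Ghat s k := fun j => by
    simp [avg, Matrix.mul_apply]
  rw [Matrix.mul_apply]
  refine (Finset.sum_mul_sq_le_sq_mul_sq _ _ _).trans ?_
  refine mul_le_mul_of_nonneg_left ?_ (rowSq_nonneg M t)
  have e2 : avg (rowSq W) = ∑ j, avg fun s => W s j ^ 2 :=
    avg_sum Finset.univ fun j s => W s j ^ 2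
  rw [e2]
  exact Finset.sum_le_sum fun j _ => by
    rw [e]
    exact sq_avg_mul_col_le hG _ k
-- Ghat depends on all of the data, but its columns have mean square one, so Cauchy–Schwarz removes
-- it from each of the three terms and leaves moments of G, E Λ/N and E Eᵀ/N. Fourth powers are
-- needed because score errors contain products of two factor errors, and their mean squares have to
-- be controlled.
theorem avg_remainder_pow_four_le (G : Matrix (Fin T) (Fin r) ℝ) (Λ : Matrix (Fin N) (Fin r) ℝ)
    (E : Matrix (Fin T) (Fin N) ℝ) {Ghat : Matrix (Fin T) (Fin r) ℝ}
    (hG : ∀ k, avg (fun t => Ghat t k ^ 2) = 1) (k : Fin r) :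
    avg (fun t => remainder G Λ E Ghat t k ^ 4) ≤
      27 * (2 * ((avg fun t => rowSq G t ^ 2) * avg fun t => rowSq ((N : ℝ)⁻¹ • (E * Λ)) t ^ 2) +
        avg fun t => (avg fun s => ((N : ℝ)⁻¹ • (E * Eᵀ)) t s ^ 2) ^ 2) := by
  set W := (N : ℝ)⁻¹ • (E * Λ) with hW
  set c := (N : ℝ)⁻¹ • (E * Eᵀ) with hc
  have hx := fun t => sq_mul_apply_le G hG W t k
  have hy := fun t => sq_mul_apply_le W hG G t k
  have hz : ∀ t, (((T : ℝ)⁻¹ • (c * Ghat)) t k) ^ 2 ≤ avg fun s => c t s ^ 2 := fun t => by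
    have e : ((T : ℝ)⁻¹ • (c * Ghat)) t k = avg fun s => c t s * Ghat s k := by
      simp only [avg, Matrix.smul_apply, Matrix.mul_apply, smul_eq_mul]
    rw [e]
    exact sq_avg_mul_col_le hG _ k
  have aW := sq_avg_le (rowSq W)
  have aG := sq_avg_le (rowSq G)
  have key : ∀ t, remainder G Λ E Ghat t k ^ 4 ≤
      27 * ((avg fun t => rowSq W t ^ 2) * rowSq G t ^ 2 +
        (avg fun t => rowSq G t ^ 2) * rowSq W t ^ 2 + (avg fun s => c t s ^ 2) ^ 2) := by
    intro t
    have e : remainder G Λ E Ghat t k = (G * ((T : ℝ)⁻¹ • (Wᵀ * Ghat))) t k +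
        (W * ((T : ℝ)⁻¹ • (Gᵀ * Ghat))) t k + ((T : ℝ)⁻¹ • (c * Ghat)) t k := rfl
    rw [e]
    refine (add_add_pow_four_le _ _ _).trans ?_
    have b1 : ((G * ((T : ℝ)⁻¹ • (Wᵀ * Ghat))) t k ^ 2) ^ 2 ≤
        (avg fun t => rowSq W t ^ 2) * rowSq G t ^ 2 := by
      calc _ ≤ (rowSq G t * avg (rowSq W)) ^ 2 := pow_le_pow_left₀ (sq_nonneg _) (hx t) 2
        _ = (avg (rowSq W)) ^ 2 * rowSq G t ^ 2 := by ring
        _ ≤ _ := by gcongr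
    have b2 : ((W * ((T : ℝ)⁻¹ • (Gᵀ * Ghat))) t k ^ 2) ^ 2 ≤
        (avg fun t => rowSq G t ^ 2) * rowSq W t ^ 2 := by
      calc _ ≤ (rowSq W t * avg (rowSq G)) ^ 2 := pow_le_pow_left₀ (sq_nonneg _) (hy t) 2
        _ = (avg (rowSq G)) ^ 2 * rowSq W t ^ 2 := by ring
        _ ≤ _ := by gcongr
    have b3 := pow_le_pow_left₀ (sq_nonneg _) (hz t) 2
    linarith
  refine (avg_mono key).trans (le_of_eq ?_)
  rw [avg_const_mul, avg_add, avg_add, avg_const_mul, avg_const_mul]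
  ring
end Remainder
end FactorHAC
-- A lower bound for the leading eigenvalues
namespace FactorHAC
variable {N T r : ℕ}
theorem dotProduct_self_eq_sum_sq {n : ℕ} (x : Fin n → ℝ) : x ⬝ᵥ x = ∑ i, x i ^ 2 := by
  simp [dotProduct, sq]
theorem dotProduct_self_nonneg_real {n : ℕ} (x : Fin n → ℝ) : 0 ≤ x ⬝ᵥ x := by
  rw [dotProduct_self_eq_sum_sq]
  positivity
theorem sq_dotProduct_le {n : ℕ} (x y : Fin n → ℝ) : (x ⬝ᵥ y) ^ 2 ≤ (x ⬝ᵥ x) * (y ⬝ᵥ y) := by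
  rw [dotProduct_self_eq_sum_sq, dotProduct_self_eq_sum_sq]
  exact Finset.sum_mul_sq_le_sq_mul_sq _ _ _
theorem dotProduct_mulVec_self_le {m n : ℕ} (M : Matrix (Fin m) (Fin n) ℝ) (x : Fin n → ℝ) :
    (M *ᵥ x) ⬝ᵥ (M *ᵥ x) ≤ (∑ i, ∑ j, M i j ^ 2) * (x ⬝ᵥ x) := by
  rw [dotProduct_self_eq_sum_sq, dotProduct_self_eq_sum_sq, Finset.sum_mul]
  exact Finset.sum_le_sum fun i _ => by
    simp only [Matrix.mulVec, dotProduct]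
    exact Finset.sum_mul_sq_le_sq_mul_sq _ _ _
-- If A = Yᵀ Y with Y invertible, then x = Y⁻¹ (Y x) bounds |x|² by the squared Frobenius norm of
-- Y⁻¹ times xᵀ A x.
theorem exists_pos_mul_le_of_posDef {A : Matrix (Fin r) (Fin r) ℝ} (hA : A.PosDef) :
    ∃ α : ℝ, 0 < α ∧ ∀ x : Fin r → ℝ, α * (x ⬝ᵥ x) ≤ x ⬝ᵥ (A *ᵥ x) := by
  obtain ⟨Y, hY⟩ : ∃ Y : Matrix (Fin r) (Fin r) ℝ, A = Yᵀ * Y := by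
    open scoped MatrixOrder in
    obtain ⟨Y, hY⟩ := CStarAlgebra.nonneg_iff_eq_star_mul_self.mp hA.posSemidef.nonneg
    exact ⟨Y, by rw [hY, Matrix.star_eq_conjTranspose,
      Matrix.conjTranspose_eq_transpose_of_trivial]⟩
  have hYdet : IsUnit Y.det := by
    have h1 : IsUnit A.det := (Matrix.isUnit_iff_isUnit_det A).1 hA.isUnit
    rw [hY, Matrix.det_mul] at h1
    exact isUnit_of_mul_isUnit_right h1
  set F : ℝ := ∑ i, ∑ j, (Y⁻¹) i j ^ 2 with hF
  have hF0 : 0 ≤ F := Finset.sum_nonneg fun i _ => Finset.sum_nonneg fun j _ => sq_nonneg _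
  refine ⟨(1 + F)⁻¹, by positivity, fun x => ?_⟩
  have h1 : x ⬝ᵥ (A *ᵥ x) = (Y *ᵥ x) ⬝ᵥ (Y *ᵥ x) := by
    rw [hY, ← Matrix.mulVec_mulVec, Matrix.dotProduct_mulVec, Matrix.vecMul_transpose]
  have h2 : x = Y⁻¹ *ᵥ (Y *ᵥ x) := by
    rw [Matrix.mulVec_mulVec, Matrix.nonsing_inv_mul Y hYdet, Matrix.one_mulVec]
  have h3 := dotProduct_mulVec_self_le (Y⁻¹) (Y *ᵥ x)
  rw [← h2, ← hF, ← h1] at h3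
  have h4 : 0 ≤ x ⬝ᵥ (A *ᵥ x) := by rw [h1]; exact dotProduct_self_nonneg_real _
  rw [inv_mul_le_iff₀ (by positivity)]
  linarith
theorem abs_dotProduct_mulVec_le {M : Matrix (Fin r) (Fin r) ℝ} {b : ℝ}
    (hM : ∀ i j, |M i j| ≤ b) (x : Fin r → ℝ) : |x ⬝ᵥ (M *ᵥ x)| ≤ r * b * (x ⬝ᵥ x) := by
  rcases Nat.eq_zero_or_pos r with rfl | hr
  · simp [dotProduct]
  have hb : 0 ≤ b := (abs_nonneg _).trans (hM ⟨0, hr⟩ ⟨0, hr⟩)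
  have h1 := dotProduct_mulVec_self_le M x
  have h2 : ∑ i, ∑ j, M i j ^ 2 ≤ (r * b) ^ 2 := by
    calc ∑ i, ∑ j, M i j ^ 2 ≤ ∑ _i : Fin r, ∑ _j : Fin r, b ^ 2 :=
          Finset.sum_le_sum fun i _ => Finset.sum_le_sum fun j _ => by
            rw [← sq_abs]
            exact pow_le_pow_left₀ (abs_nonneg _) (hM i j) 2
      _ = _ := by simp; ring
  have h3 := sq_dotProduct_le x (M *ᵥ x)
  have h0 := dotProduct_self_nonneg_real x
  refine abs_le_of_sq_le_sq ?_ (by positivity)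
  calc _ ≤ (x ⬝ᵥ x) * ((r * b) ^ 2 * (x ⬝ᵥ x)) :=
        h3.trans (mul_le_mul_of_nonneg_left (h1.trans (mul_le_mul_of_nonneg_right h2 h0)) h0)
    _ = _ := by ring
theorem mul_le_of_perturbation {A A₀ : Matrix (Fin r) (Fin r) ℝ} {α b : ℝ}
    (hA₀ : ∀ x : Fin r → ℝ, α * (x ⬝ᵥ x) ≤ x ⬝ᵥ (A₀ *ᵥ x))
    (hA : ∀ i j, |A i j - A₀ i j| ≤ b) (hb : r * b ≤ α / 2) (x : Fin r → ℝ) :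
    α / 2 * (x ⬝ᵥ x) ≤ x ⬝ᵥ (A *ᵥ x) := by
  have h1 := abs_dotProduct_mulVec_le (M := A - A₀) hA x
  rw [Matrix.sub_mulVec, dotProduct_sub] at h1
  have h2 := (abs_le.1 h1).1
  have h3 := mul_le_mul_of_nonneg_right hb (dotProduct_self_nonneg_real x)
  linarith [hA₀ x]
theorem half_sub_le_dotProduct_add {n : ℕ} (a b : Fin n → ℝ) :
    (a ⬝ᵥ a) / 2 - b ⬝ᵥ b ≤ (a + b) ⬝ᵥ (a + b) := by
  simp only [dotProduct_self_eq_sum_sq, Finset.sum_div, ← Finset.sum_sub_distrib]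
  exact Finset.sum_le_sum fun i _ => by
    simp only [Pi.add_apply]
    nlinarith [sq_nonneg (a i + 2 * b i)]
/-- The `r` largest eigenvalues of `(NT)⁻¹ X Xᵀ` are bounded away from zero. -/
theorem le_phi {G : Matrix (Fin T) (Fin r) ℝ} {Λ : Matrix (Fin N) (Fin r) ℝ}
    {E : Matrix (Fin T) (Fin N) ℝ} (hN : 1 ≤ N) (hT : 1 ≤ T) {α β θ : ℝ} (hα : 0 < α) (hβ : 0 < β)
    (hθ : 0 ≤ θ)
    (hA : ∀ x : Fin r → ℝ, α * (x ⬝ᵥ x) ≤ x ⬝ᵥ (((N : ℝ)⁻¹ • (Λᵀ * Λ)) *ᵥ x))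
    (hB : ∀ x : Fin r → ℝ, β * (x ⬝ᵥ x) ≤ x ⬝ᵥ (((T : ℝ)⁻¹ • (Gᵀ * G)) *ᵥ x))
    (hE : (avg fun t => avg fun s => ((N : ℝ)⁻¹ • (E * Eᵀ)) t s ^ 2) ≤ θ ^ 2)
    {k : ℕ} (hk : k < r) (hkT : k < Fintype.card (Fin T)) :
    α * β / 2 - θ ≤ (gramMatrix_isHermitian (G * Λᵀ + E)).eigenvalues₀ ⟨k, hkT⟩ := by
  have hN' : (0 : ℝ) < N := by exact_mod_cast hN
  have hT' : (0 : ℝ) < T := by exact_mod_cast hT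
  have hGx : ∀ x : Fin r → ℝ, x ⬝ᵥ (((T : ℝ)⁻¹ • (Gᵀ * G)) *ᵥ x) =
      (T : ℝ)⁻¹ * ((G *ᵥ x) ⬝ᵥ (G *ᵥ x)) := fun x => by
    rw [Matrix.smul_mulVec, dotProduct_smul, ← Matrix.mulVec_mulVec, Matrix.dotProduct_mulVec,
      Matrix.vecMul_transpose, smul_eq_mul]
  refine le_eigenvalues₀_of_forall_range _ G (fun x hx h0 => ?_) (fun x => ?_) hk hkT
  · have h1 := hB x
    rw [hGx, h0, dotProduct_zero, mul_zero] at h1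
    have h2 := dotProduct_self_nonneg_real x
    have h3 : x ⬝ᵥ x = 0 := by nlinarith
    exact hx (dotProduct_self_eq_zero.1 h3)
  · set v := G *ᵥ x with hv
    set B := (T : ℝ)⁻¹ • (Gᵀ * G) with hBdef
    set y := B *ᵥ x with hy
    have hGv : Gᵀ *ᵥ v = (T : ℝ) • y := by
      rw [hy, hBdef, hv, Matrix.mulVec_mulVec, Matrix.smul_mulVec, smul_smul,
        mul_inv_cancel₀ hT'.ne', one_smul]
    have e1 : v ⬝ᵥ (gramMatrix (G * Λᵀ + E) *ᵥ v) = ((N : ℝ) * T)⁻¹ *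
        ((Λ *ᵥ (Gᵀ *ᵥ v) + Eᵀ *ᵥ v) ⬝ᵥ (Λ *ᵥ (Gᵀ *ᵥ v) + Eᵀ *ᵥ v)) := by
      have : (G * Λᵀ + E)ᵀ *ᵥ v = Λ *ᵥ (Gᵀ *ᵥ v) + Eᵀ *ᵥ v := by
        rw [Matrix.transpose_add, Matrix.transpose_mul, Matrix.transpose_transpose,
          Matrix.add_mulVec, ← Matrix.mulVec_mulVec]
      rw [gramMatrix, Matrix.smul_mulVec, dotProduct_smul, ← Matrix.mulVec_mulVec,
        Matrix.dotProduct_mulVec, ← Matrix.mulVec_transpose, this, smul_eq_mul]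
    have e2 : (Λ *ᵥ (Gᵀ *ᵥ v)) ⬝ᵥ (Λ *ᵥ (Gᵀ *ᵥ v)) = N * T ^ 2 *
        (y ⬝ᵥ (((N : ℝ)⁻¹ • (Λᵀ * Λ)) *ᵥ y)) := by
      have : y ⬝ᵥ (((N : ℝ)⁻¹ • (Λᵀ * Λ)) *ᵥ y) = (N : ℝ)⁻¹ * ((Λ *ᵥ y) ⬝ᵥ (Λ *ᵥ y)) := by
        rw [Matrix.smul_mulVec, dotProduct_smul, ← Matrix.mulVec_mulVec,
          Matrix.dotProduct_mulVec y, Matrix.vecMul_transpose, smul_eq_mul]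
      rw [this, hGv, Matrix.mulVec_smul, dotProduct_smul, smul_dotProduct]
      simp only [smul_eq_mul]
      field_simp
    have e3 : (Eᵀ *ᵥ v) ⬝ᵥ (Eᵀ *ᵥ v) = N * (v ⬝ᵥ (((N : ℝ)⁻¹ • (E * Eᵀ)) *ᵥ v)) := by
      rw [Matrix.smul_mulVec, dotProduct_smul, ← Matrix.mulVec_mulVec, Matrix.dotProduct_mulVec v,
        ← Matrix.mulVec_transpose]
      simp only [smul_eq_mul]
      field_simp
    have hvv := dotProduct_self_nonneg_real v
    have b1 : v ⬝ᵥ (((N : ℝ)⁻¹ • (E * Eᵀ)) *ᵥ v) ≤ T * θ * (v ⬝ᵥ v) := by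
      have h1 := sq_dotProduct_le v (((N : ℝ)⁻¹ • (E * Eᵀ)) *ᵥ v)
      have h2 := dotProduct_mulVec_self_le ((N : ℝ)⁻¹ • (E * Eᵀ)) v
      have h3 : ∑ t, ∑ s, ((N : ℝ)⁻¹ • (E * Eᵀ)) t s ^ 2 ≤ (T * θ) ^ 2 := by
        have e : (avg fun t => avg fun s => ((N : ℝ)⁻¹ • (E * Eᵀ)) t s ^ 2) =
            ((T : ℝ)⁻¹) ^ 2 * ∑ t, ∑ s, ((N : ℝ)⁻¹ • (E * Eᵀ)) t s ^ 2 := by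
          simp only [avg, ← Finset.mul_sum]
          ring
        rw [e, inv_pow, inv_mul_le_iff₀ (by positivity)] at hE
        rw [mul_pow]
        exact hE
      refine (le_abs_self _).trans (abs_le_of_sq_le_sq ?_ (by positivity))
      calc _ ≤ (v ⬝ᵥ v) * ((T * θ) ^ 2 * (v ⬝ᵥ v)) :=
            h1.trans (mul_le_mul_of_nonneg_left
              (h2.trans (mul_le_mul_of_nonneg_right h3 hvv)) hvv)
        _ = _ := by ring
    -- As y = B x, this says that B² dominates β B: combine β |x|² ≤ x·y with Cauchy–Schwarz. It is
    -- needed because Gᵀ v = T y, so the signal is a quadratic form in y, while |v|² = T x·y.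
    have b2 : β * (x ⬝ᵥ y) ≤ y ⬝ᵥ y := by
      have h1 := sq_dotProduct_le x y
      have h2 : β * (x ⬝ᵥ x) ≤ x ⬝ᵥ y := hB x
      have h3 := dotProduct_self_nonneg_real x
      have h4 := dotProduct_self_nonneg_real y
      have h5 : 0 ≤ x ⬝ᵥ y := le_trans (by positivity) h2
      rcases h5.eq_or_lt with h6 | h6
      · rw [← h6]; simpa using h4
      · have h7 : β * (x ⬝ᵥ y) ^ 2 ≤ (x ⬝ᵥ y) * (y ⬝ᵥ y) := by
          calc β * (x ⬝ᵥ y) ^ 2 ≤ β * ((x ⬝ᵥ x) * (y ⬝ᵥ y)) := by gcongr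
            _ = β * (x ⬝ᵥ x) * (y ⬝ᵥ y) := by ring
            _ ≤ _ := by gcongr
        have h8 : (x ⬝ᵥ y) * (β * (x ⬝ᵥ y)) ≤ (x ⬝ᵥ y) * (y ⬝ᵥ y) := by linarith [h7]
        exact le_of_mul_le_mul_left h8 h6
    have b3 : x ⬝ᵥ y = (T : ℝ)⁻¹ * (v ⬝ᵥ v) := hGx x
    have b4 := hA y
    have b5 : α * β * (T : ℝ)⁻¹ * (v ⬝ᵥ v) ≤ y ⬝ᵥ (((N : ℝ)⁻¹ • (Λᵀ * Λ)) *ᵥ y) := by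
      refine le_trans ?_ b4
      rw [b3] at b2
      calc _ = α * (β * ((T : ℝ)⁻¹ * (v ⬝ᵥ v))) := by ring
        _ ≤ _ := by gcongr
    rw [e1]
    -- |a + b|² ≥ |a|²/2 - |b|², with a the signal and b the noise; this produces α β/2 and θ after
    -- division by N T.
    have h6 := half_sub_le_dotProduct_add (Λ *ᵥ (Gᵀ *ᵥ v)) (Eᵀ *ᵥ v)
    rw [e2, e3] at h6
    have h7 : N * T * ((α * β / 2 - θ) * (v ⬝ᵥ v)) ≤
        (Λ *ᵥ (Gᵀ *ᵥ v) + Eᵀ *ᵥ v) ⬝ᵥ (Λ *ᵥ (Gᵀ *ᵥ v) + Eᵀ *ᵥ v) := by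
      refine le_trans ?_ h6
      have k1 : N * T ^ 2 * (α * β * (T : ℝ)⁻¹ * (v ⬝ᵥ v)) ≤
          N * T ^ 2 * (y ⬝ᵥ (((N : ℝ)⁻¹ • (Λᵀ * Λ)) *ᵥ y)) := by gcongr
      have k2 : N * (v ⬝ᵥ (((N : ℝ)⁻¹ • (E * Eᵀ)) *ᵥ v)) ≤ N * (T * θ * (v ⬝ᵥ v)) := by gcongr
      have k3 : N * T ^ 2 * (α * β * (T : ℝ)⁻¹ * (v ⬝ᵥ v)) = N * T * (α * β * (v ⬝ᵥ v)) := by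
        field_simp
      linarith
    rw [le_inv_mul_iff₀ (by positivity)]
    exact h7
end FactorHAC
-- The eigenvector equation under regularity
namespace FactorHAC
variable {N T r : ℕ}
theorem abs_mul_apply_le {ι κ : Type*} {M : Matrix ι (Fin r) ℝ} {P : Matrix (Fin r) κ ℝ} {b c : ℝ}
    (hM : ∀ i j, |M i j| ≤ b) (hP : ∀ i j, |P i j| ≤ c) (i : ι) (j : κ) :
    |(M * P) i j| ≤ r * (b * c) := by
  rw [Matrix.mul_apply]
  calc _ ≤ ∑ k, |M i k * P k j| := Finset.abs_sum_le_sum_abs _ _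
    _ ≤ ∑ _k : Fin r, b * c := Finset.sum_le_sum fun k _ => by
        rw [abs_mul]
        exact mul_le_mul (hM i k) (hP k j) (abs_nonneg _) ((abs_nonneg _).trans (hM i k))
    _ = _ := by simp
/-- The deterministic conditions on factors, loadings and idiosyncratic components under which the
estimated factors are within order `δ` of a rotation of the factors. -/
structure IsRegular (A₀ B₀ : Matrix (Fin r) (Fin r) ℝ) (C δ : ℝ) (G : Matrix (Fin T) (Fin r) ℝ)
    (Λ : Matrix (Fin N) (Fin r) ℝ) (E : Matrix (Fin T) (Fin N) ℝ) : Prop where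
  loadings : ∀ i j, |((N : ℝ)⁻¹ • (Λᵀ * Λ)) i j - A₀ i j| ≤ C * δ
  factors : ∀ i j, |((T : ℝ)⁻¹ • (Gᵀ * G)) i j - B₀ i j| ≤ C * δ
  fourth : (avg fun t => rowSq G t ^ 2) ≤ C
  cross : (avg fun t => rowSq ((N : ℝ)⁻¹ • (E * Λ)) t ^ 2) ≤ C * δ ^ 4
  idio : (avg fun t => (avg fun s => ((N : ℝ)⁻¹ • (E * Eᵀ)) t s ^ 2) ^ 2) ≤ C * δ ^ 4
-- Replaces √C by the cruder 1 + C, which keeps all constants polynomial.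
theorem le_mul_of_sq_le {x C y : ℝ} (hC : 0 ≤ C) (hy : 0 ≤ y) (h : x ^ 2 ≤ C * y ^ 2) :
    x ≤ (1 + C) * y := by
  refine le_of_sq_le_sq ?_ (by positivity)
  nlinarith [sq_nonneg y, mul_nonneg hC (sq_nonneg y), mul_nonneg (mul_nonneg hC hC) (sq_nonneg y)]
theorem smul_transpose_mul_apply {m n : ℕ} (P : Matrix (Fin T) (Fin m) ℝ)
    (M : Matrix (Fin T) (Fin n) ℝ) (i : Fin m) (k : Fin n) :
    ((T : ℝ)⁻¹ • (Pᵀ * M)) i k = avg fun t => P t i * M t k := by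
  simp [avg, Matrix.mul_apply]
theorem IsFactorEstimator.avg_sq {X : Matrix (Fin T) (Fin N) ℝ} {Ghat : Matrix (Fin T) (Fin r) ℝ}
    (h : IsFactorEstimator X Ghat) (hT : 1 ≤ T) (k : Fin r) :
    avg (fun t => Ghat t k ^ 2) = 1 := by
  have hT' : (T : ℝ) ≠ 0 := by positivity
  have h1 := smul_transpose_mul_apply Ghat Ghat k k
  rw [h.1, smul_smul, inv_mul_cancel₀ hT', one_smul, Matrix.one_apply_eq] at h1
  simpa [sq] using h1.symm
/-- The eigenvalue equation, projected on the factors and on the estimated factors. -/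
theorem IsFactorEstimator.equations {G : Matrix (Fin T) (Fin r) ℝ} {Λ : Matrix (Fin N) (Fin r) ℝ}
    {E : Matrix (Fin T) (Fin N) ℝ} {Ghat : Matrix (Fin T) (Fin r) ℝ} (hT : 1 ≤ T)
    (h : IsFactorEstimator (G * Λᵀ + E) Ghat) :
    let A := (N : ℝ)⁻¹ • (Λᵀ * Λ)
    let Q := (T : ℝ)⁻¹ • (Gᵀ * Ghat)
    let Φ := phiMatrix r (G * Λᵀ + E)
    let R := remainder G Λ E Ghat
    Ghat * Φ = G * A * Q + R ∧
    Q * Φ = ((T : ℝ)⁻¹ • (Gᵀ * G)) * A * Q + (T : ℝ)⁻¹ • (Gᵀ * R) ∧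
    Φ = Qᵀ * A * Q + (T : ℝ)⁻¹ • (Ghatᵀ * R) := by
  intro A Q Φ R
  have hT' : (T : ℝ) ≠ 0 := by positivity
  have e1 : Ghat * Φ = G * A * Q + R := by
    rw [← h.2, gramMatrix_mul_eq]
  refine ⟨e1, ?_, ?_⟩
  · calc Q * Φ = (T : ℝ)⁻¹ • (Gᵀ * (Ghat * Φ)) := by
          simp only [Q, Matrix.smul_mul, Matrix.mul_assoc]
      _ = _ := by
          rw [e1]
          simp only [Matrix.smul_mul, Matrix.mul_assoc, Matrix.mul_add, smul_add]
  · have e2 : (T : ℝ)⁻¹ • (Ghatᵀ * (Ghat * Φ)) = Φ := by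
      rw [← Matrix.mul_assoc, h.1, Matrix.smul_mul, smul_smul, inv_mul_cancel₀ hT', one_smul,
        Matrix.one_mul]
    calc Φ = (T : ℝ)⁻¹ • (Ghatᵀ * (Ghat * Φ)) := e2.symm
      _ = _ := by
          rw [e1]
          simp only [Q, Matrix.smul_mul, Matrix.mul_assoc, Matrix.mul_add, smul_add,
            Matrix.transpose_smul, Matrix.transpose_mul, Matrix.transpose_transpose]
section Bounds
variable {A₀ B₀ : Matrix (Fin r) (Fin r) ℝ} {C δ : ℝ} {G : Matrix (Fin T) (Fin r) ℝ}
  {Λ : Matrix (Fin N) (Fin r) ℝ} {E : Matrix (Fin T) (Fin N) ℝ} {Ghat : Matrix (Fin T) (Fin r) ℝ}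
theorem IsRegular.avg_rowSq_le (h : IsRegular A₀ B₀ C δ G Λ E) (hC : 0 ≤ C) :
    avg (rowSq G) ≤ 1 + C := by
  have := le_mul_of_sq_le (y := 1) hC zero_le_one
    (((sq_avg_le (rowSq G)).trans h.fourth).trans (by simp))
  simpa using this
theorem IsRegular.avg_remainder_pow_four_le (h : IsRegular A₀ B₀ C δ G Λ E) (hC : 0 ≤ C)
    (hG : ∀ k, avg (fun t => Ghat t k ^ 2) = 1) (k : Fin r) :
    avg (fun t => remainder G Λ E Ghat t k ^ 4) ≤ 27 * (2 * C ^ 2 + C) * δ ^ 4 := by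
  refine (FactorHAC.avg_remainder_pow_four_le G Λ E hG k).trans ?_
  have h1 : (avg fun t => rowSq G t ^ 2) * (avg fun t => rowSq ((N : ℝ)⁻¹ • (E * Λ)) t ^ 2) ≤
      C * (C * δ ^ 4) :=
    mul_le_mul h.fourth h.cross (avg_nonneg fun t => sq_nonneg _) hC
  linarith [h.idio]
theorem IsRegular.avg_remainder_sq_le (h : IsRegular A₀ B₀ C δ G Λ E) (hC : 0 ≤ C)
    (hG : ∀ k, avg (fun t => Ghat t k ^ 2) = 1) (k : Fin r) :
    avg (fun t => remainder G Λ E Ghat t k ^ 2) ≤ (1 + 27 * (2 * C ^ 2 + C)) * δ ^ 2 := by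
  refine le_mul_of_sq_le (by positivity) (by positivity) ?_
  refine (sq_avg_le _).trans ?_
  have h4 := h.avg_remainder_pow_four_le hC hG k
  simp only [← pow_mul]
  exact h4
theorem IsRegular.abs_gram_le (h : IsRegular A₀ B₀ C δ G Λ E) (hC : 0 ≤ C)
    (hG : ∀ k, avg (fun t => Ghat t k ^ 2) = 1) (i k : Fin r) :
    |((T : ℝ)⁻¹ • (Gᵀ * Ghat)) i k| ≤ 1 + C := by
  rw [smul_transpose_mul_apply]
  refine abs_le_of_sq_le_sq ?_ (by positivity)
  have h1 := sq_avg_mul_col_le hG (fun t => G t i) k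
  have h2 : avg (fun t => G t i ^ 2) ≤ avg (rowSq G) := avg_mono fun t => sq_le_rowSq G t i
  have h3 := h.avg_rowSq_le hC
  nlinarith
theorem IsRegular.abs_remainder_gram_le (h : IsRegular A₀ B₀ C δ G Λ E) (hC : 0 ≤ C) (hδ : 0 ≤ δ)
    (hG : ∀ k, avg (fun t => Ghat t k ^ 2) = 1) (i k : Fin r) :
    |((T : ℝ)⁻¹ • (Gᵀ * remainder G Λ E Ghat)) i k| ≤
        (1 + C) * (1 + 27 * (2 * C ^ 2 + C)) * δ ∧
      |((T : ℝ)⁻¹ • (Ghatᵀ * remainder G Λ E Ghat)) i k| ≤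
        (1 + C) * (1 + 27 * (2 * C ^ 2 + C)) * δ := by
  have h4 := h.avg_remainder_sq_le hC hG k
  set c := 1 + 27 * (2 * C ^ 2 + C) with hc
  have hc1 : 1 ≤ c := by rw [hc]; nlinarith [sq_nonneg C]
  have h0 : 0 ≤ avg (fun t => remainder G Λ E Ghat t k ^ 2) := avg_nonneg fun t => sq_nonneg _
  have key : ∀ P : Matrix (Fin T) (Fin r) ℝ, avg (fun t => P t i ^ 2) ≤ 1 + C →
      |((T : ℝ)⁻¹ • (Pᵀ * remainder G Λ E Ghat)) i k| ≤ (1 + C) * c * δ := by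
    intro P hP
    rw [smul_transpose_mul_apply]
    refine abs_le_of_sq_le_sq ?_ (by positivity)
    refine (sq_avg_mul_le _ _).trans ?_
    calc _ ≤ (1 + C) * (c * δ ^ 2) := mul_le_mul hP h4 h0 (by positivity)
      _ ≤ ((1 + C) * c) ^ 2 * δ ^ 2 := by
          have h5 : 1 ≤ (1 + C) * c := by nlinarith
          nlinarith [mul_le_mul_of_nonneg_right h5 (by positivity : 0 ≤ (1 + C) * c * δ ^ 2)]
      _ = _ := by ring
  refine ⟨key G ?_, key Ghat ?_⟩
  · exact (avg_mono fun t => sq_le_rowSq G t i).trans (h.avg_rowSq_le hC)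
  · rw [hG]; linarith
end Bounds
/-- The diagonal of `phiMatrix`. -/
noncomputable def phiDiag (r : ℕ) (X : Matrix (Fin T) (Fin N) ℝ) (k : Fin r) : ℝ :=
  if h : (k : ℕ) < Fintype.card (Fin T) then (gramMatrix_isHermitian X).eigenvalues₀ ⟨k, h⟩ else 0
theorem phiMatrix_eq (X : Matrix (Fin T) (Fin N) ℝ) :
    phiMatrix r X = Matrix.diagonal (phiDiag r X) := rfl
theorem phiDiag_antitone (hr : r ≤ T) (X : Matrix (Fin T) (Fin N) ℝ) :
    Antitone (phiDiag r X) := by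
  intro j k hjk
  have hj : (j : ℕ) < Fintype.card (Fin T) := by simpa using j.2.trans_le hr
  have hk : (k : ℕ) < Fintype.card (Fin T) := by simpa using k.2.trans_le hr
  simp only [phiDiag, hj, hk, dif_pos]
  exact (gramMatrix_isHermitian X).eigenvalues₀_antitone hjk
theorem eventually_mul_le (c : ℝ) {d : ℝ} (hd : 0 < d) : ∀ᶠ δ : ℝ in 𝓝[>] 0, c * δ ≤ d := by
  have h : Tendsto (fun δ : ℝ => c * δ) (𝓝[>] 0) (𝓝 (c * 0)) :=
    (tendsto_nhdsWithin_of_tendsto_nhds tendsto_id).const_mul c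
  rw [mul_zero] at h
  exact (h.eventually (gt_mem_nhds hd)).mono fun _ h => h.le
/-- The eigenvalues that enter `phiMatrix` are bounded away from zero. -/
theorem exists_le_phiDiag {A₀ B₀ : Matrix (Fin r) (Fin r) ℝ} (hA₀ : A₀.PosDef) (hB₀ : B₀.PosDef)
    {C : ℝ} (hC : 0 ≤ C) : ∃ c > 0, ∀ᶠ δ : ℝ in 𝓝[>] 0, ∀ (N T : ℕ), 1 ≤ N → 1 ≤ T → r ≤ T →
      ∀ (G : Matrix (Fin T) (Fin r) ℝ) (Λ : Matrix (Fin N) (Fin r) ℝ)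
        (E : Matrix (Fin T) (Fin N) ℝ), IsRegular A₀ B₀ C δ G Λ E →
        ∀ k, c ≤ phiDiag r (G * Λᵀ + E) k := by
  obtain ⟨α, hα, hA⟩ := exists_pos_mul_le_of_posDef hA₀
  obtain ⟨β, hβ, hB⟩ := exists_pos_mul_le_of_posDef hB₀
  -- Perturbation halves α and β, so the signal is at least α β/8; the noise (1 + C) δ may use up
  -- half of it.
  refine ⟨α * β / 16, by positivity, ?_⟩
  filter_upwards [self_mem_nhdsWithin, eventually_mul_le (r * C) (half_pos hα),
    eventually_mul_le (r * C) (half_pos hβ),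
    eventually_mul_le (1 + C) (by positivity : 0 < α * β / 16)] with δ hδ h1 h2 h3
  intro N T hN hT hr G Λ E h k
  have hδ0 : (0 : ℝ) < δ := hδ
  have hk : (k : ℕ) < Fintype.card (Fin T) := by simpa using k.2.trans_le hr
  simp only [phiDiag, hk, dif_pos]
  have hE : (avg fun t => avg fun s => ((N : ℝ)⁻¹ • (E * Eᵀ)) t s ^ 2) ≤ ((1 + C) * δ) ^ 2 := by
    have := le_mul_of_sq_le (y := δ ^ 2) hC (by positivity)
      ((sq_avg_le _).trans (h.idio.trans (by rw [← pow_mul])))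
    refine this.trans ?_
    nlinarith [mul_nonneg hC (sq_nonneg δ), mul_nonneg (mul_nonneg hC hC) (sq_nonneg δ)]
  have := le_phi (α := α / 2) (β := β / 2) hN hT (by positivity) (by positivity) (by positivity)
    (mul_le_of_perturbation hA h.loadings (by linarith))
    (mul_le_of_perturbation hB h.factors (by linarith)) hE k.2 hk
  refine le_trans ?_ this
  linarith
end FactorHAC
-- The rotation and its limit up to signs
namespace FactorHAC
variable {N T r : ℕ}
theorem exists_abs_apply_le (M : Matrix (Fin r) (Fin r) ℝ) : ∃ b, 0 ≤ b ∧ ∀ i j, |M i j| ≤ b :=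
  ⟨‖M‖, norm_nonneg _, abs_apply_le_l2_opNorm M⟩
set_option maxHeartbeats 1000000 in
/-- Up to signs and to an error of order `δ`, the rotation is deterministic and the estimated
factors are the rotated factors. -/
theorem exists_rotation_limit {A₀ B₀ : Matrix (Fin r) (Fin r) ℝ} (hA₀ : A₀.PosDef) (hB₀ : B₀.PosDef)
    (heig : HasPositiveDistinctEigenvalues (B₀ * A₀)) :
    ∃ Hs : Matrix (Fin r) (Fin r) ℝ, Hsᵀ * B₀ * Hs = 1 ∧ ∀ C : ℝ, 0 ≤ C → ∃ C' : ℝ, 0 ≤ C' ∧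
      ∀ᶠ δ : ℝ in 𝓝[>] 0, ∀ (N T : ℕ), 1 ≤ N → 1 ≤ T → r ≤ T →
      ∀ (G : Matrix (Fin T) (Fin r) ℝ) (Λ : Matrix (Fin N) (Fin r) ℝ)
        (E : Matrix (Fin T) (Fin N) ℝ) (Ghat : Matrix (Fin T) (Fin r) ℝ),
        IsRegular A₀ B₀ C δ G Λ E → IsFactorEstimator (G * Λᵀ + E) Ghat →
        ∀ H, H = ((N : ℝ) * T)⁻¹ • ((Λᵀ * Λ) * (Gᵀ * Ghat) * (phiMatrix r (G * Λᵀ + E))⁻¹) →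
        (∃ s : Fin r → ℤˣ, ∀ i k, |H i k - Hs i k * ((s k : ℤ) : ℝ)| ≤ C' * δ) ∧
        ∀ k, avg (fun t => (Ghat t k - (G * H) t k) ^ 4) ≤ C' * δ ^ 4 := by
  obtain ⟨K, d, hd, hdpos, hKA, hKB⟩ := exists_simultaneous_diagonalization hA₀ hB₀ heig
  have hAK : K * (Kᵀ * A₀) = 1 := mul_eq_one_comm.1 (by rw [hKA])
  have hsq : ∀ k, √(d k) * √(d k) = d k := fun k => Real.mul_self_sqrt (hdpos k).le
  have hsp : ∀ k, 0 < √(d k) := fun k => Real.sqrt_pos.2 (hdpos k)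
  have hA₀t : A₀ᵀ = A₀ := by
    have := hA₀.1
    rwa [Matrix.IsHermitian, Matrix.conjTranspose_eq_transpose_of_trivial] at this
  set W : Fin r → ℝ := fun k => (√(d k))⁻¹ with hW
  -- The limit comes from H = A Q Φ⁻¹ with A ≈ A₀, Q ≈ K diag(±√d) and Φ ≈ diag(d).
  refine ⟨A₀ * K * Matrix.diagonal W, ?_, fun C hC => ?_⟩
  · rw [← hKB]
    simp only [Matrix.transpose_mul, Matrix.diagonal_transpose, hA₀t]
    calc Matrix.diagonal W * (Kᵀ * A₀) * (K * Matrix.diagonal d * Kᵀ) *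
          (A₀ * K * Matrix.diagonal W)
        = Matrix.diagonal W * (Kᵀ * A₀ * K) * Matrix.diagonal d * (Kᵀ * A₀ * K) *
          Matrix.diagonal W := by simp only [Matrix.mul_assoc]
      _ = 1 := by
          rw [hKA, Matrix.mul_one, Matrix.mul_one, Matrix.diagonal_mul_diagonal,
            Matrix.diagonal_mul_diagonal, Matrix.diagonal_eq_one]
          ext k
          have := hsq k
          have h2 := (hsp k).ne'
          simp only [hW, Pi.one_apply]
          field_simp
          rw [sq, this]
  obtain ⟨c, hc, hphi⟩ := exists_le_phiDiag hA₀ hB₀ hC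
  obtain ⟨ε₀, hε₀, C₁, hC₁, hsign⟩ := exists_sign_of_near_eigen hd hdpos hc
  obtain ⟨a₀, ha₀, hba⟩ := exists_abs_apply_le A₀
  obtain ⟨b₀, hb₀, hbb⟩ := exists_abs_apply_le B₀
  obtain ⟨p, hp, hbp⟩ := exists_abs_apply_le (Kᵀ * A₀)
  obtain ⟨q, hq, hbq⟩ := exists_abs_apply_le (A₀ * K)
  obtain ⟨w, hw, hbw⟩ : ∃ w, 0 ≤ w ∧ ∀ k, (√(d k))⁻¹ ≤ w :=
    ⟨∑ k, (√(d k))⁻¹, Finset.sum_nonneg fun k _ => (inv_pos.2 (hsp k)).le, fun k =>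
      Finset.single_le_sum (f := fun k => (√(d k))⁻¹) (fun k _ => (inv_pos.2 (hsp k)).le)
        (Finset.mem_univ k)⟩
  -- Constants, each in front of a power of δ: CR for the remainder (with δ⁴), c₂ for its products
  -- with G and Ghat, c₃ for B A - B₀ A₀, c₄ for the normalisation, c₅ for the input of the sign
  -- lemma, c₆ for the error of H times φ.
  set CR := 27 * (2 * C ^ 2 + C) with hCR
  set c₂ := (1 + C) * (1 + CR) with hc₂
  set c₃ := r * (C * (a₀ + C)) + r * (b₀ * C) with hc₃
  set c₄ := r * (r * ((1 + C) * C) * (1 + C)) + c₂ with hc₄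
  set c₅ := r * (p * (r * (c₃ * (1 + C)) + c₂)) + c₄ with hc₅
  set c₆ := r * (C * (1 + C)) + r * (q * (C₁ * c₅)) + q * w * (C₁ * c₅) with hc₆
  have hCR0 : 0 ≤ CR := by positivity
  have hc₂0 : 0 ≤ c₂ := by positivity
  have hc₃0 : 0 ≤ c₃ := by positivity
  have hc₄0 : 0 ≤ c₄ := by positivity
  have hc₅0 : 0 ≤ c₅ := by positivity
  have hc₆0 : 0 ≤ c₆ := by positivity
  refine ⟨c₆ / c + CR / c ^ 4, by positivity, ?_⟩
  filter_upwards [hphi, self_mem_nhdsWithin, eventually_mul_le 1 one_pos,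
    eventually_mul_le c₅ hε₀] with δ hphi hδ hδ1 hδε
  have hδ0 : (0 : ℝ) < δ := hδ
  rw [one_mul] at hδ1
  intro N T hN hT hr G Λ E Ghat h hest H hH
  have hT' : (T : ℝ) ≠ 0 := by positivity
  have hN' : (N : ℝ) ≠ 0 := by positivity
  have hG := hest.avg_sq hT
  obtain ⟨e1, e2, e3⟩ := hest.equations hT
  set A := (N : ℝ)⁻¹ • (Λᵀ * Λ) with hA
  set B := (T : ℝ)⁻¹ • (Gᵀ * G) with hB
  set Q := (T : ℝ)⁻¹ • (Gᵀ * Ghat) with hQ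
  set R := remainder G Λ E Ghat with hR
  set φ := phiDiag r (G * Λᵀ + E) with hφ
  have hφc := hphi N T hN hT hr G Λ E h
  have hφ0 : ∀ k, 0 < φ k := fun k => hc.trans_le (hφc k)
  have hΦ : phiMatrix r (G * Λᵀ + E) = Matrix.diagonal φ := rfl
  rw [hΦ] at e1 e2 e3 hH
  have hinv : (Matrix.diagonal φ)⁻¹ = Matrix.diagonal fun k => (φ k)⁻¹ := by
    refine Matrix.inv_eq_right_inv ?_
    rw [Matrix.diagonal_mul_diagonal, Matrix.diagonal_eq_one]
    ext k
    simp [(hφ0 k).ne']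
  have hH' : H = A * Q * Matrix.diagonal fun k => (φ k)⁻¹ := by
    rw [hH, hinv, hA, hQ]
    simp only [Matrix.smul_mul, Matrix.mul_smul, smul_smul, mul_inv]
    rw [mul_comm]
  have hHφ : ∀ i k, H i k * φ k = (A * Q) i k := fun i k => by
    rw [hH', Matrix.mul_diagonal, mul_assoc, inv_mul_cancel₀ (hφ0 k).ne', mul_one]
  have bA : ∀ i j, |(A - A₀) i j| ≤ C * δ := h.loadings
  have bB : ∀ i j, |(B - B₀) i j| ≤ C * δ := h.factors
  have bA' : ∀ i j, |A i j| ≤ a₀ + C := fun i j => by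
    have h1 := bA i j
    rw [Matrix.sub_apply] at h1
    have h2 : |A i j| ≤ |A i j - A₀ i j| + |A₀ i j| := by
      simpa using abs_add_le (A i j - A₀ i j) (A₀ i j)
    have h3 := hba i j
    nlinarith
  have bQ : ∀ i j, |Q i j| ≤ 1 + C := h.abs_gram_le hC hG
  have bQt : ∀ i j, |Qᵀ i j| ≤ 1 + C := fun i j => bQ j i
  have bR1 : ∀ i j, |((T : ℝ)⁻¹ • (Gᵀ * R)) i j| ≤ c₂ * δ := fun i j =>
    (h.abs_remainder_gram_le hC hδ0.le hG i j).1
  have bR2 : ∀ i j, |((T : ℝ)⁻¹ • (Ghatᵀ * R)) i j| ≤ c₂ * δ := fun i j =>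
    (h.abs_remainder_gram_le hC hδ0.le hG i j).2
  -- The coordinates of Q in the basis K, in which A₀ is the identity and B₀ A₀ acts as diag(d).
  set Z := Kᵀ * A₀ * Q with hZ
  have hQZ : Q = K * Z := by rw [hZ, ← Matrix.mul_assoc, hAK, Matrix.one_mul]
  -- the approximate eigenvalue equation
  have bBA : ∀ i j, |(B * A - B₀ * A₀) i j| ≤ c₃ * δ := fun i j => by
    have e : B * A - B₀ * A₀ = (B - B₀) * A + B₀ * (A - A₀) := by
      simp only [Matrix.sub_mul, Matrix.mul_sub]; abel
    rw [e, Matrix.add_apply]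
    have h1 := abs_mul_apply_le bB bA' i j
    have h2 := abs_mul_apply_le hbb bA i j
    refine (abs_add_le _ _).trans ((add_le_add h1 h2).trans (le_of_eq ?_))
    rw [hc₃]; ring
  have bin : ∀ i j, |((B * A - B₀ * A₀) * Q + (T : ℝ)⁻¹ • (Gᵀ * R)) i j| ≤
      (r * (c₃ * (1 + C)) + c₂) * δ := fun i j => by
    rw [Matrix.add_apply]
    refine (abs_add_le _ _).trans ((add_le_add (abs_mul_apply_le bBA bQ i j) (bR1 i j)).trans
      (le_of_eq ?_))
    ring
  have eZ : Z * Matrix.diagonal φ - Matrix.diagonal d * Z =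
      (Kᵀ * A₀) * ((B * A - B₀ * A₀) * Q + (T : ℝ)⁻¹ • (Gᵀ * R)) := by
    have k1 : Z * Matrix.diagonal φ = (Kᵀ * A₀) * (B * A * Q + (T : ℝ)⁻¹ • (Gᵀ * R)) := by
      rw [hZ, Matrix.mul_assoc, e2]
    have k2 : Matrix.diagonal d * Z = (Kᵀ * A₀) * (B₀ * A₀ * Q) := by
      calc Matrix.diagonal d * Z = (Kᵀ * A₀ * K) * Matrix.diagonal d * Kᵀ * A₀ * Q := by
            rw [hKA, hZ, Matrix.one_mul]; simp only [Matrix.mul_assoc]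
        _ = (Kᵀ * A₀) * ((K * Matrix.diagonal d * Kᵀ) * A₀ * Q) := by
            simp only [Matrix.mul_assoc]
        _ = _ := by rw [hKB]
    rw [k1, k2, ← Matrix.mul_sub, Matrix.sub_mul]
    congr 1
    abel
  have bZ1 : ∀ i k, |Z i k * (φ k - d i)| ≤ c₅ * δ := fun i k => by
    have k1 : Z i k * (φ k - d i) = (Z * Matrix.diagonal φ - Matrix.diagonal d * Z) i k := by
      rw [Matrix.sub_apply, Matrix.mul_diagonal, Matrix.diagonal_mul]; ring
    rw [k1, eZ]
    refine (abs_mul_apply_le hbp bin i k).trans ?_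
    rw [hc₅]
    nlinarith [mul_nonneg hc₄0 hδ0.le]
  -- the approximate normalisation
  have eZZ : Zᵀ * Z - Matrix.diagonal φ =
      -(Qᵀ * (A - A₀) * Q) - (T : ℝ)⁻¹ • (Ghatᵀ * R) := by
    have k1 : Zᵀ * Z = Qᵀ * A₀ * Q := by
      calc Zᵀ * Z = Zᵀ * (Kᵀ * A₀ * K) * Z := by rw [hKA, Matrix.mul_one]
        _ = (K * Z)ᵀ * A₀ * (K * Z) := by
            rw [Matrix.transpose_mul K Z]; simp only [Matrix.mul_assoc]
        _ = _ := by rw [← hQZ]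
    rw [k1, e3, Matrix.mul_sub, Matrix.sub_mul]
    abel
  have bZ2 : ∀ j k, |∑ i, Z i j * Z i k - if j = k then φ k else 0| ≤ c₅ * δ := fun j k => by
    have k1 : ∑ i, Z i j * Z i k - (if j = k then φ k else 0) =
        (Zᵀ * Z - Matrix.diagonal φ) j k := by
      rw [Matrix.sub_apply, Matrix.mul_apply, Matrix.diagonal_apply]
      congr 1
      split_ifs with hjk
      · rw [hjk]
      · rfl
    rw [k1, eZZ, Matrix.sub_apply, Matrix.neg_apply]
    have h1 := abs_mul_apply_le (abs_mul_apply_le bQt bA) bQ j k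
    have h2 := bR2 j k
    have h3 : 0 ≤ r * (p * (r * (c₃ * (1 + C)) + c₂)) * δ := by positivity
    calc _ ≤ |-(Qᵀ * (A - A₀) * Q) j k| + |((T : ℝ)⁻¹ • (Ghatᵀ * R)) j k| := abs_sub _ _
      _ ≤ r * (r * ((1 + C) * (C * δ)) * (1 + C)) + c₂ * δ := by
          rw [abs_neg]; exact add_le_add h1 h2
      _ = c₄ * δ := by rw [hc₄]; ring
      _ ≤ _ := by rw [hc₅]; linarith
  obtain ⟨s, hs1, hs2⟩ := hsign (c₅ * δ) (by positivity) hδε φ Z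
    (phiDiag_antitone hr _) hφc bZ1 bZ2
  have hs : ∀ k, |((s k : ℤ) : ℝ)| = 1 := fun k => by
    rcases Int.units_eq_one_or (s k) with h | h <;> simp [h]
  refine ⟨⟨s, fun i k => ?_⟩, fun k => ?_⟩
  · set M : Matrix (Fin r) (Fin r) ℝ := Matrix.diagonal fun k => ((s k : ℤ) : ℝ) * √(d k) with hM
    have bZM : ∀ i k, |(Z - M) i k| ≤ C₁ * (c₅ * δ) := fun i k => by
      have k1 : M i k = if i = k then ((s k : ℤ) : ℝ) * √(d k) else 0 := by
        rw [hM, Matrix.diagonal_apply]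
        split_ifs with hik
        · rw [hik]
        · rfl
      rw [Matrix.sub_apply, k1]
      exact hs2 i k
    have eAQ : A * Q - A₀ * K * M = (A - A₀) * Q + A₀ * K * (Z - M) := by
      rw [Matrix.mul_sub, Matrix.sub_mul, Matrix.mul_assoc A₀ K Z, ← hQZ]
      abel
    -- Multiplication by φ k turns H into A Q; the last term compensates for φ k in place of d k in
    -- the limit.
    have k1 : (H i k - (A₀ * K * Matrix.diagonal W) i k * ((s k : ℤ) : ℝ)) * φ k =
        ((A - A₀) * Q) i k + (A₀ * K * (Z - M)) i k -
          (A₀ * K) i k * (√(d k))⁻¹ * (φ k - d k) * ((s k : ℤ) : ℝ) := by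
      rw [← Matrix.add_apply, ← eAQ, Matrix.sub_apply, sub_mul, hHφ, Matrix.mul_diagonal, hM,
        Matrix.mul_diagonal]
      have := hsq k
      have h2 : (√(d k))⁻¹ * d k = √(d k) := by
        rw [inv_mul_eq_iff_eq_mul₀ (hsp k).ne', this]
      simp only [hW]
      linear_combination (-(A₀ * K) i k * ((s k : ℤ) : ℝ)) * h2
    have k2 : |(H i k - (A₀ * K * Matrix.diagonal W) i k * ((s k : ℤ) : ℝ)) * φ k| ≤ c₆ * δ := by
      rw [k1]
      have h1 := abs_mul_apply_le bA bQ i k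
      have h2 := abs_mul_apply_le hbq bZM i k
      have h3 : |(A₀ * K) i k * (√(d k))⁻¹ * (φ k - d k) * ((s k : ℤ) : ℝ)| ≤
          q * w * (C₁ * (c₅ * δ)) := by
        rw [abs_mul, hs, mul_one, abs_mul, abs_mul, abs_of_pos (inv_pos.2 (hsp k))]
        exact mul_le_mul (mul_le_mul (hbq i k) (hbw k) (inv_pos.2 (hsp k)).le hq) (hs1 k)
          (abs_nonneg _) (by positivity)
      refine (abs_sub _ _).trans ?_
      refine (add_le_add (abs_add_le _ _) h3).trans ?_
      refine (add_le_add (add_le_add h1 h2) le_rfl).trans (le_of_eq ?_)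
      rw [hc₆]; ring
    rw [abs_mul, abs_of_pos (hφ0 k)] at k2
    set x := |H i k - (A₀ * K * Matrix.diagonal W) i k * ((s k : ℤ) : ℝ)|
    have hx : 0 ≤ x := abs_nonneg _
    have k3 : x * c ≤ c₆ * δ := (mul_le_mul_of_nonneg_left (hφc k) hx).trans k2
    have k4 : x ≤ c₆ / c * δ := by
      rw [div_mul_eq_mul_div, le_div_iff₀ hc]; exact k3
    have k5 : 0 ≤ CR / c ^ 4 * δ := by positivity
    linarith
  -- H Φ = A Q, so the eigenvector equation says (Ghat - G H) Φ = R exactly.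
  · have k1 : ∀ t, (Ghat t k - (G * H) t k) * φ k = R t k := fun t => by
      have h1 : (Ghat * Matrix.diagonal φ) t k = (G * A * Q + R) t k := by rw [e1]
      rw [Matrix.mul_diagonal, Matrix.add_apply] at h1
      have h2 : (G * H) t k * φ k = (G * A * Q) t k := by
        rw [hH', ← Matrix.mul_assoc, ← Matrix.mul_assoc, Matrix.mul_diagonal, mul_assoc,
          inv_mul_cancel₀ (hφ0 k).ne', mul_one]
      linarith
    have k2 : ∀ t, (Ghat t k - (G * H) t k) ^ 4 ≤ (c ^ 4)⁻¹ * R t k ^ 4 := fun t => by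
      rw [le_inv_mul_iff₀ (by positivity), ← k1 t, mul_pow, mul_comm]
      have := pow_le_pow_left₀ hc.le (hφc k) 4
      gcongr
    refine (avg_mono k2).trans ?_
    rw [avg_const_mul]
    have k3 := h.avg_remainder_pow_four_le hC hG k
    have k4 : (c ^ 4)⁻¹ * avg (fun t => R t k ^ 4) ≤ (c ^ 4)⁻¹ * (CR * δ ^ 4) := by gcongr
    have k5 : 0 ≤ c₆ / c * δ ^ 4 := by positivity
    refine k4.trans ?_
    have : (c ^ 4)⁻¹ * (CR * δ ^ 4) = CR / c ^ 4 * δ ^ 4 := by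
      field_simp
    linarith
end FactorHAC
-- Stability of the HAC estimator
namespace FactorHAC
variable {N T r : ℕ}
-- Cauchy–Schwarz over the pairs with lag l. Each time occurs at most once as first and once as
-- second member, so the bound is free of l.
theorem sq_lag_sum_le (a b : Fin T → ℝ) (l : ℕ) :
    ((T : ℝ)⁻¹ * ∑ x : Fin T × Fin T with (x.1 : ℕ) = x.2 + l, a x.1 * b x.2) ^ 2 ≤
      (avg fun t => a t ^ 2) * avg fun t => b t ^ 2 := by
  set S : Finset (Fin T × Fin T) := {x | (x.1 : ℕ) = x.2 + l} with hS
  have mem : ∀ x ∈ S, (x.1 : ℕ) = x.2 + l := fun x hx => by simpa [hS] using hx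
  have h1 : ∑ x ∈ S, a x.1 ^ 2 ≤ ∑ t, a t ^ 2 := by
    rw [← Finset.sum_image (s := S) (g := Prod.fst) (f := fun t => a t ^ 2)]
    · exact Finset.sum_le_sum_of_subset_of_nonneg (Finset.subset_univ _) fun _ _ _ => sq_nonneg _
    · intro x hx y hy hxy
      have hx' := mem x hx
      have hy' := mem y hy
      refine Prod.ext hxy (Fin.ext ?_)
      have : (x.1 : ℕ) = y.1 := congrArg _ hxy
      omega
  have h2 : ∑ x ∈ S, b x.2 ^ 2 ≤ ∑ t, b t ^ 2 := by
    rw [← Finset.sum_image (s := S) (g := Prod.snd) (f := fun t => b t ^ 2)]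
    · exact Finset.sum_le_sum_of_subset_of_nonneg (Finset.subset_univ _) fun _ _ _ => sq_nonneg _
    · intro x hx y hy hxy
      have hx' := mem x hx
      have hy' := mem y hy
      refine Prod.ext (Fin.ext ?_) hxy
      have : (x.2 : ℕ) = y.2 := congrArg _ hxy
      omega
  have h3 := Finset.sum_mul_sq_le_sq_mul_sq S (fun x => a x.1) fun x => b x.2
  have h4 : (∑ x ∈ S, a x.1 ^ 2) * ∑ x ∈ S, b x.2 ^ 2 ≤ (∑ t, a t ^ 2) * ∑ t, b t ^ 2 :=
    mul_le_mul h1 h2 (Finset.sum_nonneg fun _ _ => sq_nonneg _)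
      (Finset.sum_nonneg fun _ _ => sq_nonneg _)
  calc _ = ((T : ℝ)⁻¹) ^ 2 * (∑ x ∈ S, a x.1 * b x.2) ^ 2 := by ring
    _ ≤ ((T : ℝ)⁻¹) ^ 2 * ((∑ t, a t ^ 2) * ∑ t, b t ^ 2) := by gcongr; exact h3.trans h4
    _ = _ := by simp only [avg]; ring
theorem abs_lag_sum_le {a b : Fin T → ℝ} {x y : ℝ} (hx : 0 ≤ x) (hy : 0 ≤ y)
    (ha : (avg fun t => a t ^ 2) ≤ x ^ 2) (hb : (avg fun t => b t ^ 2) ≤ y ^ 2) (l : ℕ) :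
    |(T : ℝ)⁻¹ * ∑ x : Fin T × Fin T with (x.1 : ℕ) = x.2 + l, a x.1 * b x.2| ≤ x * y := by
  refine abs_le_of_sq_le_sq ((sq_lag_sum_le a b l).trans ?_) (by positivity)
  rw [mul_pow]
  exact mul_le_mul ha hb (avg_nonneg fun _ => sq_nonneg _) (by positivity)
/-- Stability of sample autocovariances. -/
theorem abs_sampleCov_sub_le {ι : Type*} {S S₀ : Fin T → ι → ℝ} {x y : ℝ} (hx : 0 ≤ x) (hy : 0 ≤ y)
    (hS : ∀ p, (avg fun t => (S t p - S₀ t p) ^ 2) ≤ x ^ 2)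
    (hS₀ : ∀ p, (avg fun t => S₀ t p ^ 2) ≤ y ^ 2) (l : ℕ) (p q : ι) :
    |sampleCov S l p q - sampleCov S₀ l p q| ≤ 2 * (x * y) + x ^ 2 := by
  have h1 := abs_lag_sum_le hx hy (hS p) (hS₀ q) l
  have h2 := abs_lag_sum_le hy hx (hS₀ p) (hS q) l
  have h3 := abs_lag_sum_le hx hx (hS p) (hS q) l
  have e : sampleCov S l p q - sampleCov S₀ l p q =
      (T : ℝ)⁻¹ * (∑ x : Fin T × Fin T with (x.1 : ℕ) = x.2 + l,
        (S x.1 p - S₀ x.1 p) * S₀ x.2 q) +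
      (T : ℝ)⁻¹ * (∑ x : Fin T × Fin T with (x.1 : ℕ) = x.2 + l,
        S₀ x.1 p * (S x.2 q - S₀ x.2 q)) +
      (T : ℝ)⁻¹ * (∑ x : Fin T × Fin T with (x.1 : ℕ) = x.2 + l,
        (S x.1 p - S₀ x.1 p) * (S x.2 q - S₀ x.2 q)) := by
    simp only [sampleCov, Matrix.of_apply]
    rw [← mul_sub, ← mul_add, ← mul_add, ← Finset.sum_sub_distrib, ← Finset.sum_add_distrib,
      ← Finset.sum_add_distrib]
    congr 1
    exact Finset.sum_congr rfl fun _ _ => by ring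
  rw [e]
  refine (abs_add_le _ _).trans ?_
  have := abs_add_le ((T : ℝ)⁻¹ * (∑ x : Fin T × Fin T with (x.1 : ℕ) = x.2 + l,
        (S x.1 p - S₀ x.1 p) * S₀ x.2 q))
      ((T : ℝ)⁻¹ * (∑ x : Fin T × Fin T with (x.1 : ℕ) = x.2 + l,
        S₀ x.1 p * (S x.2 q - S₀ x.2 q)))
  nlinarith
theorem scoreVec_apply (U : Matrix (Fin T) (Fin r) ℝ) (t : Fin T) (p : VechIdx r) :
    scoreVec U t p = U t p.1.1 * U t p.1.2 - (1 : Matrix (Fin r) (Fin r) ℝ) p.1.1 p.1.2 := by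
  simp [scoreVec, vech, Matrix.vecMulVec_apply]
theorem sq_avg_sq_mul_sq_le {a b : Fin T → ℝ} {x y : ℝ} (hx : 0 ≤ x)
    (ha : (avg fun t => a t ^ 4) ≤ x) (hb : (avg fun t => b t ^ 4) ≤ y) :
    (avg fun t => a t ^ 2 * b t ^ 2) ^ 2 ≤ x * y := by
  refine (sq_avg_mul_le _ _).trans ?_
  simp only [← pow_mul]
  exact mul_le_mul ha hb (avg_nonneg fun _ => by rw [pow_mul]; positivity) hx
/-- Stability of the scores. -/
theorem avg_scoreVec_sub_sq_le {U V : Matrix (Fin T) (Fin r) ℝ} {c C δ : ℝ} (hc : 0 ≤ c)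
    (hC : 0 ≤ C) (hδ : 0 ≤ δ) (hδ1 : δ ≤ 1)
    (hUV : ∀ k, (avg fun t => (U t k - V t k) ^ 4) ≤ c * δ ^ 4)
    (hV : ∀ k, (avg fun t => V t k ^ 4) ≤ C) (p : VechIdx r) :
    (avg fun t => (scoreVec U t p - scoreVec V t p) ^ 2) ≤
      (3 * (3 + 2 * (c * C) + c ^ 2) * δ) ^ 2 := by
  obtain ⟨⟨i, j⟩, hij⟩ := p
  set D : Fin r → Fin T → ℝ := fun k t => U t k - V t k with hD
  have k1 : (avg fun t => D i t ^ 2 * V t j ^ 2) ≤ (1 + c * C) * δ ^ 2 :=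
    le_mul_of_sq_le (by positivity) (by positivity)
      ((sq_avg_sq_mul_sq_le (by positivity) (hUV i) (hV j)).trans (le_of_eq (by ring)))
  have k2 : (avg fun t => D j t ^ 2 * V t i ^ 2) ≤ (1 + c * C) * δ ^ 2 :=
    le_mul_of_sq_le (by positivity) (by positivity)
      ((sq_avg_sq_mul_sq_le (by positivity) (hUV j) (hV i)).trans (le_of_eq (by ring)))
  have k3 : (avg fun t => D i t ^ 2 * D j t ^ 2) ≤ (1 + c ^ 2) * δ ^ 2 := by
    refine le_mul_of_sq_le (by positivity) (by positivity)
      ((sq_avg_sq_mul_sq_le (by positivity) (hUV i) (hUV j)).trans ?_)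
    have : δ ^ 4 ≤ 1 := pow_le_one₀ hδ hδ1
    have h5 : 0 ≤ c ^ 2 * δ ^ 4 := by positivity
    nlinarith
  -- U_i U_j - V_i V_j = D_i V_j + D_j V_i + D_i D_j with D = U - V; the centring cancels.
  have key : ∀ t, (scoreVec U t ⟨(i, j), hij⟩ - scoreVec V t ⟨(i, j), hij⟩) ^ 2 ≤
      3 * (D i t ^ 2 * V t j ^ 2 + D j t ^ 2 * V t i ^ 2 + D i t ^ 2 * D j t ^ 2) := fun t => by
    have e : scoreVec U t ⟨(i, j), hij⟩ - scoreVec V t ⟨(i, j), hij⟩ =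
        D i t * V t j + D j t * V t i + D i t * D j t := by
      rw [scoreVec_apply, scoreVec_apply]
      simp only [hD]
      ring
    rw [e]
    nlinarith [sq_nonneg (D i t * V t j - D j t * V t i), sq_nonneg (D i t * V t j - D i t * D j t),
      sq_nonneg (D j t * V t i - D i t * D j t)]
  refine (avg_mono key).trans ?_
  rw [avg_const_mul, avg_add, avg_add]
  have h1 : 1 ≤ 3 * (3 + 2 * (c * C) + c ^ 2) := by nlinarith [mul_nonneg hc hC, sq_nonneg c]
  calc _ ≤ 3 * (3 + 2 * (c * C) + c ^ 2) * δ ^ 2 := by linarith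
    _ ≤ (3 * (3 + 2 * (c * C) + c ^ 2)) ^ 2 * δ ^ 2 := by
        refine mul_le_mul_of_nonneg_right ?_ (sq_nonneg _)
        nlinarith
    _ = _ := by ring
theorem avg_scoreVec_sq_le {V : Matrix (Fin T) (Fin r) ℝ} {C : ℝ} (hC : 0 ≤ C)
    (hV : ∀ k, (avg fun t => V t k ^ 4) ≤ C) (p : VechIdx r) :
    (avg fun t => scoreVec V t p ^ 2) ≤ (2 + 2 * C) ^ 2 := by
  obtain ⟨⟨i, j⟩, hij⟩ := p
  have k1 : (avg fun t => V t i ^ 2 * V t j ^ 2) ≤ C :=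
    le_of_sq_le_sq ((sq_avg_sq_mul_sq_le hC (hV i) (hV j)).trans (by rw [sq])) hC
  have key : ∀ t, scoreVec V t ⟨(i, j), hij⟩ ^ 2 ≤ 2 * (V t i ^ 2 * V t j ^ 2) + 2 := fun t => by
    rw [scoreVec_apply]
    have h1 : (1 : Matrix (Fin r) (Fin r) ℝ) i j = 0 ∨ (1 : Matrix (Fin r) (Fin r) ℝ) i j = 1 := by
      rw [Matrix.one_apply]; split_ifs <;> simp
    rcases h1 with h1 | h1 <;> simp only [h1] <;>
      nlinarith [sq_nonneg (V t i * V t j + 1), sq_nonneg (V t i * V t j)]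
  refine (avg_mono key).trans ?_
  rw [avg_add, avg_const_mul]
  have := avg_const_le (T := T) 2 zero_le_two
  nlinarith
/-- The linear map that `S ↦ H₀ᵀ S H₀` induces on half-vectorisations. -/
noncomputable def congrMatrix (H₀ : Matrix (Fin r) (Fin r) ℝ) : Matrix (VechIdx r) (VechIdx r) ℝ :=
  elimMatrix r * (H₀ᵀ ⊗ₖ H₀ᵀ) * dupMatrix r
theorem congrMatrix_mulVec_vech (H₀ : Matrix (Fin r) (Fin r) ℝ) {S : Matrix (Fin r) (Fin r) ℝ}
    (hS : S.IsSymm) : congrMatrix H₀ *ᵥ vech S = vech (H₀ᵀ * S * H₀) := by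
  rw [congrMatrix, ← Matrix.mulVec_mulVec, ← Matrix.mulVec_mulVec, dupMatrix_mulVec_vech S hS,
    Matrix.kronecker_mulVec_vec, elimMatrix_mulVec_vec, Matrix.transpose_transpose]
theorem longRunV_eq (H₀ : Matrix (Fin r) (Fin r) ℝ) (D : Matrix (VechIdx r) (VechIdx r) ℝ) :
    longRunV H₀ D = congrMatrix H₀ * D * (congrMatrix H₀)ᵀ := by
  simp only [longRunV, congrMatrix, Matrix.transpose_mul, Matrix.mul_assoc,
    ← Matrix.kroneckerMap_transpose, Matrix.transpose_transpose]
-- The normalisation of H₀ turns the centring at B₀ of the original scores into centring at the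
-- identity of the rotated ones.
theorem congrMatrix_mulVec_score {H₀ B₀ : Matrix (Fin r) (Fin r) ℝ} (hB₀ : B₀.IsSymm)
    (hH : H₀ᵀ * B₀ * H₀ = 1) (G : Matrix (Fin T) (Fin r) ℝ) (t : Fin T) :
    congrMatrix H₀ *ᵥ vech (Matrix.vecMulVec (G t) (G t) - B₀) = scoreVec (G * H₀) t := by
  have hs : (Matrix.vecMulVec (G t) (G t) - B₀).IsSymm := by
    refine Matrix.IsSymm.sub ?_ hB₀
    rw [Matrix.IsSymm, Matrix.transpose_vecMulVec]
  rw [congrMatrix_mulVec_vech H₀ hs, Matrix.mul_sub, Matrix.sub_mul, hH, scoreVec,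
    Matrix.mul_vecMulVec, Matrix.vecMulVec_mul, Matrix.mulVec_transpose]
  rfl
theorem avg_mul_apply_pow_four_le {G : Matrix (Fin T) (Fin r) ℝ} {M : Matrix (Fin r) (Fin r) ℝ}
    {C b : ℝ} (hG : (avg fun t => rowSq G t ^ 2) ≤ C) (hM : ∀ i j, |M i j| ≤ b) (k : Fin r) :
    (avg fun t => (G * M) t k ^ 4) ≤ r ^ 2 * b ^ 4 * C := by
  have key : ∀ t, (G * M) t k ^ 4 ≤ r ^ 2 * b ^ 4 * rowSq G t ^ 2 := fun t => by
    have h1 : ((G * M) t k) ^ 2 ≤ rowSq G t * (r * b ^ 2) := by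
      rw [Matrix.mul_apply]
      refine (Finset.sum_mul_sq_le_sq_mul_sq _ _ _).trans ?_
      refine mul_le_mul_of_nonneg_left ?_ (rowSq_nonneg G t)
      calc ∑ j, M j k ^ 2 ≤ ∑ _j : Fin r, b ^ 2 := Finset.sum_le_sum fun j _ => by
            rw [← sq_abs]
            exact pow_le_pow_left₀ (abs_nonneg _) (hM j k) 2
        _ = _ := by simp
    calc (G * M) t k ^ 4 = ((G * M) t k ^ 2) ^ 2 := by ring
      _ ≤ (rowSq G t * (r * b ^ 2)) ^ 2 := by gcongr
      _ = _ := by ring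
  refine (avg_mono key).trans ?_
  rw [avg_const_mul]
  gcongr
/-- The HAC estimator is within order `m δ` of the one that uses the rotated true factors. -/
theorem exists_abs_hacEstimator_sub_le (H₀ : Matrix (Fin r) (Fin r) ℝ) {C C' : ℝ}
    (hC : 0 ≤ C) (hC' : 0 ≤ C') : ∃ C'' : ℝ, 0 ≤ C'' ∧ ∀ δ : ℝ, 0 ≤ δ → δ ≤ 1 →
      ∀ (T : ℕ) (G Ghat : Matrix (Fin T) (Fin r) ℝ) (H : Matrix (Fin r) (Fin r) ℝ),
        (avg fun t => rowSq G t ^ 2) ≤ C → (∀ i k, |H i k - H₀ i k| ≤ C' * δ) →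
        (∀ k, (avg fun t => (Ghat t k - (G * H) t k) ^ 4) ≤ C' * δ ^ 4) →
        ∀ m : ℕ, 1 ≤ m → ∀ p q, |hacEstimator Ghat m p q - hacEstimator (G * H₀) m p q| ≤
          C'' * (m * δ) := by
  obtain ⟨b, hb, hbH⟩ := exists_abs_apply_le H₀
  -- From Ghat - G H₀ = (Ghat - G H) + G (H - H₀) and (x + y)⁴ ≤ 8 (x⁴ + y⁴).
  set c := 8 * (C' + r ^ 2 * C' ^ 4 * C) with hc
  set CV := r ^ 2 * b ^ 4 * C with hCV
  have hc0 : 0 ≤ c := by positivity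
  have hCV0 : 0 ≤ CV := by positivity
  set x := 3 * (3 + 2 * (c * CV) + c ^ 2) with hx
  set y := 2 + 2 * CV with hy
  have hx0 : 0 ≤ x := by positivity
  have hy0 : 0 ≤ y := by positivity
  -- There are 2 (m + 1) ≤ 4 m autocovariance errors, each at most (2 x y + x²) δ.
  refine ⟨4 * (2 * (x * y) + x ^ 2), by positivity, fun δ hδ hδ1 T G Ghat H hG hH hd m hm p q => ?_⟩
  have hUV : ∀ k, (avg fun t => (Ghat t k - (G * H₀) t k) ^ 4) ≤ c * δ ^ 4 := fun k => by
    have h1 : ∀ t, (Ghat t k - (G * H₀) t k) ^ 4 ≤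
        8 * ((Ghat t k - (G * H) t k) ^ 4 + (G * (H - H₀)) t k ^ 4) := fun t => by
      have e : Ghat t k - (G * H₀) t k = (Ghat t k - (G * H) t k) + (G * (H - H₀)) t k := by
        rw [Matrix.mul_sub, Matrix.sub_apply]; ring
      rw [e]
      exact add_pow_four_le _ _
    refine (avg_mono h1).trans ?_
    rw [avg_const_mul, avg_add]
    have h2 := avg_mul_apply_pow_four_le (M := H - H₀) hG hH k
    have h3 := hd k
    rw [hc]
    nlinarith
  have hV := avg_mul_apply_pow_four_le (M := H₀) hG hbH
  have hS := avg_scoreVec_sub_sq_le hc0 hCV0 hδ hδ1 hUV hV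
  have hS₀ := avg_scoreVec_sq_le hCV0 hV
  have hcov := abs_sampleCov_sub_le (x := x * δ) (by positivity) hy0 hS hS₀
  have hcov' : ∀ l p q, |sampleCov (scoreVec Ghat) l p q - sampleCov (scoreVec (G * H₀)) l p q| ≤
      (2 * (x * y) + x ^ 2) * δ := fun l p q => by
    refine (hcov l p q).trans ?_
    have : δ ^ 2 ≤ δ := by nlinarith
    nlinarith [mul_le_mul_of_nonneg_left this (sq_nonneg x)]
  rw [hacEstimator_eq_bartlett, hacEstimator_eq_bartlett]
  refine (abs_bartlett_sub_le _ _ m p q).trans ?_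
  refine (Finset.sum_le_sum fun l _ => add_le_add (hcov' l p q) (hcov' l q p)).trans ?_
  rw [Finset.sum_const, Finset.card_range, nsmul_eq_mul]
  push_cast
  have hm' : (1 : ℝ) ≤ m := by exact_mod_cast hm
  have h0 : 0 ≤ (2 * (x * y) + x ^ 2) * δ := by positivity
  nlinarith
end FactorHAC
-- From moments to probabilities
namespace FactorHAC
section Moments
variable {Ω : Type*} [MeasurableSpace Ω] {μ : Measure Ω}
-- Markov's inequality, with the threshold chosen to make the exceptional probability η.
theorem measure_lt_le_of_integral_le [IsFiniteMeasure μ] {X : Ω → ℝ} (hX : Integrable X μ)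
    (h0 : ∀ ω, 0 ≤ X ω) {a η : ℝ} (ha : ∫ ω, X ω ∂μ ≤ a) (hη : 0 < η) (ha0 : 0 < a) :
    μ {ω | a / η < X ω} ≤ ENNReal.ofReal η := by
  have h1 := mul_meas_ge_le_integral_of_nonneg (Eventually.of_forall h0) hX (a / η)
  have h2 : μ.real {ω | a / η ≤ X ω} ≤ η := by
    have h3 : a / η * μ.real {ω | a / η ≤ X ω} ≤ a / η * η := by
      rw [div_mul_cancel₀ _ hη.ne']
      exact h1.trans ha
    exact le_of_mul_le_mul_left h3 (by positivity)
  calc μ {ω | a / η < X ω} ≤ μ {ω | a / η ≤ X ω} :=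
        measure_mono fun ω (h : a / η < X ω) => h.le
    _ = ENNReal.ofReal (μ.real {ω | a / η ≤ X ω}) := by
        rw [ofReal_measureReal]
    _ ≤ _ := ENNReal.ofReal_le_ofReal h2
theorem pow_four_le_one_add_rpow {x p : ℝ} (hx : 0 ≤ x) (hp : 4 ≤ p) : x ^ 4 ≤ 1 + x ^ p := by
  rcases le_total x 1 with h | h
  · have h1 := pow_le_one₀ (n := 4) hx h
    have h2 := Real.rpow_nonneg hx p
    linarith
  · have h1 := Real.rpow_le_rpow_of_exponent_le h hp
    rw [show (4 : ℝ) = ((4 : ℕ) : ℝ) by norm_num, Real.rpow_natCast] at h1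
    linarith
/-- A bound on a moment of order at least four, on the scale `√n`, bounds the fourth moment. -/
theorem integral_norm_pow_four_le [IsProbabilityMeasure μ] {E : Type*} [NormedAddCommGroup E]
    {v : Ω → E} (hv : AEStronglyMeasurable v μ) {p q c n : ℝ} (hp : 4 ≤ p) (hq : q = p / 2)
    (hc : 0 ≤ c) (hn : 0 < n) (h : absMoment μ v p ≤ ENNReal.ofReal (c * n ^ q)) :
    Integrable (fun ω => ‖v ω‖ ^ 4 / n ^ 2) μ ∧ ∫ ω, ‖v ω‖ ^ 4 / n ^ 2 ∂μ ≤ 1 + c := by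
  have hp0 : 0 ≤ p := by linarith
  have hnq : 0 < n ^ q := Real.rpow_pos_of_pos hn q
  have haes : AEStronglyMeasurable (fun ω => ‖v ω‖ ^ p) μ :=
    (hv.norm.aemeasurable.pow_const p).aestronglyMeasurable
  have hl : ∫⁻ ω, ‖‖v ω‖ ^ p‖ₑ ∂μ = absMoment μ v p := by
    rw [absMoment]
    refine lintegral_congr fun ω => ?_
    rw [Real.enorm_rpow_of_nonneg (norm_nonneg _) hp0, enorm_norm]
  have hint : Integrable (fun ω => ‖v ω‖ ^ p) μ :=
    ⟨haes, by rw [HasFiniteIntegral, hl]; exact h.trans_lt ENNReal.ofReal_lt_top⟩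
  have hle : ∫ ω, ‖v ω‖ ^ p ∂μ ≤ c * n ^ q := by
    have h0 : ∀ ω, 0 ≤ ‖v ω‖ ^ p := fun ω => Real.rpow_nonneg (norm_nonneg _) p
    rw [integral_eq_lintegral_of_nonneg_ae (Eventually.of_forall h0) haes]
    refine ENNReal.toReal_le_of_le_ofReal (by positivity) ?_
    rw [← hl] at h
    refine le_trans (le_of_eq ?_) h
    exact lintegral_congr fun ω => (Real.enorm_of_nonneg (h0 ω)).symm
  -- Apply x⁴ ≤ 1 + x^p to ‖v‖/√n. Since q = p/2, the power n^q is exactly the scale of ‖v‖^p.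
  have hpt : ∀ ω, ‖v ω‖ ^ 4 / n ^ 2 ≤ 1 + (n ^ q)⁻¹ * ‖v ω‖ ^ p := fun ω => by
    have h1 := pow_four_le_one_add_rpow (div_nonneg (norm_nonneg (v ω)) (Real.sqrt_nonneg n)) hp
    have e1 : (‖v ω‖ / √n) ^ 4 = ‖v ω‖ ^ 4 / n ^ 2 := by
      rw [div_pow, show (4 : ℕ) = 2 * 2 by norm_num, pow_mul √n, Real.sq_sqrt hn.le]
    have e2 : (‖v ω‖ / √n) ^ p = (n ^ q)⁻¹ * ‖v ω‖ ^ p := by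
      rw [Real.div_rpow (norm_nonneg _) (Real.sqrt_nonneg _), Real.sqrt_eq_rpow,
        ← Real.rpow_mul hn.le, hq, div_eq_inv_mul]
      congr 3
      ring
    rwa [e1, e2] at h1
  have hdom : Integrable (fun ω => 1 + (n ^ q)⁻¹ * ‖v ω‖ ^ p) μ :=
    (integrable_const _).add (hint.const_mul _)
  have hres : Integrable (fun ω => ‖v ω‖ ^ 4 / n ^ 2) μ := by
    refine hdom.mono' ((hv.norm.aemeasurable.pow_const 4).div_const _).aestronglyMeasurable
      (Eventually.of_forall fun ω => ?_)
    rw [Real.norm_of_nonneg (by positivity)]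
    exact hpt ω
  refine ⟨hres, (integral_mono hres hdom hpt).trans ?_⟩
  rw [integral_add (integrable_const _) (hint.const_mul _), integral_const_mul]
  simp only [integral_const, probReal_univ, smul_eq_mul, mul_one]
  have : (n ^ q)⁻¹ * ∫ ω, ‖v ω‖ ^ p ∂μ ≤ (n ^ q)⁻¹ * (c * n ^ q) := by gcongr
  have e : (n ^ q)⁻¹ * (c * n ^ q) = c := by field_simp
  linarith
theorem integrable_avg {T : ℕ} {φ : Fin T → Ω → ℝ} (h : ∀ t, Integrable (φ t) μ) :
    Integrable (fun ω => avg fun t => φ t ω) μ :=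
  (integrable_finsetSum _ fun t _ => h t).const_mul _
theorem integral_avg_le {T : ℕ} {φ : Fin T → Ω → ℝ} (h : ∀ t, Integrable (φ t) μ) {c : ℝ}
    (hc : 0 ≤ c) (hφ : ∀ t, ∫ ω, φ t ω ∂μ ≤ c) : ∫ ω, avg (fun t => φ t ω) ∂μ ≤ c := by
  have e : ∫ ω, avg (fun t => φ t ω) ∂μ = avg fun t => ∫ ω, φ t ω ∂μ := by
    simp only [avg]
    rw [integral_const_mul, integral_finsetSum _ fun t _ => h t]
  rw [e]
  exact (avg_mono hφ).trans (avg_const_le c hc)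
end Moments
theorem sum_Icc_eq_sum_fin (n : ℕ) (φ : ℕ → ℝ) :
    ∑ i ∈ Finset.Icc 1 n, φ i = ∑ i : Fin n, φ (i + 1) := by
  rw [Fin.sum_univ_eq_sum_range (fun i => φ (i + 1)), sum_Icc_eq_sum_range]
end FactorHAC
-- Regularity holds with high probability
namespace FactorHAC
universe u v
variable {Ω : Type u} {r : ℕ}
/-- The matrix of idiosyncratic components. -/
def idioMatrix (e : ℕ → ℕ → Ω → ℝ) (N T : ℕ) (ω : Ω) : Matrix (Fin T) (Fin N) ℝ :=
  Matrix.of fun t i => e ((i : ℕ) + 1) ((t : ℕ) + 1) ω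
theorem dataMatrix_eq (lam : ℕ → EuclideanSpace ℝ (Fin r)) (g : ℤ → Ω → EuclideanSpace ℝ (Fin r))
    (e : ℕ → ℕ → Ω → ℝ) (N T : ℕ) (ω : Ω) : dataMatrix lam g e N T ω =
      factorMatrix g T ω * (loadingMatrix lam N)ᵀ + idioMatrix e N T ω := rfl
theorem rowSq_factorMatrix (f : ℤ → Ω → EuclideanSpace ℝ (Fin r)) (T : ℕ) (ω : Ω) (t : Fin T) :
    rowSq (factorMatrix f T ω) t = ‖f (((t : ℕ) : ℤ) + 1) ω‖ ^ 2 := by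
  rw [EuclideanSpace.real_norm_sq_eq]
  rfl
theorem rowSq_idio_mul_loading (lam : ℕ → EuclideanSpace ℝ (Fin r)) (e : ℕ → ℕ → Ω → ℝ) (N T : ℕ)
    (ω : Ω) (t : Fin T) :
    rowSq ((N : ℝ)⁻¹ • (idioMatrix e N T ω * loadingMatrix lam N)) t ^ 2 =
      ‖∑ i ∈ Finset.Icc 1 N, e i (t + 1) ω • lam i‖ ^ 4 / (N : ℝ) ^ 2 / (N : ℝ) ^ 2 := by
  have e1 : ‖∑ i ∈ Finset.Icc 1 N, e i (t + 1) ω • lam i‖ ^ 2 =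
      ∑ k, ((idioMatrix e N T ω * loadingMatrix lam N) t k) ^ 2 := by
    rw [EuclideanSpace.real_norm_sq_eq]
    refine Finset.sum_congr rfl fun k _ => ?_
    congr 1
    rw [WithLp.ofLp_sum, Finset.sum_apply, sum_Icc_eq_sum_fin N fun i => (e i (t + 1) ω • lam i) k,
      Matrix.mul_apply]
    rfl
  have e2 : rowSq ((N : ℝ)⁻¹ • (idioMatrix e N T ω * loadingMatrix lam N)) t =
      ((N : ℝ)⁻¹) ^ 2 * ‖∑ i ∈ Finset.Icc 1 N, e i (t + 1) ω • lam i‖ ^ 2 := by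
    rw [e1, rowSq, Finset.mul_sum]
    exact Finset.sum_congr rfl fun k _ => by rw [Matrix.smul_apply, smul_eq_mul, mul_pow]
  rw [e2, mul_pow, ← pow_mul, ← pow_mul]
  simp only [div_eq_mul_inv, inv_pow]
  ring
variable [MeasurableSpace Ω]
theorem idio_gram_apply (μ : Measure Ω) (e : ℕ → ℕ → Ω → ℝ) {N : ℕ} (hN : 1 ≤ N) (T : ℕ) (ω : Ω)
    (t s : Fin T) :
    ((N : ℝ)⁻¹ • (idioMatrix e N T ω * (idioMatrix e N T ω)ᵀ)) t s =
      gammaST μ e N (t + 1) (s + 1) + (N : ℝ)⁻¹ * ∑ i ∈ Finset.Icc 1 N,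
        (e i (s + 1) ω * e i (t + 1) ω - gammaST μ e N (t + 1) (s + 1)) := by
  have hN' : (N : ℝ) ≠ 0 := by positivity
  have e1 : (idioMatrix e N T ω * (idioMatrix e N T ω)ᵀ) t s =
      ∑ i ∈ Finset.Icc 1 N, e i (s + 1) ω * e i (t + 1) ω := by
    rw [sum_Icc_eq_sum_fin N fun i => e i (s + 1) ω * e i (t + 1) ω, Matrix.mul_apply]
    exact Finset.sum_congr rfl fun i _ => mul_comm _ _
  rw [Matrix.smul_apply, e1, Finset.sum_sub_distrib, Finset.sum_const, Nat.card_Icc, smul_eq_mul,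
    nsmul_eq_mul, Nat.add_sub_cancel]
  field_simp
  ring
/-- The second moments of the idiosyncratic components, separated into means and deviations. -/
theorem avg_idio_gram_le {μ : Measure Ω} {e : ℕ → ℕ → Ω → ℝ} {N T : ℕ} (hN : 1 ≤ N) (hT : 1 ≤ T)
    {c : ℝ} (hγ : ∀ s ∈ Finset.Icc 1 T, ∑ t ∈ Finset.Icc 1 T, |gammaST μ e N s t| ≤ c) (ω : Ω) :
    (avg fun t : Fin T => (avg fun s : Fin T =>
        ((N : ℝ)⁻¹ • (idioMatrix e N T ω * (idioMatrix e N T ω)ᵀ)) t s ^ 2) ^ 2) ≤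
      8 * c ^ 4 / (T : ℝ) ^ 2 + 8 / (N : ℝ) ^ 2 * avg fun t : Fin T => avg fun s : Fin T =>
        ‖∑ i ∈ Finset.Icc 1 N, (e i (s + 1) ω * e i (t + 1) ω -
          gammaST μ e N (t + 1) (s + 1))‖ ^ 4 / (N : ℝ) ^ 2 := by
  have hT' : (0 : ℝ) < T := by positivity
  have hN' : (0 : ℝ) < N := by positivity
  set z : Fin T → Fin T → ℝ := fun t s => ∑ i ∈ Finset.Icc 1 N,
    (e i (s + 1) ω * e i (t + 1) ω - gammaST μ e N (t + 1) (s + 1)) with hz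
  set g : Fin T → Fin T → ℝ := fun t s => gammaST μ e N (t + 1) (s + 1) with hg
  have hc : ∀ t s, ((N : ℝ)⁻¹ • (idioMatrix e N T ω * (idioMatrix e N T ω)ᵀ)) t s =
      g t s + (N : ℝ)⁻¹ * z t s := fun t s => idio_gram_apply μ e hN T ω t s
  -- Summability of |γ| over one time index bounds the sum of squares by c², so their average is
  -- O(1/T).
  have hgs : ∀ t, (avg fun s => g t s ^ 2) ≤ c ^ 2 / T := fun t => by
    have h1 := hγ (t + 1) (Finset.mem_Icc.2 ⟨by omega, t.2⟩)
    rw [sum_Icc_eq_sum_fin T fun s => |gammaST μ e N (t + 1) s|] at h1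
    have h2 : ∑ s, |g t s| ^ 2 ≤ (∑ s, |g t s|) ^ 2 :=
      Finset.sum_sq_le_sq_sum_of_nonneg fun s _ => abs_nonneg _
    simp only [sq_abs] at h2
    have h3 : (∑ s, |g t s|) ^ 2 ≤ c ^ 2 :=
      pow_le_pow_left₀ (Finset.sum_nonneg fun _ _ => abs_nonneg _) h1 2
    rw [avg, div_eq_inv_mul]
    gcongr
    exact h2.trans h3
  have key : ∀ t, (avg fun s => (g t s + (N : ℝ)⁻¹ * z t s) ^ 2) ^ 2 ≤
      8 * c ^ 4 / (T : ℝ) ^ 2 + 8 / (N : ℝ) ^ 2 * avg fun s => ‖z t s‖ ^ 4 / (N : ℝ) ^ 2 :=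
    fun t => by
    have h1 : (avg fun s => (g t s + (N : ℝ)⁻¹ * z t s) ^ 2) ≤
        2 * (avg fun s => g t s ^ 2) + 2 * avg fun s => ((N : ℝ)⁻¹ * z t s) ^ 2 := by
      rw [← avg_const_mul, ← avg_const_mul, ← avg_add]
      exact avg_mono fun s => by nlinarith [sq_nonneg (g t s - (N : ℝ)⁻¹ * z t s)]
    set a := avg fun s => g t s ^ 2 with ha
    set b := avg fun s => ((N : ℝ)⁻¹ * z t s) ^ 2 with hb
    have ha0 : 0 ≤ a := avg_nonneg fun _ => sq_nonneg _
    have hb0 : 0 ≤ b := avg_nonneg fun _ => sq_nonneg _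
    have h2 : a ^ 2 ≤ (c ^ 2 / T) ^ 2 := pow_le_pow_left₀ ha0 (hgs t) 2
    have h3 : b ^ 2 ≤ avg fun s => (((N : ℝ)⁻¹ * z t s) ^ 2) ^ 2 := sq_avg_le _
    have h4 : (avg fun s => (((N : ℝ)⁻¹ * z t s) ^ 2) ^ 2) =
        1 / (N : ℝ) ^ 2 * avg fun s => ‖z t s‖ ^ 4 / (N : ℝ) ^ 2 := by
      rw [← avg_const_mul]
      congr 1
      funext s
      rw [Real.norm_eq_abs, (by norm_num : Even 4).pow_abs]
      field_simp
    have h0 : 0 ≤ avg fun s => (g t s + (N : ℝ)⁻¹ * z t s) ^ 2 := avg_nonneg fun _ => sq_nonneg _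
    calc _ ≤ (2 * a + 2 * b) ^ 2 := pow_le_pow_left₀ h0 h1 2
      _ ≤ 8 * a ^ 2 + 8 * b ^ 2 := by nlinarith [sq_nonneg (a - b)]
      _ ≤ 8 * (c ^ 2 / T) ^ 2 + 8 * (1 / (N : ℝ) ^ 2 * avg fun s => ‖z t s‖ ^ 4 / (N : ℝ) ^ 2) := by
          rw [← h4]; linarith
      _ = _ := by ring
  simp only [hc]
  refine (avg_mono key).trans ?_
  rw [avg_add, avg_const_mul]
  have := avg_const_le (T := T) (8 * c ^ 4 / (T : ℝ) ^ 2) (by positivity)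
  linarith
theorem factor_gram_apply (μ : Measure Ω) (f : ℤ → Ω → EuclideanSpace ℝ (Fin r)) {T : ℕ}
    (hT : 1 ≤ T) (ω : Ω) (i j : Fin r) :
    ((T : ℝ)⁻¹ • ((factorMatrix f T ω)ᵀ * factorMatrix f T ω)) i j - sigmaF μ f i j =
      (T : ℝ)⁻¹ * ∑ t : Fin T, centredProd μ f (((t : ℕ) : ℤ) + 1) (i, j) ω := by
  have hT' : (T : ℝ) ≠ 0 := by positivity
  have e : (T : ℝ)⁻¹ * ∑ t : Fin T, centredProd μ f (((t : ℕ) : ℤ) + 1) (i, j) ω =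
      (T : ℝ)⁻¹ * (∑ t : Fin T, factorMatrix f T ω t i * factorMatrix f T ω t j -
        T * sigmaF μ f i j) := by
    simp only [centredProd, Finset.sum_sub_distrib, Finset.sum_const, Finset.card_univ,
      Fintype.card_fin, nsmul_eq_mul]
    rfl
  rw [e, Matrix.smul_apply, Matrix.mul_apply, smul_eq_mul]
  simp only [Matrix.transpose_apply]
  field_simp
/-- With probability arbitrarily close to one, uniformly in the sample sizes, factors and
idiosyncratic components satisfy the deterministic conditions. -/
theorem exists_isRegular {μ : Measure Ω} [IsProbabilityMeasure μ]
    {f : ℤ → Ω → EuclideanSpace ℝ (Fin r)} {D : Matrix (VechIdx r) (VechIdx r) ℝ}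
    {lam : ℕ → EuclideanSpace ℝ (Fin r)} {SΛ : Matrix (Fin r) (Fin r) ℝ} {e : ℕ → ℕ → Ω → ℝ}
    (hf : FactorAssumption.{u, v} 1 μ f D) (hl : LoadingAssumption lam SΛ)
    (he : IdiosyncraticAssumption 1 μ lam e) {η : ℝ} (hη : 0 < η) :
    ∃ C : ℝ, 0 ≤ C ∧ ∀ N T : ℕ, 1 ≤ N → 1 ≤ T →
      μ {ω | ¬ IsRegular SΛ (sigmaF μ f) C (√((min N T : ℕ) : ℝ))⁻¹ (factorMatrix f T ω)
        (loadingMatrix lam N) (idioMatrix e N T ω)} ≤ ENNReal.ofReal η := by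
  obtain ⟨K, hK, hf8, hf2, -⟩ := hf.exists_bounds
  obtain ⟨-, c₁, hc₁, -, hl⟩ := hl
  obtain ⟨ε, c₀, hε, -, hc₀, he⟩ := he
  set a := r ^ 2 * K + (1 + K) + (1 + c₀) + (1 + c₀) with ha
  have ha0 : 0 < a := by positivity
  set M := a / η with hM
  have hM0 : 0 < M := by positivity
  -- Here M is Markov's threshold for the sum of the four statistics below; c₁ serves the loadings,
  -- 1 + M the factors, M the fourth moments and the cross term, 8 (c₀⁴ + M) the idiosyncratic term.
  refine ⟨1 + M + c₁ + 8 * (c₀ ^ 4 + M), by positivity, fun N T hN hT => ?_⟩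
  obtain ⟨h1, h2, h3, h4, -, -⟩ := he N T hN hT
  have hT' : (0 : ℝ) < T := by positivity
  have hN' : (0 : ℝ) < N := by positivity
  have mem : ∀ t : Fin T, (t : ℕ) + 1 ∈ Finset.Icc 1 T := fun t =>
    Finset.mem_Icc.2 ⟨by omega, t.2⟩
  have haes : ∀ i ∈ Finset.Icc 1 N, ∀ t : Fin T, AEStronglyMeasurable (e i (t + 1)) μ :=
    fun i hi t => (h1 i hi _ (mem t)).1.aestronglyMeasurable
  -- the four statistics
  set X₁ : Ω → ℝ := fun ω => ∑ p : Fin r × Fin r, T * ((T : ℝ)⁻¹ *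
    ∑ t : Fin T, centredProd μ f (((t : ℕ) : ℤ) + 1) p ω) ^ 2 with hX₁
  set X₂ : Ω → ℝ := fun ω => avg fun t : Fin T => ‖f (((t : ℕ) : ℤ) + 1) ω‖ ^ 4 with hX₂
  set X₃ : Ω → ℝ := fun ω => avg fun t : Fin T =>
    ‖∑ i ∈ Finset.Icc 1 N, e i (t + 1) ω • lam i‖ ^ 4 / (N : ℝ) ^ 2 with hX₃
  set X₄ : Ω → ℝ := fun ω => avg fun t : Fin T => avg fun s : Fin T =>
    ‖∑ i ∈ Finset.Icc 1 N, (e i (s + 1) ω * e i (t + 1) ω - gammaST μ e N (t + 1) (s + 1))‖ ^ 4 /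
      (N : ℝ) ^ 2 with hX₄
  have n₁ : ∀ ω, 0 ≤ X₁ ω := fun ω => Finset.sum_nonneg fun p _ => by positivity
  have n₂ : ∀ ω, 0 ≤ X₂ ω := fun ω => avg_nonneg fun t => by positivity
  have n₃ : ∀ ω, 0 ≤ X₃ ω := fun ω => avg_nonneg fun t => by positivity
  have n₄ : ∀ ω, 0 ≤ X₄ ω := fun ω => avg_nonneg fun t => avg_nonneg fun s => by positivity
  have i₁ : Integrable X₁ μ :=
    integrable_finsetSum _ fun p _ => ((hf2 T hT p).1.const_mul _)
  have b₁ : ∫ ω, X₁ ω ∂μ ≤ r ^ 2 * K := by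
    rw [hX₁, integral_finsetSum _ fun p _ => ((hf2 T hT p).1.const_mul _)]
    calc _ ≤ ∑ _p : Fin r × Fin r, K := Finset.sum_le_sum fun p _ => by
          rw [integral_const_mul]
          calc _ ≤ (T : ℝ) * (K / T) := mul_le_mul_of_nonneg_left (hf2 T hT p).2 hT'.le
            _ = K := by field_simp
      _ = _ := by
          rw [Finset.sum_const, Finset.card_univ, Fintype.card_prod, Fintype.card_fin, nsmul_eq_mul]
          push_cast
          ring
  have f4 : ∀ t, Integrable (fun ω => ‖f t ω‖ ^ 4) μ ∧ ∫ ω, ‖f t ω‖ ^ 4 ∂μ ≤ 1 + K := fun t => by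
    obtain ⟨k1, k2⟩ := hf8 t
    have pt : ∀ ω, ‖f t ω‖ ^ 4 ≤ 1 + ‖f t ω‖ ^ 8 := fun ω => by
      nlinarith [sq_nonneg (‖f t ω‖ ^ 4 - 1), sq_nonneg (‖f t ω‖ ^ 4)]
    have dom : Integrable (fun ω => 1 + ‖f t ω‖ ^ 8) μ := (integrable_const _).add k1
    -- Measurability of ‖f‖⁴ is read off that of ‖f‖⁸ by a square root.
    have es : (fun ω => ‖f t ω‖ ^ 4) = fun ω => √(‖f t ω‖ ^ 8) := by
      funext ω
      rw [show ‖f t ω‖ ^ 8 = (‖f t ω‖ ^ 4) ^ 2 by ring, Real.sqrt_sq (by positivity)]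
    have int : Integrable (fun ω => ‖f t ω‖ ^ 4) μ := by
      refine dom.mono' ?_ (Eventually.of_forall fun ω => ?_)
      · rw [es]
        exact Real.continuous_sqrt.comp_aestronglyMeasurable k1.aestronglyMeasurable
      · rw [Real.norm_of_nonneg (by positivity)]
        exact pt ω
    refine ⟨int, (integral_mono int dom pt).trans ?_⟩
    rw [integral_add (integrable_const _) k1]
    simpa using k2
  have i₂ : Integrable X₂ μ := integrable_avg fun t => (f4 _).1
  have b₂ : ∫ ω, X₂ ω ∂μ ≤ 1 + K := integral_avg_le (fun t => (f4 _).1) (by positivity)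
    fun t => (f4 _).2
  have m₃ : ∀ t : Fin T, _ := fun t => integral_norm_pow_four_le (μ := μ)
    (v := fun ω => ∑ i ∈ Finset.Icc 1 N, e i (t + 1) ω • lam i)
    (Finset.aestronglyMeasurable_fun_sum _ fun i hi => (haes i hi t).smul_const _)
    (by linarith : (4 : ℝ) ≤ 8 + ε) (by ring : 4 + ε / 2 = (8 + ε) / 2) hc₀.le hN' (h4 _ (mem t))
  have i₃ : Integrable X₃ μ := integrable_avg fun t => (m₃ t).1
  have b₃ : ∫ ω, X₃ ω ∂μ ≤ 1 + c₀ :=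
    integral_avg_le (fun t => (m₃ t).1) (by positivity) fun t => (m₃ t).2
  have m₄ : ∀ t s : Fin T, _ := fun t s => integral_norm_pow_four_le (μ := μ)
    (v := fun ω => ∑ i ∈ Finset.Icc 1 N,
      (e i (s + 1) ω * e i (t + 1) ω - gammaST μ e N (t + 1) (s + 1)))
    (Finset.aestronglyMeasurable_fun_sum _ fun i hi =>
      ((haes i hi s).mul (haes i hi t)).sub aestronglyMeasurable_const)
    (by linarith : (4 : ℝ) ≤ 4 + ε) (by ring : 2 + ε / 2 = (4 + ε) / 2) hc₀.le hN'
    (h3 _ (mem t) _ (mem s))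
  have i₄ : Integrable X₄ μ := integrable_avg fun t => integrable_avg fun s => (m₄ t s).1
  have b₄ : ∫ ω, X₄ ω ∂μ ≤ 1 + c₀ :=
    integral_avg_le (fun t => integrable_avg fun s => (m₄ t s).1) (by positivity) fun t =>
      integral_avg_le (fun s => (m₄ t s).1) (by positivity) fun s => (m₄ t s).2
  have hX : ∫ ω, (X₁ ω + X₂ ω + X₃ ω + X₄ ω) ∂μ ≤ a := by
    have j₂ : Integrable (fun ω => X₁ ω + X₂ ω) μ := i₁.add i₂
    have j₃ : Integrable (fun ω => X₁ ω + X₂ ω + X₃ ω) μ := j₂.add i₃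
    rw [integral_add j₃ i₄, integral_add j₂ i₃, integral_add i₁ i₂]
    linarith
  -- The statistics are non-negative, so one application of Markov's inequality to their sum bounds
  -- them all.
  refine le_trans (measure_mono fun ω hω => ?_) (measure_lt_le_of_integral_le
    (((i₁.add i₂).add i₃).add i₄) (fun ω => ?_) hX hη ha0)
  · by_contra hcon
    refine hω ?_
    have hXM : X₁ ω + X₂ ω + X₃ ω + X₄ ω ≤ M := not_lt.1 hcon
    have l₁ : X₁ ω ≤ M := by linarith [n₁ ω, n₂ ω, n₃ ω, n₄ ω]
    have l₂ : X₂ ω ≤ M := by linarith [n₁ ω, n₂ ω, n₃ ω, n₄ ω]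
    have l₃ : X₃ ω ≤ M := by linarith [n₁ ω, n₂ ω, n₃ ω, n₄ ω]
    have l₄ : X₄ ω ≤ M := by linarith [n₁ ω, n₂ ω, n₃ ω, n₄ ω]
    set δ := (√((min N T : ℕ) : ℝ))⁻¹ with hδ
    have hmin : (0 : ℝ) < ((min N T : ℕ) : ℝ) := by
      have : 0 < min N T := by omega
      exact_mod_cast this
    have hδ0 : 0 < δ := by positivity
    have hδ2 : δ ^ 2 = (((min N T : ℕ) : ℝ))⁻¹ := by rw [hδ, inv_pow, Real.sq_sqrt hmin.le]
    have hNδ : (N : ℝ)⁻¹ ≤ δ ^ 2 := by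
      rw [hδ2]
      gcongr
      exact min_le_left _ _
    have hTδ : (T : ℝ)⁻¹ ≤ δ ^ 2 := by
      rw [hδ2]
      gcongr
      exact min_le_right _ _
    have hNδ4 : ((N : ℝ) ^ 2)⁻¹ ≤ δ ^ 4 := by
      calc _ = ((N : ℝ)⁻¹) ^ 2 := by rw [inv_pow]
        _ ≤ (δ ^ 2) ^ 2 := by gcongr
        _ = _ := by ring
    have hTδ4 : ((T : ℝ) ^ 2)⁻¹ ≤ δ ^ 4 := by
      calc _ = ((T : ℝ)⁻¹) ^ 2 := by rw [inv_pow]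
        _ ≤ (δ ^ 2) ^ 2 := by gcongr
        _ = _ := by ring
    have hδ4 : 0 ≤ δ ^ 4 := by positivity
    refine ⟨fun i j => ?_, fun i j => ?_, ?_, ?_, ?_⟩
    · have k1 := (abs_apply_le_l2_opNorm _ i j).trans (hl N hN)
      rw [Matrix.sub_apply] at k1
      have k2 : (N : ℝ) ^ (-(1 / 2) : ℝ) ≤ δ := by
        refine le_of_sq_le_sq ?_ hδ0.le
        rw [← Real.rpow_natCast, ← Real.rpow_mul hN'.le]
        norm_num
        rw [Real.rpow_neg_one]
        exact hNδ
      have k3 : c₁ * (N : ℝ) ^ (-(1 / 2) : ℝ) ≤ c₁ * δ := by gcongr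
      have k4 : 0 ≤ (1 + M + 8 * (c₀ ^ 4 + M)) * δ := by positivity
      linarith
    · rw [factor_gram_apply μ f hT]
      have k1 : T * ((T : ℝ)⁻¹ * ∑ t : Fin T, centredProd μ f (((t : ℕ) : ℤ) + 1) (i, j) ω) ^ 2 ≤
          M := le_trans (Finset.single_le_sum (f := fun p : Fin r × Fin r => T * ((T : ℝ)⁻¹ *
            ∑ t : Fin T, centredProd μ f (((t : ℕ) : ℤ) + 1) p ω) ^ 2)
            (fun p _ => by positivity) (Finset.mem_univ (i, j))) l₁
      set x := (T : ℝ)⁻¹ * ∑ t : Fin T, centredProd μ f (((t : ℕ) : ℤ) + 1) (i, j) ω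
      have k2 : x ^ 2 ≤ M * δ ^ 2 := by
        calc x ^ 2 = (T : ℝ)⁻¹ * (T * x ^ 2) := by field_simp
          _ ≤ δ ^ 2 * M := by gcongr
          _ = _ := mul_comm _ _
      have k3 := le_mul_of_sq_le (x := |x|) hM0.le hδ0.le (by rw [sq_abs]; exact k2)
      have k4 : 0 ≤ (c₁ + 8 * (c₀ ^ 4 + M)) * δ := by positivity
      linarith
    · simp only [rowSq_factorMatrix, ← pow_mul]
      have k4 : 0 ≤ 1 + c₁ + 8 * (c₀ ^ 4 + M) := by positivity
      have k5 : X₂ ω ≤ 1 + M + c₁ + 8 * (c₀ ^ 4 + M) := by linarith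
      exact k5
    · simp only [rowSq_idio_mul_loading]
      have k1 : (avg fun t : Fin T => ‖∑ i ∈ Finset.Icc 1 N, e i (t + 1) ω • lam i‖ ^ 4 /
          (N : ℝ) ^ 2 / (N : ℝ) ^ 2) = ((N : ℝ) ^ 2)⁻¹ * X₃ ω := by
        rw [hX₃, ← avg_const_mul]
        congr 1
        funext t
        rw [div_eq_inv_mul _ ((N : ℝ) ^ 2)]
      rw [k1]
      have k2 : ((N : ℝ) ^ 2)⁻¹ * X₃ ω ≤ δ ^ 4 * M := by
        gcongr
        exact n₃ ω
      have k4 : 0 ≤ (1 + c₁ + 8 * (c₀ ^ 4 + M)) * δ ^ 4 := by positivity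
      linarith
    · refine (avg_idio_gram_le hN hT h2 ω).trans ?_
      have k1 : ((N : ℝ) ^ 2)⁻¹ * X₄ ω ≤ δ ^ 4 * M := by
        gcongr
        exact n₄ ω
      have k2 : c₀ ^ 4 * ((T : ℝ) ^ 2)⁻¹ ≤ c₀ ^ 4 * δ ^ 4 := by gcongr
      have k4 : 0 ≤ (1 + M + c₁) * δ ^ 4 := by positivity
      calc _ = 8 * (c₀ ^ 4 * ((T : ℝ) ^ 2)⁻¹) + 8 * (((N : ℝ) ^ 2)⁻¹ * X₄ ω) := by
            rw [hX₄]; ring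
        _ ≤ _ := by linarith
  · have := n₁ ω
    have := n₂ ω
    have := n₃ ω
    have := n₄ ω
    simp only [Pi.add_apply]
    linarith
end FactorHAC
-- The rotation in probability
namespace FactorHAC
universe u v
variable {Ω : Type u} {r : ℕ}
-- Φ is diagonal and commutes with the diagonal matrix of signs, so changing signs of eigenvectors
-- only changes signs of columns of H.
theorem rotation_mul_diagonal (lam : ℕ → EuclideanSpace ℝ (Fin r))
    (g : ℤ → Ω → EuclideanSpace ℝ (Fin r)) (e : ℕ → ℕ → Ω → ℝ) (N T : ℕ) (ω : Ω)
    (Ghat : Matrix (Fin T) (Fin r) ℝ) (s : Fin r → ℝ) :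
    rotation lam g e N T ω (Ghat * Matrix.diagonal s) =
      rotation lam g e N T ω Ghat * Matrix.diagonal s := by
  have h : Matrix.diagonal s * (phiMatrix r (dataMatrix lam g e N T ω))⁻¹ =
      (phiMatrix r (dataMatrix lam g e N T ω))⁻¹ * Matrix.diagonal s := by
    rw [phiMatrix_eq, Matrix.inv_diagonal, Matrix.diagonal_mul_diagonal,
      Matrix.diagonal_mul_diagonal]
    simp only [mul_comm]
  simp only [rotation, Matrix.smul_mul, Matrix.mul_assoc]
  rw [h]
theorem norm_le_of_abs_apply_le {ι : Type*} [Fintype ι] [DecidableEq ι] {M : Matrix ι ι ℝ} {b : ℝ}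
    (h : ∀ i j, |M i j| ≤ b) : ‖M‖ ≤ (Fintype.card ι : ℝ) ^ 2 * b := by
  refine (l2_opNorm_le_sum_abs M).trans ?_
  calc ∑ i, ∑ j, |M i j| ≤ ∑ _i : ι, ∑ _j : ι, b :=
        Finset.sum_le_sum fun i _ => Finset.sum_le_sum fun j _ => h i j
    _ = _ := by
        simp only [Finset.sum_const, Finset.card_univ, nsmul_eq_mul]
        ring
/-- The diagonal matrix of a family of signs. -/
def signDiag (s : Fin r → ℤˣ) : Matrix (Fin r) (Fin r) ℝ :=
  Matrix.diagonal fun k => ((s k : ℤ) : ℝ)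
theorem signDiag_mul_self (s : Fin r → ℤˣ) : signDiag s * signDiag s = 1 := by
  rw [signDiag, Matrix.diagonal_mul_diagonal, Matrix.diagonal_eq_one]
  ext k
  rcases Int.units_eq_one_or (s k) with h | h <;> simp [h]
theorem mul_signDiag_congr {H B : Matrix (Fin r) (Fin r) ℝ} (h : Hᵀ * B * H = 1)
    (s : Fin r → ℤˣ) : (H * signDiag s)ᵀ * B * (H * signDiag s) = 1 := by
  have ht : (signDiag s)ᵀ = signDiag s := Matrix.diagonal_transpose _
  calc (H * signDiag s)ᵀ * B * (H * signDiag s) = signDiag s * (Hᵀ * B * H) * signDiag s := by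
        rw [Matrix.transpose_mul, ht]; simp only [Matrix.mul_assoc]
    _ = 1 := by rw [h, Matrix.mul_one, signDiag_mul_self]
/-- A finite family of points that differ from `y` stays away from `y`. -/
theorem exists_separation {ι X : Type*} [Finite ι] [MetricSpace X] (P : ι → X) (y : X) :
    ∃ ρ > 0, ∀ i, dist (P i) y < ρ → P i = y := by
  have hfin : (Set.range P \ {y}).Finite := (Set.finite_range P).subset Set.sdiff_subset
  have hmem : y ∈ (Set.range P \ {y})ᶜ := by simp
  obtain ⟨ρ, hρ, hball⟩ := Metric.isOpen_iff.1 hfin.isClosed.isOpen_compl y hmem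
  refine ⟨ρ, hρ, fun i hi => ?_⟩
  by_contra hne
  exact hball (Metric.mem_ball.2 hi) ⟨Set.mem_range_self i, hne⟩
variable [MeasurableSpace Ω]
theorem isLittleOP_iff {μ : Measure Ω} {X : ℕ → Ω → ℝ} {a : ℕ → ℝ} : IsLittleOP μ X a ↔
    ∀ ε : ℝ, 0 < ε → ∀ η : ℝ, 0 < η →
      ∀ᶠ n in atTop, μ {ω | ε ≤ |X n ω / a n|} ≤ ENNReal.ofReal η := by
  rw [IsLittleOP, tendstoInMeasure_iff_norm]
  simp only [sub_zero, Real.norm_eq_abs]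
  refine forall₂_congr fun ε _ => ?_
  rw [ENNReal.tendsto_nhds_zero]
  constructor
  · intro h η hη
    exact h _ (ENNReal.ofReal_pos.2 hη)
  · intro h x hx
    obtain ⟨η, hη, hηx⟩ := ENNReal.lt_iff_exists_nnreal_btwn.1 hx
    have h1 := h η (by exact_mod_cast hη)
    rw [ENNReal.ofReal_coe_nnreal] at h1
    exact h1.mono fun n hn => hn.trans hηx.le
theorem tendsto_inv_sqrt_min {N T : ℕ → ℕ} (hN : Tendsto N atTop atTop)
    (hT : Tendsto T atTop atTop) :
    Tendsto (fun n => (√((min (N n) (T n) : ℕ) : ℝ))⁻¹) atTop (𝓝[>] 0) := by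
  refine tendsto_inv_atTop_nhdsGT_zero.comp (Real.tendsto_sqrt_atTop.comp
    (tendsto_natCast_atTop_atTop.comp ?_))
  rw [tendsto_atTop]
  intro b
  filter_upwards [tendsto_atTop.1 hN b, tendsto_atTop.1 hT b] with n h1 h2
  exact le_min h1 h2
/-- The estimated factors and their rotation, outside an event of small probability. -/
theorem exists_rotation_close {μ : Measure Ω} [IsProbabilityMeasure μ]
    {f : ℤ → Ω → EuclideanSpace ℝ (Fin r)} {D : Matrix (VechIdx r) (VechIdx r) ℝ}
    {lam : ℕ → EuclideanSpace ℝ (Fin r)} {SΛ : Matrix (Fin r) (Fin r) ℝ} {e : ℕ → ℕ → Ω → ℝ}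
    (hf : FactorAssumption.{u, v} 1 μ f D) (hl : LoadingAssumption lam SΛ)
    (he : IdiosyncraticAssumption 1 μ lam e)
    (heig : HasPositiveDistinctEigenvalues (sigmaF μ f * SΛ)) {N T : ℕ → ℕ}
    (hN : Tendsto N atTop atTop) (hT : Tendsto T atTop atTop) :
    ∃ Hs : Matrix (Fin r) (Fin r) ℝ, Hsᵀ * sigmaF μ f * Hs = 1 ∧ ∀ η : ℝ, 0 < η →
      ∃ C C' : ℝ, 0 ≤ C ∧ 0 ≤ C' ∧ ∀ᶠ n in atTop, ∃ bad : Set Ω, μ bad ≤ ENNReal.ofReal η ∧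
        ∀ ω ∉ bad, (avg fun t => rowSq (factorMatrix f (T n) ω) t ^ 2) ≤ C ∧
          ∀ Ghat : Matrix (Fin (T n)) (Fin r) ℝ,
            IsFactorEstimator (dataMatrix lam f e (N n) (T n) ω) Ghat →
            (∃ s : Fin r → ℤˣ, ∀ i k,
              |(rotation lam f e (N n) (T n) ω Ghat - Hs * signDiag s) i k| ≤
                C' * (√((min (N n) (T n) : ℕ) : ℝ))⁻¹) ∧
            ∀ k, avg (fun t => (Ghat t k -
                (factorMatrix f (T n) ω * rotation lam f e (N n) (T n) ω Ghat) t k) ^ 4) ≤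
              C' * (√((min (N n) (T n) : ℕ) : ℝ))⁻¹ ^ 4 := by
  obtain ⟨Hs, hHs, hrot⟩ := exists_rotation_limit hl.1 hf.posDef heig
  refine ⟨Hs, hHs, fun η hη => ?_⟩
  obtain ⟨C, hC, hreg⟩ := exists_isRegular hf hl he hη
  obtain ⟨C', hC', hev⟩ := hrot C hC
  refine ⟨C, C', hC, hC', ?_⟩
  filter_upwards [(tendsto_inv_sqrt_min hN hT).eventually hev, tendsto_atTop.1 hN 1,
    tendsto_atTop.1 hT 1, tendsto_atTop.1 hT r] with n h hN1 hT1 hTr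
  -- The bad event is the failure of regularity. It does not involve Ghat, so all choices of
  -- eigenvectors are covered at once, measurable or not.
  refine ⟨_, hreg (N n) (T n) hN1 hT1, fun ω hω => ?_⟩
  have hω' := not_not.1 hω
  refine ⟨hω'.fourth, fun Ghat hG => ?_⟩
  rw [dataMatrix_eq] at hG
  obtain ⟨⟨s, hs⟩, hk⟩ := h (N n) (T n) hN1 hT1 hTr _ _ _ Ghat hω' hG
    (rotation lam f e (N n) (T n) ω Ghat) rfl
  refine ⟨⟨s, fun i k => ?_⟩, hk⟩
  rw [Matrix.sub_apply, signDiag, Matrix.mul_diagonal]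
  exact hs i k
/-- The error of the HAC estimator computed from the rotated true factors. -/
theorem norm_hacEstimator_sub_longRunV_le {μ : Measure Ω}
    {f : ℤ → Ω → EuclideanSpace ℝ (Fin r)} {D : Matrix (VechIdx r) (VechIdx r) ℝ}
    {H₀ : Matrix (Fin r) (Fin r) ℝ} (hH₀ : H₀ᵀ * sigmaF μ f * H₀ = 1) {T m : ℕ} {ω : Ω} {b : ℝ}
    (h : ∀ p q, |bartlett (sampleCov (trueScore μ f T ω)) m p q - D p q| ≤ b) :
    ‖hacEstimator (factorMatrix f T ω * H₀) m - longRunV H₀ D‖ ≤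
      ‖congrMatrix H₀‖ * ‖(congrMatrix H₀)ᵀ‖ * ((Fintype.card (VechIdx r) : ℝ) ^ 2 * b) := by
  have hsymm : (sigmaF μ f).IsSymm := by
    ext i j
    simp [sigmaF, mul_comm]
  have hscore : scoreVec (factorMatrix f T ω * H₀) =
      fun t => congrMatrix H₀ *ᵥ trueScore μ f T ω t := by
    funext t
    rw [← congrMatrix_mulVec_score hsymm hH₀]
    rfl
  rw [hacEstimator_eq_bartlett, hscore, sampleCov_mulVec, bartlett_mul_mul_transpose, longRunV_eq,
    ← Matrix.sub_mul, ← Matrix.mul_sub]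
  have h1 := norm_le_of_abs_apply_le (M := bartlett (sampleCov (trueScore μ f T ω)) m - D) h
  calc _ ≤ ‖congrMatrix H₀ * (bartlett (sampleCov (trueScore μ f T ω)) m - D)‖ *
        ‖(congrMatrix H₀)ᵀ‖ := Matrix.l2_opNorm_mul _ _
    _ ≤ ‖congrMatrix H₀‖ * ‖bartlett (sampleCov (trueScore μ f T ω)) m - D‖ *
        ‖(congrMatrix H₀)ᵀ‖ := by gcongr; exact Matrix.l2_opNorm_mul _ _
    _ = ‖congrMatrix H₀‖ * ‖(congrMatrix H₀)ᵀ‖ *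
        ‖bartlett (sampleCov (trueScore μ f T ω)) m - D‖ := by ring
    _ ≤ _ := by gcongr
end FactorHAC
-- Convergence of the rotation and consistency
namespace FactorHAC
universe u v
variable {Ω : Type u} [MeasurableSpace Ω] {r : ℕ}
/-- After a suitable choice of signs, the rotation converges in probability. -/
theorem exists_signs_isPLim {μ : Measure Ω} {f : ℤ → Ω → EuclideanSpace ℝ (Fin r)}
    {lam : ℕ → EuclideanSpace ℝ (Fin r)} {e : ℕ → ℕ → Ω → ℝ} {N T : ℕ → ℕ}
    {Hs : Matrix (Fin r) (Fin r) ℝ} {δ : ℕ → ℝ} (hδ : Tendsto δ atTop (𝓝[>] 0))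
    {Ghat : (n : ℕ) → Ω → Matrix (Fin (T n)) (Fin r) ℝ}
    (h : ∀ η : ℝ, 0 < η → ∃ C : ℝ, ∀ᶠ n in atTop, ∃ bad : Set Ω, μ bad ≤ ENNReal.ofReal η ∧
      ∀ ω ∉ bad, ∃ s : Fin r → ℤˣ, ∀ i k,
        |(rotation lam f e (N n) (T n) ω (Ghat n ω) - Hs * signDiag s) i k| ≤ C * δ n) :
    ∃ s : ℕ → Ω → Fin r → ℝ, (∀ n ω k, s n ω k = 1 ∨ s n ω k = -1) ∧
      IsPLim μ (fun n ω => rotation lam f e (N n) (T n) ω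
        (Ghat n ω * Matrix.diagonal (s n ω))) Hs := by
  -- The signs found on good events come with an event that depends on η. Minimising the distance to
  -- Hs over the finitely many sign patterns gives one choice that serves all η.
  have hmin : ∀ n ω, ∃ s : Fin r → ℤˣ, ∀ s' : Fin r → ℤˣ,
      ‖rotation lam f e (N n) (T n) ω (Ghat n ω * signDiag s) - Hs‖ ≤
        ‖rotation lam f e (N n) (T n) ω (Ghat n ω * signDiag s') - Hs‖ := fun n ω =>
    Finite.exists_min fun s : Fin r → ℤˣ =>
      ‖rotation lam f e (N n) (T n) ω (Ghat n ω * signDiag s) - Hs‖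
  choose s hs using hmin
  refine ⟨fun n ω k => ((s n ω k : ℤ) : ℝ), fun n ω k => ?_, ?_⟩
  · rcases Int.units_eq_one_or (s n ω k) with h | h <;> simp [h]
  rw [IsPLim, isLittleOP_iff]
  intro ε hε η hη
  obtain ⟨C, hC⟩ := h η hη
  filter_upwards [hC, hδ.eventually (eventually_mul_le (r ^ 2 * C) (half_pos hε))] with n hn hnε
  obtain ⟨bad, hbad, hgood⟩ := hn
  refine (measure_mono fun ω hω => ?_).trans hbad
  by_contra hcon
  obtain ⟨s', hs'⟩ := hgood ω hcon
  have h1 : ‖rotation lam f e (N n) (T n) ω (Ghat n ω * signDiag s') - Hs‖ ≤ ε / 2 := by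
    have e1 : rotation lam f e (N n) (T n) ω (Ghat n ω * signDiag s') - Hs =
        (rotation lam f e (N n) (T n) ω (Ghat n ω) - Hs * signDiag s') * signDiag s' := by
      rw [Matrix.sub_mul, Matrix.mul_assoc, signDiag_mul_self, Matrix.mul_one, signDiag,
        rotation_mul_diagonal]
    rw [e1]
    refine (norm_le_of_abs_apply_le (b := C * δ n) fun i k => ?_).trans ?_
    · rw [signDiag, Matrix.mul_diagonal, abs_mul]
      have : |((s' k : ℤ) : ℝ)| = 1 := by
        rcases Int.units_eq_one_or (s' k) with h | h <;> simp [h]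
      rw [this, mul_one]
      exact hs' i k
    · rw [Fintype.card_fin]
      linarith
  have h2 := (hs n ω s').trans h1
  have h3 : ε ≤ |‖rotation lam f e (N n) (T n) ω (Ghat n ω * signDiag (s n ω)) - Hs‖ / 1| := hω
  rw [div_one, abs_of_nonneg (norm_nonneg _)] at h3
  linarith
/-- Consistency of the HAC estimator, at the rate `1 / L`. -/
theorem hacEstimator_isLittleOP {μ : Measure Ω} [IsProbabilityMeasure μ]
    {f : ℤ → Ω → EuclideanSpace ℝ (Fin r)} {D : Matrix (VechIdx r) (VechIdx r) ℝ}
    {lam : ℕ → EuclideanSpace ℝ (Fin r)} {e : ℕ → ℕ → Ω → ℝ} {N T m : ℕ → ℕ} {L : ℕ → ℝ}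
    (hf : FactorAssumption.{u, v} 1 μ f D)
    (hN : Tendsto N atTop atTop) (hT : Tendsto T atTop atTop) (hm : ∀ n, 1 ≤ m n)
    (hL : ∀ n, 0 ≤ L n) (hm₁ : Tendsto (fun n => L n / (m n : ℝ)) atTop (𝓝 0))
    (hm₂ : Tendsto (fun n => (m n : ℝ) * L n / √((min (N n) (T n) : ℕ) : ℝ)) atTop (𝓝 0))
    {Hs H₀ : Matrix (Fin r) (Fin r) ℝ} (hHs : Hsᵀ * sigmaF μ f * Hs = 1)
    {Ghat : (n : ℕ) → Ω → Matrix (Fin (T n)) (Fin r) ℝ}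
    (h : ∀ η : ℝ, 0 < η → ∃ C C' : ℝ, 0 ≤ C ∧ 0 ≤ C' ∧ ∀ᶠ n in atTop, ∃ bad : Set Ω,
      μ bad ≤ ENNReal.ofReal η ∧ ∀ ω ∉ bad,
        (avg fun t => rowSq (factorMatrix f (T n) ω) t ^ 2) ≤ C ∧
        (∃ s : Fin r → ℤˣ, ∀ i k,
          |(rotation lam f e (N n) (T n) ω (Ghat n ω) - Hs * signDiag s) i k| ≤
            C' * (√((min (N n) (T n) : ℕ) : ℝ))⁻¹) ∧
        ∀ k, avg (fun t => (Ghat n ω t k -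
            (factorMatrix f (T n) ω * rotation lam f e (N n) (T n) ω (Ghat n ω)) t k) ^ 4) ≤
          C' * (√((min (N n) (T n) : ℕ) : ℝ))⁻¹ ^ 4)
    (hlim : IsPLim μ (fun n ω => rotation lam f e (N n) (T n) ω (Ghat n ω)) H₀) :
    IsLittleOP μ (fun n ω => ‖hacEstimator (Ghat n ω) (m n) - longRunV H₀ D‖)
      (fun n => (L n)⁻¹) := by
  set δ : ℕ → ℝ := fun n => (√((min (N n) (T n) : ℕ) : ℝ))⁻¹ with hδdef
  have hδ : Tendsto δ atTop (𝓝[>] 0) := tendsto_inv_sqrt_min hN hT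
  -- Only finitely many limits are possible, so those that differ from H₀ keep a distance of at
  -- least ρ.
  obtain ⟨ρ, hρ, hsep⟩ := exists_separation (fun s : Fin r → ℤˣ => Hs * signDiag s) H₀
  rw [IsPLim, isLittleOP_iff] at hlim
  -- on the good event, `H₀` is the signed limit next to the rotation
  have hnear : ∀ η : ℝ, 0 < η → ∃ C C' : ℝ, 0 ≤ C ∧ 0 ≤ C' ∧ ∀ᶠ n in atTop, ∃ bad : Set Ω,
      μ bad ≤ ENNReal.ofReal (2 * η) ∧ ∀ ω ∉ bad,
        (∃ s : Fin r → ℤˣ, Hs * signDiag s = H₀) ∧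
        (avg fun t => rowSq (factorMatrix f (T n) ω) t ^ 2) ≤ C ∧
        (∀ i k, |rotation lam f e (N n) (T n) ω (Ghat n ω) i k - H₀ i k| ≤ C' * δ n) ∧
        ∀ k, avg (fun t => (Ghat n ω t k -
            (factorMatrix f (T n) ω * rotation lam f e (N n) (T n) ω (Ghat n ω)) t k) ^ 4) ≤
          C' * δ n ^ 4 := by
    intro η hη
    obtain ⟨C, C', hC, hC', hev⟩ := h η hη
    refine ⟨C, C', hC, hC', ?_⟩
    filter_upwards [hev, hlim (ρ / 2) (half_pos hρ) η hη,
      hδ.eventually (eventually_mul_le (r ^ 2 * C') (by positivity : 0 < ρ / 4))]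
      with n ⟨bad, hbad, hgood⟩ hn hnρ
    refine ⟨bad ∪ {ω | ρ / 2 ≤ |‖rotation lam f e (N n) (T n) ω (Ghat n ω) - H₀‖ / 1|}, ?_,
      fun ω hω => ?_⟩
    · refine (measure_union_le _ _).trans ((add_le_add hbad hn).trans (le_of_eq ?_))
      rw [← ENNReal.ofReal_add hη.le hη.le, two_mul]
    · rw [Set.mem_union, not_or] at hω
      obtain ⟨h1, ⟨s, hs⟩, h3⟩ := hgood ω hω.1
      have h4 : ‖rotation lam f e (N n) (T n) ω (Ghat n ω) - H₀‖ < ρ / 2 := by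
        have := hω.2
        rw [Set.mem_ofPred_eq, not_le] at this
        rwa [div_one, abs_of_nonneg (norm_nonneg _)] at this
      have h5 : ‖rotation lam f e (N n) (T n) ω (Ghat n ω) - Hs * signDiag s‖ ≤ ρ / 4 := by
        refine (norm_le_of_abs_apply_le hs).trans ?_
        rw [Fintype.card_fin]
        linarith
      -- The rotation is within ρ/2 of H₀ and within ρ/4 of the signed limit. The two are closer
      -- than ρ and hence equal, and H inherits the rate δ towards H₀.
      have h6 : Hs * signDiag s = H₀ := by
        refine hsep s ?_
        have h7 := dist_triangle_left (Hs * signDiag s) H₀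
          (rotation lam f e (N n) (T n) ω (Ghat n ω))
        rw [dist_eq_norm, dist_eq_norm] at h7
        rw [dist_eq_norm] at h7 ⊢
        linarith
      refine ⟨⟨s, h6⟩, h1, fun i k => ?_, h3⟩
      have := hs i k
      rwa [h6] at this
  have hH₀ : H₀ᵀ * sigmaF μ f * H₀ = 1 := by
    -- The claim is deterministic, so one ω outside a bad event of probability at most 1/2 suffices.
    obtain ⟨_, _, _, _, hev⟩ := hnear (1 / 4) (by norm_num)
    obtain ⟨n, bad, hbad, hgood⟩ := hev.exists
    have hne : badᶜ.Nonempty := by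
      by_contra hcon
      rw [Set.not_nonempty_iff_eq_empty, Set.compl_empty_iff] at hcon
      rw [hcon, measure_univ] at hbad
      have : ENNReal.ofReal (2 * (1 / 4)) < 1 := by
        rw [ENNReal.ofReal_lt_one]; norm_num
      exact absurd hbad (not_le.2 this)
    obtain ⟨ω, hω⟩ := hne
    obtain ⟨⟨s, hs⟩, -⟩ := hgood ω hω
    rw [← hs]
    exact mul_signDiag_congr hHs s
  obtain ⟨K, hK, -, -, Y, hY⟩ := hf.exists_bounds
  set d : ℝ := (Fintype.card (VechIdx r) : ℝ) ^ 2 with hd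
  set cJ := ‖congrMatrix H₀‖ * ‖(congrMatrix H₀)ᵀ‖ with hcJ
  have hd0 : 0 ≤ d := by positivity
  have hcJ0 : 0 ≤ cJ := by positivity
  rw [isLittleOP_iff]
  intro ε hε η' hη'
  -- Two thirds of the probability budget go to the estimation of the factors, one third to the
  -- stochastic error of the true scores.
  obtain ⟨η, hη, hηη⟩ : ∃ η : ℝ, 0 < η ∧ 2 * η + η = η' := ⟨η' / 3, by positivity, by ring⟩
  obtain ⟨C, C', hC, hC', hev⟩ := hnear η hη
  obtain ⟨C'', hC'', hhac⟩ := exists_abs_hacEstimator_sub_le H₀ hC hC'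
  set c₁ := d * C'' + cJ * (d * (K / η)) with hc₁
  set c₂ := cJ * (d * K) with hc₂
  have hc₁0 : 0 ≤ c₁ := by positivity
  have hc₂0 : 0 ≤ c₂ := by positivity
  have ht : Tendsto (fun n => c₁ * ((m n : ℝ) * L n / √((min (N n) (T n) : ℕ) : ℝ)) +
      c₂ * (L n / (m n : ℝ))) atTop (𝓝 0) := by
    have := (hm₂.const_mul c₁).add (hm₁.const_mul c₂)
    simpa using this
  filter_upwards [hev, ht.eventually (gt_mem_nhds hε), hδ.eventually (eventually_mul_le 1 one_pos),
    hδ.eventually self_mem_nhdsWithin, tendsto_atTop.1 hT 1, tendsto_atTop.1 hN 1]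
    with n ⟨bad, hbad, hgood⟩ hnε hδ1 hδ0 hT1 hN1
  have hδ0 : 0 < δ n := hδ0
  rw [one_mul] at hδ1
  obtain ⟨⟨hYint, hYle⟩, hYb⟩ := hY (T n) (m n) hT1 (hm n)
  have hT0 : (0 : ℝ) < T n := by exact_mod_cast hT1
  have hm0 : (0 : ℝ) < m n := by exact_mod_cast hm n
  have hmark := measure_lt_le_of_integral_le hYint (fun ω => (hYb ω).1) hYle hη (by positivity)
  have hsub : {ω | ε ≤ |‖hacEstimator (Ghat n ω) (m n) - longRunV H₀ D‖ / (L n)⁻¹|} ⊆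
      bad ∪ {ω | K * ((m n : ℝ) / √(T n : ℝ)) / η < Y (T n) (m n) ω} := by
    intro ω hω
    by_contra hcon
    rw [Set.mem_union, not_or] at hcon
    obtain ⟨hcb, hcY⟩ := hcon
    obtain ⟨-, g1, g2, g3⟩ := hgood ω hcb
    have hcY' : Y (T n) (m n) ω ≤ K * ((m n : ℝ) / √(T n : ℝ)) / η := not_lt.1 hcY
    have hTδ : (m n : ℝ) / √(T n : ℝ) ≤ m n * δ n := by
      rw [div_eq_mul_inv]
      simp only [hδdef]
      have hmin : (0 : ℝ) < ((min (N n) (T n) : ℕ) : ℝ) := by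
        have : 0 < min (N n) (T n) := by omega
        exact_mod_cast this
      gcongr
      exact min_le_right _ _
    have hY1 : Y (T n) (m n) ω ≤ K / η * (m n * δ n) := by
      calc _ ≤ K * ((m n : ℝ) / √(T n : ℝ)) / η := hcY'
        _ = K / η * ((m n : ℝ) / √(T n : ℝ)) := by ring
        _ ≤ _ := by gcongr
    have n1 : ‖hacEstimator (Ghat n ω) (m n) - hacEstimator (factorMatrix f (T n) ω * H₀) (m n)‖ ≤
        d * (C'' * (m n * δ n)) :=
      norm_le_of_abs_apply_le (hhac (δ n) hδ0.le hδ1 (T n) _ (Ghat n ω) _ g1 g2 g3 (m n) (hm n))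
    have n2 : ‖hacEstimator (factorMatrix f (T n) ω * H₀) (m n) - longRunV H₀ D‖ ≤
        cJ * (d * (K / η * (m n * δ n) + K / m n)) :=
      norm_hacEstimator_sub_longRunV_le hH₀ fun p q => ((hYb ω).2 p q).trans (by linarith)
    have n3 : ‖hacEstimator (Ghat n ω) (m n) - longRunV H₀ D‖ ≤
        c₁ * (m n * δ n) + c₂ * (m n : ℝ)⁻¹ := by
      refine (norm_sub_le_norm_sub_add_norm_sub _ _ _).trans ((add_le_add n1 n2).trans
        (le_of_eq ?_))
      rw [hc₁, hc₂]
      ring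
    have n4 : ε ≤ ‖hacEstimator (Ghat n ω) (m n) - longRunV H₀ D‖ * L n := by
      have h1 : ε ≤ |‖hacEstimator (Ghat n ω) (m n) - longRunV H₀ D‖ / (L n)⁻¹| := hω
      rwa [div_inv_eq_mul, abs_of_nonneg (mul_nonneg (norm_nonneg _) (hL n))] at h1
    -- Multiplied by L, the two errors are m L δ and L/m up to constants, which the bandwidth
    -- conditions send to zero.
    have n5 := mul_le_mul_of_nonneg_right n3 (hL n)
    have n6 : (c₁ * (m n * δ n) + c₂ * (m n : ℝ)⁻¹) * L n =
        c₁ * ((m n : ℝ) * L n / √((min (N n) (T n) : ℕ) : ℝ)) + c₂ * (L n / (m n : ℝ)) := by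
      rw [hδdef]
      ring
    linarith
  refine (measure_mono hsub).trans ((measure_union_le _ _).trans
    ((add_le_add hbad hmark).trans (le_of_eq ?_)))
  rw [← ENNReal.ofReal_add (by positivity) hη.le, hηη]
end FactorHAC
-- The proposition
theorem proposition3p1 {Ω : Type*} [MeasurableSpace Ω] (μ : Measure Ω) [IsProbabilityMeasure μ]
    {r : ℕ} (f : ℤ → Ω → EuclideanSpace ℝ (Fin r))
    (D : Matrix (FactorHAC.VechIdx r) (FactorHAC.VechIdx r) ℝ)
    (lam : ℕ → EuclideanSpace ℝ (Fin r)) (SΛ : Matrix (Fin r) (Fin r) ℝ)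
    (e : ℕ → ℕ → Ω → ℝ) (N T γ m : ℕ → ℕ)
    (hfactors : FactorHAC.FactorAssumption 1 μ f D)
    (hloadings : FactorHAC.LoadingAssumption lam SΛ)
    (hidio : FactorHAC.IdiosyncraticAssumption 1 μ lam e)
    (hdep : FactorHAC.DependenceAssumption 1 μ lam f e)
    (heig : FactorHAC.HasPositiveDistinctEigenvalues (FactorHAC.sigmaF μ f * SΛ))
    (hN : Tendsto N atTop atTop) (hT : Tendsto T atTop atTop)
    (hNT : ∃ ε₀ : ℝ, 0 < ε₀ ∧
      Tendsto (fun n => (T n : ℝ) ^ (1 / 2 + ε₀) / (N n : ℝ)) atTop (𝓝 0))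
    (hγ : ∀ n, 1 ≤ γ n ∧ γ n < T n) (hm : ∀ n, 1 ≤ m n)
    (hm₁ : Tendsto (fun n => Real.log ((T n : ℝ) / γ n) / (m n : ℝ)) atTop (𝓝 0))
    (hm₂ : Tendsto (fun n => (m n : ℝ) * Real.log ((T n : ℝ) / γ n) /
      √((min (N n) (T n) : ℕ) : ℝ)) atTop (𝓝 0)) :
    -- up to the signs of the eigenvectors, the probability limit of the rotation exists
    (∃ H₀ : Matrix (Fin r) (Fin r) ℝ,
      ∀ Ghat : (n : ℕ) → Ω → Matrix (Fin (T n)) (Fin r) ℝ,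
        (∀ n ω, r ≤ T n →
          FactorHAC.IsFactorEstimator (FactorHAC.dataMatrix lam f e (N n) (T n) ω) (Ghat n ω)) →
        ∃ s : ℕ → Ω → Fin r → ℝ, (∀ n ω k, s n ω k = 1 ∨ s n ω k = -1) ∧
          FactorHAC.IsPLim μ (fun n ω => FactorHAC.rotation lam f e (N n) (T n) ω
            (Ghat n ω * Matrix.diagonal (s n ω))) H₀) ∧
    -- the HAC estimator, for every choice of eigenvectors whose rotation has a limit
    (∀ (Ghat : (n : ℕ) → Ω → Matrix (Fin (T n)) (Fin r) ℝ) (H₀ : Matrix (Fin r) (Fin r) ℝ),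
      (∀ n ω, r ≤ T n →
        FactorHAC.IsFactorEstimator (FactorHAC.dataMatrix lam f e (N n) (T n) ω) (Ghat n ω)) →
      FactorHAC.IsPLim μ
        (fun n ω => FactorHAC.rotation lam f e (N n) (T n) ω (Ghat n ω)) H₀ →
      FactorHAC.IsLittleOP μ
        (fun n ω => ‖FactorHAC.hacEstimator (Ghat n ω) (m n) - FactorHAC.longRunV H₀ D‖)
        (fun n => (Real.log ((T n : ℝ) / γ n))⁻¹)) := by
  obtain ⟨Hs, hHs, hclose⟩ :=
    FactorHAC.exists_rotation_close hfactors hloadings hidio heig hN hT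
  -- Only for r ≤ T do r orthonormal eigenvectors exist, and this holds eventually.
  have hTr := tendsto_atTop.1 hT r
  refine ⟨⟨Hs, fun Ghat hG => ?_⟩, fun Ghat H₀ hG hlim => ?_⟩
  · refine FactorHAC.exists_signs_isPLim (FactorHAC.tendsto_inv_sqrt_min hN hT) fun η hη => ?_
    obtain ⟨_, C', -, -, hev⟩ := hclose η hη
    refine ⟨C', ?_⟩
    filter_upwards [hev, hTr] with n ⟨bad, hbad, hgood⟩ hn
    exact ⟨bad, hbad, fun ω hω => ((hgood ω hω).2 _ (hG n ω hn)).1⟩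
  · refine FactorHAC.hacEstimator_isLittleOP hfactors hN hT hm (fun n => ?_) hm₁ hm₂ hHs
      (fun η hη => ?_) hlim
    · refine Real.log_nonneg ?_
      have h0 : (0 : ℝ) < γ n := by exact_mod_cast (hγ n).1
      rw [one_le_div h0]
      exact_mod_cast (hγ n).2.le
    · obtain ⟨C, C', hC, hC', hev⟩ := hclose η hη
      refine ⟨C, C', hC, hC', ?_⟩
      filter_upwards [hev, hTr] with n ⟨bad, hbad, hgood⟩ hn
      exact ⟨bad, hbad, fun ω hω => ⟨(hgood ω hω).1, (hgood ω hω).2 _ (hG n ω hn)⟩⟩
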